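/- Let $N\ge 2$, let $\Omega\subset\mathbb{R}^N$ be a bounded domain (nonempty, open, connected) with $C^\infty$ boundary $\partial\Omega$, and let $\sigma$ be the surface measure on $\partial\Omega$. Let $a\in L^\infty(\Omega)$ and $b\in L^\infty(\partial\Omega)$ be nonnegative functions with $$\int_\Omega a\,dx+\int_{\partial\Omega} b\,d\sigma>0,$$ and let $q\in(1,\infty)$. Boundary values of functions in $W^{1,q}(\Omega)$ are understood in the sense of traces. Set $J(w)=\int_\Omega|\nabla w|^q\,dx$ and $$\mathcal{C}_q=\Big\{w\in W^{1,q}(\Omega):\ \int_\Omega a|w|^{q-2}w\,dx+\int_{\partial\Omega}b|w|^{q-2}w\,d\sigma=0\Big\},$$ $$\mathcal{C}_{1q}=\Big\{w\in\mathcal{C}_q:\ \int_\Omega a|w|^{q}\,dx+\int_{\partial\Omega}b|w|^{q}\,d\sigma=1\Big\},$$ $$\lambda_{1q}=\inf_{w\in\mathcal{C}_q\setminus\{0\}}\frac{\int_\Omega|\nabla w|^q\,dx}{\int_\Omega a|w|^q\,dx+\int_{\partial\Omega}b|w|^q\,d\sigma},$$ where a quotient with zero denominator (its numerator is then positive) has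 the value $+\infty$. A number $\lambda\in\mathbb{R}$ is called an eigenvalue of the problem $$-\Delta_q u=\lambda a|u|^{q-2}u\ \text{ in }\Omega,\qquad |\nabla u|^{q-2}\frac{\partial u}{\partial\nu}=\lambda b|u|^{q-2}u\ \text{ on }\partial\Omega,$$ with eigenfunction $u$, if $u\in W^{1,q}(\Omega)\setminus\{0\}$ and $$\int_\Omega|\nabla u|^{q-2}\nabla u\cdot\nabla w\,dx=\lambda\Big(\int_\Omega a|u|^{q-2}uw\,dx+\int_{\partial\Omega}b|u|^{q-2}uw\,d\sigma\Big)\qquad\text{for all } w\in W^{1,q}(\Omega).$$ Then there exists $u_*\in\mathcal{C}_{1q}$ such that $$\mu:=J(u_*)=\min_{w\in\mathcal{C}_{1q}}J(w)>0.$$ Moreover, $\mu=\lambda_{1q}$, the number $\mu$ is the lowest positive eigenvalue of the above problem, and $u_*$ is an eigenfunction corresponding to $\mu$. -/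

import Mathlib

open MeasureTheory Filter Set
open scoped ENNReal ContDiff Topology

noncomputable section

namespace SteklovLike

/-- Euclidean space `ℝ^N` with its Euclidean norm. -/
abbrev Eucl (N : ℕ) : Type := EuclideanSpace ℝ (Fin N)

/-- `Ω` has a smooth (`C^∞`) boundary: near each boundary point, after an orthogonal change of
coordinates `y ↦ (y', y_N)`, the set `Ω` is the region strictly above the graph of a smooth
function of `y'`. -/
def HasSmoothBoundary {N : ℕ} (Ω : Set (Eucl N)) : Prop :=
  ∀ x ∈ frontier Ω, ∃ r : ℝ, 0 < r ∧
    ∃ (e : Eucl N ≃ₗᵢ[ℝ] WithLp 2 (Eucl (N - 1) × ℝ)) (γ : Eucl (N - 1) → ℝ),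
      ContDiff ℝ ∞ γ ∧
        ∀ y ∈ Metric.ball x r, (y ∈ Ω ↔ γ (e y).fst < (e y).snd)

/-- The surface measure `σ` on `∂Ω`: the `(N-1)`-dimensional Hausdorff measure (normalized to
agree with Lebesgue measure on `ℝ^(N-1)`) restricted to the topological boundary of `Ω`. -/
def surfaceMeasure {N : ℕ} (Ω : Set (Eucl N)) : Measure (Eucl N) :=
  (Measure.euclideanHausdorffMeasure (N - 1)).restrict (frontier Ω)

/-- `g` is a weak (distributional) gradient of `u` on `Ω`:
`∫_Ω u ∂_v φ = - ∫_Ω (g · v) φ` for all test functions `φ ∈ C_c^∞(Ω)` and all directions `v`. -/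
def HasWeakGradient {N : ℕ} (Ω : Set (Eucl N)) (u : Eucl N → ℝ) (g : Eucl N → Eucl N) : Prop :=
  LocallyIntegrableOn u Ω volume ∧ LocallyIntegrableOn g Ω volume ∧
    ∀ φ : Eucl N → ℝ, ContDiff ℝ ∞ φ → HasCompactSupport φ → tsupport φ ⊆ Ω →
      ∀ v : Eucl N,
        ∫ x in Ω, u x * fderiv ℝ φ x v = -∫ x in Ω, inner ℝ (g x) v * φ x

/-- The Sobolev space `W^{1,q}(Ω)` (real functions, two functions that agree almost everywhere in
`Ω` representing the same element): `u ∈ L^q(Ω)` with a weak gradient in `L^q(Ω; ℝ^N)`. -/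
def sobolev {N : ℕ} (Ω : Set (Eucl N)) (q : ℝ) : Set (Eucl N → ℝ) :=
  {u | MemLp u (ENNReal.ofReal q) (volume.restrict Ω) ∧
    ∃ g : Eucl N → Eucl N,
      MemLp g (ENNReal.ofReal q) (volume.restrict Ω) ∧ HasWeakGradient Ω u g}

open Classical in
/-- The weak gradient `∇u` on `Ω` (unique up to null sets; `0` if there is none). -/
def weakGrad {N : ℕ} (Ω : Set (Eucl N)) (u : Eucl N → ℝ) : Eucl N → Eucl N :=
  if h : ∃ g, HasWeakGradient Ω u g then h.choose else 0

/-- `t ∈ L^q(∂Ω)` is a trace of `u ∈ W^{1,q}(Ω)`: it is the limit in `L^q(∂Ω)` of the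
restrictions to `∂Ω` of smooth functions `φ_n` on `ℝ^N` with `φ_n → u` in `W^{1,q}(Ω)`. -/
def IsTrace {N : ℕ} (Ω : Set (Eucl N)) (q : ℝ) (u t : Eucl N → ℝ) : Prop :=
  MemLp t (ENNReal.ofReal q) (surfaceMeasure Ω) ∧
    ∃ φ : ℕ → Eucl N → ℝ, (∀ n, ContDiff ℝ ∞ (φ n)) ∧
      Tendsto (fun n => eLpNorm (fun x => φ n x - u x) (ENNReal.ofReal q) (volume.restrict Ω))
        atTop (𝓝 0) ∧
      Tendsto (fun n => eLpNorm (fun x => gradient (φ n) x - weakGrad Ω u x) (ENNReal.ofReal q)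
        (volume.restrict Ω)) atTop (𝓝 0) ∧
      Tendsto (fun n => eLpNorm (fun x => φ n x - t x) (ENNReal.ofReal q) (surfaceMeasure Ω))
        atTop (𝓝 0)

open Classical in
/-- The trace of `u ∈ W^{1,q}(Ω)` on `∂Ω` (unique up to `σ`-null sets; `0` if there is none). -/
def trace {N : ℕ} (Ω : Set (Eucl N)) (q : ℝ) (u : Eucl N → ℝ) : Eucl N → ℝ :=
  if h : ∃ t, IsTrace Ω q u t then h.choose else 0

/-- `J(w) = ∫_Ω |∇w|^q dx`. -/
def energy {N : ℕ} (Ω : Set (Eucl N)) (q : ℝ) (w : Eucl N → ℝ) : ℝ :=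
  ∫ x in Ω, ‖weakGrad Ω w x‖ ^ q

/-- `∫_Ω a |w|^q dx + ∫_{∂Ω} b |w|^q dσ`. -/
def weightedMass {N : ℕ} (Ω : Set (Eucl N)) (q : ℝ) (a b : Eucl N → ℝ) (w : Eucl N → ℝ) : ℝ :=
  (∫ x in Ω, a x * |w x| ^ q) + ∫ x, b x * |trace Ω q w x| ^ q ∂(surfaceMeasure Ω)

/-- `∫_Ω a |u|^{q-2} u w dx + ∫_{∂Ω} b |u|^{q-2} u w dσ`. -/
def weightedForm {N : ℕ} (Ω : Set (Eucl N)) (q : ℝ) (a b : Eucl N → ℝ) (u w : Eucl N → ℝ) : ℝ :=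
  (∫ x in Ω, a x * |u x| ^ (q - 2) * u x * w x) +
    ∫ x, b x * |trace Ω q u x| ^ (q - 2) * trace Ω q u x * trace Ω q w x ∂(surfaceMeasure Ω)

/-- `𝒞_q`: the `w ∈ W^{1,q}(Ω)` with `∫_Ω a |w|^{q-2} w dx + ∫_{∂Ω} b |w|^{q-2} w dσ = 0`. -/
def coneC {N : ℕ} (Ω : Set (Eucl N)) (q : ℝ) (a b : Eucl N → ℝ) : Set (Eucl N → ℝ) :=
  {w | w ∈ sobolev Ω q ∧
    (∫ x in Ω, a x * |w x| ^ (q - 2) * w x) +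
      ∫ x, b x * |trace Ω q w x| ^ (q - 2) * trace Ω q w x ∂(surfaceMeasure Ω) = 0}

/-- `𝒞_{1q}`: the `w ∈ 𝒞_q` with `∫_Ω a |w|^q dx + ∫_{∂Ω} b |w|^q dσ = 1`. -/
def sphereC {N : ℕ} (Ω : Set (Eucl N)) (q : ℝ) (a b : Eucl N → ℝ) : Set (Eucl N → ℝ) :=
  {w | w ∈ coneC Ω q a b ∧ weightedMass Ω q a b w = 1}

/-- `w` is the zero element of `W^{1,q}(Ω)`, that is, it vanishes almost everywhere in `Ω`. -/
def IsZeroOn {N : ℕ} (Ω : Set (Eucl N)) (w : Eucl N → ℝ) : Prop :=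
  w =ᵐ[volume.restrict Ω] 0

/-- `λ_{1q}`: the infimum over `w ∈ 𝒞_q \ {0}` of
`∫_Ω |∇w|^q / (∫_Ω a |w|^q + ∫_{∂Ω} b |w|^q)`, in `[0, ∞]`; a quotient with positive
numerator and zero denominator is `∞`. -/
def lambdaOne {N : ℕ} (Ω : Set (Eucl N)) (q : ℝ) (a b : Eucl N → ℝ) : ℝ≥0∞ :=
  ⨅ w ∈ {w | w ∈ coneC Ω q a b ∧ ¬ IsZeroOn Ω w},
    ENNReal.ofReal (energy Ω q w) / ENNReal.ofReal (weightedMass Ω q a b w)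

/-- `u` is an eigenfunction for `lam` of `-Δ_q u = lam a |u|^{q-2} u` in `Ω`,
`|∇u|^{q-2} ∂u/∂ν = lam b |u|^{q-2} u` on `∂Ω`, in the weak sense. -/
def IsEigenfunction {N : ℕ} (Ω : Set (Eucl N)) (q : ℝ) (a b : Eucl N → ℝ) (lam : ℝ)
    (u : Eucl N → ℝ) : Prop :=
  u ∈ sobolev Ω q ∧ ¬ IsZeroOn Ω u ∧
    ∀ w ∈ sobolev Ω q,
      ∫ x in Ω, ‖weakGrad Ω u x‖ ^ (q - 2) * inner ℝ (weakGrad Ω u x) (weakGrad Ω w x) =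
        lam * weightedForm Ω q a b u w

/-- `lam` is an eigenvalue of that problem. -/
def IsEigenvalue {N : ℕ} (Ω : Set (Eucl N)) (q : ℝ) (a b : Eucl N → ℝ) (lam : ℝ) : Prop :=
  ∃ u, IsEigenfunction Ω q a b lam u

end SteklovLike

end

/-!
The minimisation is carried out abstractly for two linear maps `D` and `M` from a vector space `V`
into `L^q` spaces: `D u = ∇u`, and `M u = (u, trace u)` in `L^q` of the measure `a dx ⊕ b dσ`
(`massMeasure`), so that `‖D u‖^q` is the energy, `‖M u‖^q` the weighted mass, and the constraint
defining the cone is the vanishing of the first variation of `‖M u‖^q` in the direction of the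
constants. By convexity this says that `0` is the best constant approximation of `M u`
(`isCentred_iff_firstVariation_eq_zero`).

*Existence* (`exists_isCentred_minimiser`). The map `M` is compact relative to `D`, so a minimising
sequence has a subsequence along which `M` converges. Convex combinations of its tails still have
the same limit under `M`, and can be chosen so that `D` converges too, by uniform convexity of `L^q`
(`exists_mem_convexHull_tail_cauchySeq`). Being centred and having mass one pass to the limit.

*Euler–Lagrange equation* (`firstVariation_eq_of_minimiser`). With `λ` the minimum,
`λ ‖M v - c M 1‖^q ≤ ‖D v‖^q` holds for every `v` and the best `c`. Since `‖·‖^q` lies above its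
tangent at `M u`, which is flat in the direction of the constants, the function
`t ↦ ‖D u + t D w‖^q - λ (1 + t q B(M u, M w))` is minimal at `t = 0`.

*Analysis on `Ω`.* The boundary charts give a uniform inward cone condition, hence mollifiers that
only look into `Ω`; these yield density of smooth functions (`smoothApprox_of_hasWeakGradient`),
constancy of functions with vanishing gradient (`ae_eq_const_of_hasWeakGradient_zero`) and Rellich
compactness (`totallyBounded_sobolevBall`). Surface measure is at most a constant times the image of
Lebesgue measure under the graph charts, and integrating vertically over a collar of width `h`
bounds `∫ |φ|^q dσ` by `C (h⁻¹ ∫ |φ|^q + h^(q-1) ∫ |∇φ|^q)` (`exists_trace_inequality`). This gives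
the trace operator and, as `h` is free, its compactness. Compactness together with the fact that
only constants have vanishing gradient gives a Poincaré inequality `‖u‖ ≤ C (‖∇u‖ + ‖M u‖)`
(`exists_poincare`).

An eigenfunction for a positive eigenvalue lies in the cone (test with `1`) and has the eigenvalue
as its quotient (test with itself), so no positive eigenvalue is below the minimum.
-/


namespace SteklovLike

/-! ### The `q`-th power of the `L^q` norm -/

section LpPower

variable {X E : Type*} [MeasurableSpace X] {ν : Measure X} [NormedAddCommGroup E] {q : ℝ}

lemma eLpNorm_rpow_eq_lintegral (hq : 0 < q) (f : X → E) :
    eLpNorm f (ENNReal.ofReal q) ν ^ q = ∫⁻ x, ‖f x‖ₑ ^ q ∂ν := by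
  rw [eLpNorm_eq_lintegral_rpow_enorm_toReal (by simpa using hq) ENNReal.ofReal_ne_top,
    ENNReal.toReal_ofReal hq.le, ← ENNReal.rpow_mul, one_div, inv_mul_cancel₀ hq.ne',
    ENNReal.rpow_one]

lemma eLpNorm_le_of_lintegral_le (hq : 0 < q) {F : Type*} [NormedAddCommGroup F] {Y : Type*}
    [MeasurableSpace Y] {ν' : Measure Y} {f : X → E} {g : Y → F} {C : ℝ≥0∞}
    (h : ∫⁻ x, ‖f x‖ₑ ^ q ∂ν ≤ C ^ q * ∫⁻ x, ‖g x‖ₑ ^ q ∂ν') :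
    eLpNorm f (ENNReal.ofReal q) ν ≤ C * eLpNorm g (ENNReal.ofReal q) ν' := by
  rw [← eLpNorm_rpow_eq_lintegral hq, ← eLpNorm_rpow_eq_lintegral hq,
    ← ENNReal.mul_rpow_of_nonneg _ _ hq.le] at h
  exact (ENNReal.rpow_le_rpow_iff hq).1 h

lemma integrable_norm_rpow_of_memLp (hq : 0 < q) {f : X → E}
    (hf : MemLp f (ENNReal.ofReal q) ν) : Integrable (fun x => ‖f x‖ ^ q) ν := by
  have := hf.integrable_norm_rpow (by simpa using hq) ENNReal.ofReal_ne_top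
  rwa [ENNReal.toReal_ofReal hq.le] at this

lemma integral_norm_rpow_eq (hq : 0 < q) {f : X → E} (hf : MemLp f (ENNReal.ofReal q) ν) :
    ∫ x, ‖f x‖ ^ q ∂ν = (eLpNorm f (ENNReal.ofReal q) ν).toReal ^ q := by
  rw [ENNReal.toReal_rpow, eLpNorm_rpow_eq_lintegral hq,
    integral_eq_lintegral_of_nonneg_ae (.of_forall fun x => by positivity)
      (integrable_norm_rpow_of_memLp hq hf).1]
  congr 1
  refine lintegral_congr fun x => ?_
  rw [← ENNReal.ofReal_rpow_of_nonneg (norm_nonneg _) hq.le, ofReal_norm]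

lemma Lp_norm_rpow_eq (hq : 0 < q) (f : Lp E (ENNReal.ofReal q) ν) :
    ‖f‖ ^ q = ∫ x, ‖f x‖ ^ q ∂ν := by
  rw [integral_norm_rpow_eq hq (Lp.memLp f), Lp.norm_def]

/-- Jensen's inequality for `|·|^q` and a probability measure, integrated in a parameter. -/
lemma lintegral_enorm_integral_rpow_le [NormedSpace ℝ E] {Z : Type*} [MeasurableSpace Z]
    {P : Measure Z} [IsProbabilityMeasure P] [SFinite ν] (hq : 1 ≤ q) {f : X → Z → E}
    (hf : AEStronglyMeasurable (Function.uncurry f) (ν.prod P)) :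
    ∫⁻ x, ‖∫ z, f x z ∂P‖ₑ ^ q ∂ν ≤ ∫⁻ z, ∫⁻ x, ‖f x z‖ₑ ^ q ∂ν ∂P := by
  have hq0 : 0 < q := by linarith
  calc ∫⁻ x, ‖∫ z, f x z ∂P‖ₑ ^ q ∂ν ≤ ∫⁻ x, ∫⁻ z, ‖f x z‖ₑ ^ q ∂P ∂ν := by
        refine lintegral_mono_ae ?_
        filter_upwards [hf.prodMk_left] with x hx
        have h1 := eLpNorm'_le_eLpNorm'_of_exponent_le (p := 1) (q := q) one_pos hq P hx
        simp only [eLpNorm', ENNReal.rpow_one, div_one, Function.uncurry_apply_pair] at h1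
        have h2 : ‖∫ z, f x z ∂P‖ₑ ≤ (∫⁻ z, ‖f x z‖ₑ ^ q ∂P) ^ (1 / q) :=
          (enorm_integral_le_lintegral_enorm _).trans h1
        calc ‖∫ z, f x z ∂P‖ₑ ^ q ≤ ((∫⁻ z, ‖f x z‖ₑ ^ q ∂P) ^ (1 / q)) ^ q := by gcongr
          _ = _ := by
            rw [← ENNReal.rpow_mul, one_div, inv_mul_cancel₀ hq0.ne', ENNReal.rpow_one]
    _ = _ := by
        refine lintegral_lintegral_swap ?_
        exact (hf.enorm.pow_const q)

end LpPower

/-! ### Uniform convexity and differentiability of `f ↦ ‖f‖^q` -/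

section Convexity

variable {E : Type*} [NormedAddCommGroup E] [InnerProductSpace ℝ E] {q : ℝ}

lemma norm_half_add_rpow_le (hq : 1 < q) (a b : E) :
    ‖(1 / 2 : ℝ) • (a + b)‖ ^ q ≤ (‖a‖ ^ q + ‖b‖ ^ q) / 2 := by
  have h1 : ‖(1 / 2 : ℝ) • (a + b)‖ ≤ (1 / 2) * ‖a‖ + (1 / 2) * ‖b‖ := by
    rw [norm_smul]
    have := norm_add_le a b
    norm_num
    linarith
  have h2 := (convexOn_rpow hq.le).2 (mem_Ici.2 (norm_nonneg a)) (mem_Ici.2 (norm_nonneg b))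
    (by norm_num : (0 : ℝ) ≤ 1 / 2) (by norm_num : (0 : ℝ) ≤ 1 / 2) (by norm_num)
  simp only [smul_eq_mul] at h2
  have h3 : ‖(1 / 2 : ℝ) • (a + b)‖ ^ q ≤ (1 / 2 * ‖a‖ + 1 / 2 * ‖b‖) ^ q :=
    Real.rpow_le_rpow (norm_nonneg _) h1 (by linarith)
  linarith

lemma eq_of_norm_half_add_rpow_eq (hq : 1 < q) {a b : E}
    (h : (‖a‖ ^ q + ‖b‖ ^ q) / 2 ≤ ‖(1 / 2 : ℝ) • (a + b)‖ ^ q) : a = b := by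
  have h0 : ‖(1 / 2 : ℝ) • (a + b)‖ = (1 / 2) * ‖a + b‖ := by
    rw [norm_smul]; norm_num
  have h1 : ‖a‖ = ‖b‖ := by
    by_contra hne
    have h2 := (strictConvexOn_rpow hq).2 (mem_Ici.2 (norm_nonneg a)) (mem_Ici.2 (norm_nonneg b))
      hne (by norm_num : (0 : ℝ) < 1 / 2) (by norm_num : (0 : ℝ) < 1 / 2) (by norm_num)
    simp only [smul_eq_mul] at h2
    have h3 : ‖(1 / 2 : ℝ) • (a + b)‖ ^ q ≤ (1 / 2 * ‖a‖ + 1 / 2 * ‖b‖) ^ q := by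
      refine Real.rpow_le_rpow (norm_nonneg _) ?_ (by linarith)
      rw [h0]; linarith [norm_add_le a b]
    linarith
  refine eq_of_norm_eq_of_norm_add_eq h1 (le_antisymm (norm_add_le _ _) ?_)
  rw [h1] at h ⊢
  have h4 : ‖b‖ ≤ ‖(1 / 2 : ℝ) • (a + b)‖ := by
    refine (Real.rpow_le_rpow_iff (norm_nonneg _) (norm_nonneg _) (by linarith : 0 < q)).1 ?_
    linarith
  rw [h0] at h4
  linarith

/-- A quantitative form of the strict convexity of `|·|^q`, obtained from compactness of the
unit sphere and homogeneity. -/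
lemma exists_norm_sub_rpow_le [FiniteDimensional ℝ E] (hq : 1 < q) {ε : ℝ} (hε : 0 < ε) :
    ∃ C : ℝ, 0 ≤ C ∧ ∀ a b : E, ‖a - b‖ ^ q ≤ ε * (‖a‖ ^ q + ‖b‖ ^ q) +
      C * ((‖a‖ ^ q + ‖b‖ ^ q) / 2 - ‖(1 / 2 : ℝ) • (a + b)‖ ^ q) := by
  have hq0 : 0 < q := by linarith
  have hc : ∀ f : E × E → E, Continuous f → Continuous fun x => ‖f x‖ ^ q := fun f hf =>
    (hf.norm).rpow_const fun _ => Or.inr hq0.le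
  set δ : E × E → ℝ := fun x => (‖x.1‖ ^ q + ‖x.2‖ ^ q) / 2 - ‖(1 / 2 : ℝ) • (x.1 + x.2)‖ ^ q
    with hδ
  have hδc : Continuous δ := by
    have h1 := hc _ continuous_fst
    have h2 := hc _ continuous_snd
    have h3 := hc (fun x => (1 / 2 : ℝ) • (x.1 + x.2)) (by fun_prop)
    exact ((h1.add h2).div_const 2).sub h3
  have hδ0 : ∀ x, 0 ≤ δ x := fun x => sub_nonneg.2 (norm_half_add_rpow_le hq x.1 x.2)
  set S : Set (E × E) := {x | ‖x.1‖ ^ q + ‖x.2‖ ^ q = 1 ∧ ε ≤ ‖x.1 - x.2‖ ^ q} with hS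
  have hle1 : ∀ x : E × E, ‖x.1‖ ^ q + ‖x.2‖ ^ q = 1 → ‖x.1‖ ≤ 1 ∧ ‖x.2‖ ≤ 1 := by
    intro x hx
    have h1 : 0 ≤ ‖x.1‖ ^ q := by positivity
    have h2 : 0 ≤ ‖x.2‖ ^ q := by positivity
    constructor
    · refine (Real.rpow_le_rpow_iff (norm_nonneg _) zero_le_one hq0).1 ?_
      rw [Real.one_rpow]; linarith
    · refine (Real.rpow_le_rpow_iff (norm_nonneg _) zero_le_one hq0).1 ?_
      rw [Real.one_rpow]; linarith
  have hScl : IsClosed S := by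
    have h1 := hc _ continuous_fst
    have h2 := hc _ continuous_snd
    have h3 := hc (fun x => x.1 - x.2) (by fun_prop)
    exact (isClosed_eq (h1.add h2) continuous_const).inter (isClosed_le continuous_const h3)
  have hScomp : IsCompact S := by
    refine (isCompact_closedBall (0 : E × E) 1).of_isClosed_subset hScl fun x hx => ?_
    rw [mem_closedBall_zero_iff, Prod.norm_def]
    exact max_le (hle1 x hx.1).1 (hle1 x hx.1).2
  obtain ⟨d, hd, hdS⟩ : ∃ d : ℝ, 0 < d ∧ ∀ x ∈ S, d ≤ δ x := by
    rcases S.eq_empty_or_nonempty with he | hne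
    · exact ⟨1, one_pos, by simp [he]⟩
    · obtain ⟨x, hx, hmin⟩ := hScomp.exists_isMinOn hne hδc.continuousOn
      refine ⟨δ x, lt_of_le_of_ne (hδ0 x) fun h0 => ?_, fun y hy => hmin hy⟩
      have : x.1 = x.2 := eq_of_norm_half_add_rpow_eq hq (by simp only [hδ] at h0; linarith)
      have h2 := hx.2
      rw [this, sub_self, norm_zero, Real.zero_rpow hq0.ne'] at h2
      linarith
  refine ⟨2 ^ q / d, by positivity, ?_⟩
  have key : ∀ x : E × E, ‖x.1‖ ^ q + ‖x.2‖ ^ q = 1 → ‖x.1 - x.2‖ ^ q ≤ ε + 2 ^ q / d * δ x := by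
    intro x hx
    by_cases h : ε ≤ ‖x.1 - x.2‖ ^ q
    · have h1 := hdS x ⟨hx, h⟩
      have h2 : ‖x.1 - x.2‖ ^ q ≤ 2 ^ q := by
        refine Real.rpow_le_rpow (norm_nonneg _) ?_ hq0.le
        have := norm_sub_le x.1 x.2
        have := hle1 x hx
        linarith
      have h3 : 2 ^ q ≤ 2 ^ q / d * δ x := by
        rw [div_mul_eq_mul_div, le_div_iff₀ hd]
        gcongr
      linarith
    · have := hδ0 x
      have : 0 ≤ 2 ^ q / d * δ x := by positivity
      linarith
  intro a b
  by_cases hr : ‖a‖ ^ q + ‖b‖ ^ q = 0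
  · have h1 : 0 ≤ ‖a‖ ^ q := by positivity
    have h2 : 0 ≤ ‖b‖ ^ q := by positivity
    have ha : ‖a‖ ^ q = 0 := by linarith
    have hb : ‖b‖ ^ q = 0 := by linarith
    rw [Real.rpow_eq_zero (norm_nonneg _) hq0.ne', norm_eq_zero] at ha hb
    simp [ha, hb, Real.zero_rpow hq0.ne']
  · set r := ‖a‖ ^ q + ‖b‖ ^ q with hrdef
    have hrpos : 0 < r := lt_of_le_of_ne (by positivity) (Ne.symm hr)
    set s := r ^ (-(1 / q)) with hs
    have hs0 : 0 < s := by positivity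
    have hsq : s ^ q = r⁻¹ := by
      rw [hs, ← Real.rpow_mul hrpos.le]
      have : -(1 / q) * q = -1 := by field_simp
      rw [this, Real.rpow_neg_one]
    have hsm : ∀ c : E, ‖s • c‖ ^ q = r⁻¹ * ‖c‖ ^ q := fun c => by
      rw [norm_smul, Real.norm_of_nonneg hs0.le, Real.mul_rpow hs0.le (norm_nonneg _), hsq]
    have hk := key (s • a, s • b) (by
      simp only [hsm]; rw [← mul_add, ← hrdef]; field_simp)
    simp only [hδ, ← smul_sub, ← smul_add, smul_comm _ s, hsm] at hk
    have h5 := mul_le_mul_of_nonneg_left hk hrpos.le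
    calc ‖a - b‖ ^ q = r * (r⁻¹ * ‖a - b‖ ^ q) := by field_simp
      _ ≤ _ := h5
      _ = _ := by field_simp; rw [← hrdef]

variable {X : Type*} [MeasurableSpace X] {ν : Measure X}

/-- Uniform convexity of `L^q(ν; E)`, in terms of the `q`-th power of the norm. -/
lemma Lp_norm_sub_lt_of_midpoint [FiniteDimensional ℝ E]
    [Fact ((1 : ℝ≥0∞) ≤ ENNReal.ofReal q)] (hq : 1 < q) (R : ℝ) {ε : ℝ}
    (hε : 0 < ε) :
    ∃ δ > 0, ∀ f g : Lp E (ENNReal.ofReal q) ν, ‖f‖ ^ q ≤ R → ‖g‖ ^ q ≤ R →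
      (‖f‖ ^ q + ‖g‖ ^ q) / 2 - ‖(1 / 2 : ℝ) • (f + g)‖ ^ q ≤ δ → ‖f - g‖ < ε := by
  have hq0 : 0 < q := by linarith
  set R' := max R 0 + 1 with hR'
  have hR'0 : 0 < R' := by positivity
  obtain ⟨C, hC0, hC⟩ := exists_norm_sub_rpow_le (E := E) hq (ε := ε ^ q / (4 * R'))
    (by positivity)
  refine ⟨ε ^ q / (4 * (C + 1)), by positivity, fun f g hf hg hfg => ?_⟩
  have i1 := integrable_norm_rpow_of_memLp hq0 (Lp.memLp f)
  have i2 := integrable_norm_rpow_of_memLp hq0 (Lp.memLp g)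
  have i3 := integrable_norm_rpow_of_memLp hq0 (Lp.memLp (f - g))
  have i4 := integrable_norm_rpow_of_memLp hq0 (Lp.memLp ((1 / 2 : ℝ) • (f + g)))
  have key : ‖f - g‖ ^ q ≤ ε ^ q / (4 * R') * (‖f‖ ^ q + ‖g‖ ^ q) +
      C * ((‖f‖ ^ q + ‖g‖ ^ q) / 2 - ‖(1 / 2 : ℝ) • (f + g)‖ ^ q) := by
    simp only [Lp_norm_rpow_eq hq0]
    have i5 : Integrable (fun x => ε ^ q / (4 * R') * (‖f x‖ ^ q + ‖g x‖ ^ q)) ν :=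
      (i1.add i2).const_mul _
    have i6 : Integrable (fun x => (‖f x‖ ^ q + ‖g x‖ ^ q) / 2) ν := (i1.add i2).div_const 2
    have i7 : Integrable (fun x => C * ((‖f x‖ ^ q + ‖g x‖ ^ q) / 2 -
        ‖((1 / 2 : ℝ) • (f + g) : Lp E (ENNReal.ofReal q) ν) x‖ ^ q)) ν := (i6.sub i4).const_mul _
    rw [← integral_add i1 i2, ← integral_div, ← integral_sub i6 i4,
      ← integral_const_mul, ← integral_const_mul, ← integral_add i5 i7]
    refine integral_mono_ae i3 (i5.add i7) ?_
    filter_upwards [Lp.coeFn_sub f g, Lp.coeFn_smul (1 / 2 : ℝ) (f + g), Lp.coeFn_add f g]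
      with x h1 h2 h3
    simp only [h1, h2, h3, Pi.sub_apply, Pi.smul_apply, Pi.add_apply]
    exact hC (f x) (g x)
  have h1 : ε ^ q / (4 * R') * (‖f‖ ^ q + ‖g‖ ^ q) ≤ ε ^ q / 2 := by
    have : ‖f‖ ^ q + ‖g‖ ^ q ≤ 2 * R' := by
      have := le_max_left R 0
      linarith
    calc _ ≤ ε ^ q / (4 * R') * (2 * R') := by gcongr
      _ = _ := by field_simp; norm_num
  have h2 : C * ((‖f‖ ^ q + ‖g‖ ^ q) / 2 - ‖(1 / 2 : ℝ) • (f + g)‖ ^ q) ≤ ε ^ q / 4 := by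
    calc _ ≤ C * (ε ^ q / (4 * (C + 1))) := by gcongr
      _ = ε ^ q / 4 * (C / (C + 1)) := by field_simp
      _ ≤ ε ^ q / 4 * 1 := by
        gcongr
        rw [div_le_one (by positivity)]; linarith
      _ = _ := mul_one _
  have h3 : ‖f - g‖ ^ q < ε ^ q := by
    have : 0 < ε ^ q := by positivity
    linarith
  exact (Real.rpow_lt_rpow_iff (norm_nonneg _) hε.le hq0).1 h3

/-- The first variation `∫ |f|^{q-2} f · g` of `q⁻¹ ‖·‖^q` at `f` in the direction `g`. Where
`f = 0` the integrand vanishes, whatever value the power takes there. -/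
noncomputable def firstVariation (q : ℝ) (ν : Measure X) (f g : X → E) : ℝ :=
  ∫ x, ‖f x‖ ^ (q - 2) * inner ℝ (f x) (g x) ∂ν

lemma abs_norm_rpow_mul_inner_le (hq : 1 < q) (a b : E) :
    |‖a‖ ^ (q - 2) * inner ℝ a b| ≤ ‖a‖ ^ (q - 1) * ‖b‖ := by
  rcases eq_or_ne a 0 with rfl | ha
  · simp [Real.zero_rpow (by linarith : q - 1 ≠ 0)]
  · have ha' : 0 < ‖a‖ := norm_pos_iff.2 ha
    rw [abs_mul, abs_of_nonneg (by positivity)]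
    calc ‖a‖ ^ (q - 2) * |inner ℝ a b| ≤ ‖a‖ ^ (q - 2) * (‖a‖ * ‖b‖) := by
          gcongr; exact abs_real_inner_le_norm a b
      _ = ‖a‖ ^ (q - 2 + 1) * ‖b‖ := by rw [Real.rpow_add_one ha'.ne']; ring
      _ = _ := by ring_nf

/-- Differentiation under the integral sign; the derivative is dominated by Hölder's inequality. -/
lemma hasDerivAt_integral_norm_add_rpow (hq : 1 < q) {f g : X → E}
    (hf : MemLp f (ENNReal.ofReal q) ν) (hg : MemLp g (ENNReal.ofReal q) ν) :
    Integrable (fun x => ‖f x‖ ^ (q - 2) * inner ℝ (f x) (g x)) ν ∧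
    HasDerivAt (fun t : ℝ => ∫ x, ‖f x + t • g x‖ ^ q ∂ν) (q * firstVariation q ν f g) 0 := by
  have hq0 : 0 < q := by linarith
  have hp1 : (1 : ℝ≥0∞) ≤ ENNReal.ofReal q := by
    rw [← ENNReal.ofReal_one]; exact ENNReal.ofReal_le_ofReal hq.le
  have hF : ∀ t : ℝ, MemLp (fun x => f x + t • g x) (ENNReal.ofReal q) ν := fun t =>
    hf.add (hg.const_smul t)
  have hd : ∀ x, ∀ t : ℝ, HasDerivAt (fun t : ℝ => ‖f x + t • g x‖ ^ q)
      (q * ‖f x + t • g x‖ ^ (q - 2) * inner ℝ (f x + t • g x) (g x)) t := by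
    intro x t
    have h1 := hasFDerivAt_norm_rpow (f x + t • g x) hq
    have h2 : HasDerivAt (fun t : ℝ => f x + t • g x) (g x) t := by
      simpa using ((hasDerivAt_id t).smul_const (g x)).const_add (f x)
    have h3 := h1.comp_hasDerivAt t h2
    simpa only [Function.comp_def, smul_apply, innerSL_apply_apply,
      smul_eq_mul] using h3
  have hbi : Integrable (fun x => q * (‖f x‖ + ‖g x‖) ^ q) ν := by
    have := integrable_norm_rpow_of_memLp hq0 (hf.norm.add hg.norm)
    refine (this.congr (.of_forall fun x => ?_)).const_mul q
    simp only [Pi.add_apply]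
    rw [Real.norm_of_nonneg (by positivity)]
  have hmeas : AEStronglyMeasurable
      (fun x => q * ‖f x + (0 : ℝ) • g x‖ ^ (q - 2) * inner ℝ (f x + (0 : ℝ) • g x) (g x)) ν := by
    have h0 := (hF 0).1
    refine AEStronglyMeasurable.mul ?_ (h0.inner hg.1)
    exact ((h0.norm.aemeasurable.pow_const (q - 2)).const_mul q).aestronglyMeasurable
  have main := hasDerivAt_integral_of_dominated_loc_of_deriv_le (μ := ν)
    (F := fun (t : ℝ) x => ‖f x + t • g x‖ ^ q) (x₀ := 0) (s := Metric.ball 0 1)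
    (F' := fun (t : ℝ) x => q * ‖f x + t • g x‖ ^ (q - 2) * inner ℝ (f x + t • g x) (g x))
    (bound := fun x => q * (‖f x‖ + ‖g x‖) ^ q) (Metric.ball_mem_nhds _ one_pos)
    (.of_forall fun t => (integrable_norm_rpow_of_memLp hq0 (hF t)).1)
    (integrable_norm_rpow_of_memLp hq0 (hF 0)) hmeas ?_ hbi
    (.of_forall fun x t _ => hd x t)
  · simp only [zero_smul, add_zero] at main
    refine ⟨?_, ?_⟩
    · refine (main.1.const_mul q⁻¹).congr (.of_forall fun x => ?_)
      simp only
      field_simp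
    · have e : ∫ x, q * ‖f x‖ ^ (q - 2) * inner ℝ (f x) (g x) ∂ν = q * firstVariation q ν f g := by
        simp only [firstVariation, ← integral_const_mul, mul_assoc]
      exact e ▸ main.2
  · refine .of_forall fun x t ht => ?_
    rw [mem_ball_zero_iff, Real.norm_eq_abs] at ht
    have h1 : ‖f x + t • g x‖ ≤ ‖f x‖ + ‖g x‖ := by
      refine (norm_add_le _ _).trans ?_
      gcongr
      rw [norm_smul, Real.norm_eq_abs]
      exact mul_le_of_le_one_left (norm_nonneg _) ht.le
    rw [mul_assoc, norm_mul, Real.norm_of_nonneg hq0.le, Real.norm_eq_abs]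
    gcongr
    refine (abs_norm_rpow_mul_inner_le hq _ _).trans ?_
    have hs : 0 ≤ ‖f x‖ + ‖g x‖ := by positivity
    calc ‖f x + t • g x‖ ^ (q - 1) * ‖g x‖
        ≤ (‖f x‖ + ‖g x‖) ^ (q - 1) * (‖f x‖ + ‖g x‖) := by
          gcongr
          linarith [norm_nonneg (f x)]
      _ = _ := by
          rcases hs.eq_or_lt with h | h
          · rw [← h, mul_zero, Real.zero_rpow hq0.ne']
          · rw [← Real.rpow_add_one h.ne']; ring_nf

lemma hasDerivAt_Lp_norm_rpow (hq : 1 < q) (f g : Lp E (ENNReal.ofReal q) ν) :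
    HasDerivAt (fun t : ℝ => ‖f + t • g‖ ^ q) (q * firstVariation q ν f g) 0 := by
  have hq0 : 0 < q := by linarith
  refine (hasDerivAt_integral_norm_add_rpow hq (Lp.memLp f) (Lp.memLp g)).2.congr_of_eventuallyEq
    (.of_forall fun t => ?_)
  simp only
  rw [Lp_norm_rpow_eq hq0]
  refine integral_congr_ae ?_
  filter_upwards [Lp.coeFn_add f (t • g), Lp.coeFn_smul t g] with x h1 h2
  simp only [h1, h2, Pi.add_apply, Pi.smul_apply]

lemma firstVariation_add_right (hq : 1 < q) {f g h : X → E}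
    (hf : MemLp f (ENNReal.ofReal q) ν) (hg : MemLp g (ENNReal.ofReal q) ν)
    (hh : MemLp h (ENNReal.ofReal q) ν) :
    firstVariation q ν f (fun x => g x + h x) = firstVariation q ν f g + firstVariation q ν f h := by
  rw [firstVariation, firstVariation, firstVariation,
    ← integral_add (hasDerivAt_integral_norm_add_rpow hq hf hg).1
      (hasDerivAt_integral_norm_add_rpow hq hf hh).1]
  refine integral_congr_ae (.of_forall fun x => ?_)
  simp only [inner_add_right, mul_add]

lemma firstVariation_smul_right (c : ℝ) (f g : X → E) :
    firstVariation q ν f (fun x => c • g x) = c * firstVariation q ν f g := by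
  rw [firstVariation, firstVariation, ← integral_const_mul]
  refine integral_congr_ae (.of_forall fun x => ?_)
  simp only [inner_smul_right]
  ring

lemma firstVariation_congr {f g f' g' : X → E} (hf : f =ᵐ[ν] f') (hg : g =ᵐ[ν] g') :
    firstVariation q ν f g = firstVariation q ν f' g' := by
  refine integral_congr_ae ?_
  filter_upwards [hf, hg] with x h1 h2
  rw [h1, h2]

lemma firstVariation_Lp_smul_sub_smul (hq : 1 < q) (f g h : Lp E (ENNReal.ofReal q) ν) (s t : ℝ) :
    firstVariation q ν f ((s • g - t • h : Lp E (ENNReal.ofReal q) ν) : X → E) =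
      s * firstVariation q ν f g - t * firstVariation q ν f h := by
  have h1 : ((s • g - t • h : Lp E (ENNReal.ofReal q) ν) : X → E) =ᵐ[ν]
      fun x => s • g x + (-t) • h x := by
    filter_upwards [Lp.coeFn_sub (s • g) (t • h), Lp.coeFn_smul s g, Lp.coeFn_smul t h]
      with x h1 h2 h3
    rw [h1, Pi.sub_apply, h2, h3, Pi.smul_apply, Pi.smul_apply, neg_smul, sub_eq_add_neg]
  have h2 := firstVariation_add_right hq (Lp.memLp f) (g := fun x => s • g x)
    (h := fun x => (-t) • h x) ((Lp.memLp g).const_smul s) ((Lp.memLp h).const_smul (-t))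
  rw [firstVariation_congr (ae_eq_refl _) h1, h2, firstVariation_smul_right,
    firstVariation_smul_right]
  ring

lemma firstVariation_self (hq : 0 < q) (f : Lp E (ENNReal.ofReal q) ν) :
    firstVariation q ν f f = ‖f‖ ^ q := by
  rw [Lp_norm_rpow_eq hq, firstVariation]
  refine integral_congr_ae (.of_forall fun x => ?_)
  simp only [real_inner_self_eq_norm_sq]
  rcases eq_or_ne (f x) 0 with h | h
  · simp [h, Real.zero_rpow hq.ne']
  · have : 0 < ‖f x‖ := norm_pos_iff.2 h
    rw [← Real.rpow_natCast ‖f x‖ 2, ← Real.rpow_add this]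
    norm_num

/-- The convex function `‖·‖^q` lies above its tangent at `f`. -/
lemma Lp_norm_rpow_add_firstVariation_le (hq : 1 < q) [Fact ((1 : ℝ≥0∞) ≤ ENNReal.ofReal q)]
    (f g : Lp E (ENNReal.ofReal q) ν) :
    ‖f‖ ^ q + q * firstVariation q ν f g ≤ ‖f + g‖ ^ q := by
  have hconv : ConvexOn ℝ univ fun t : ℝ => ‖f + t • g‖ ^ q := by
    refine ⟨convex_univ, fun s _ t _ a b ha hb hab => ?_⟩
    have h1 : f + (a • s + b • t) • g = a • (f + s • g) + b • (f + t • g) := by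
      have h2 : f = a • f + b • f := by rw [← add_smul, hab, one_smul]
      calc _ = (a • f + b • f) + (a • s + b • t) • g := by rw [← h2]
        _ = _ := by simp only [smul_eq_mul, add_smul, mul_smul, smul_add]; abel
    have h3 := (convexOn_rpow hq.le).2 (x := ‖f + s • g‖) (norm_nonneg _)
      (y := ‖f + t • g‖) (norm_nonneg _) ha hb hab
    refine le_trans ?_ h3
    simp only [h1]
    refine Real.rpow_le_rpow (norm_nonneg _) ((norm_add_le _ _).trans ?_) (by linarith)
    rw [norm_smul, norm_smul, Real.norm_of_nonneg ha, Real.norm_of_nonneg hb]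
    rfl
  have h := hconv.le_slope_of_hasDerivAt (mem_univ 0) (mem_univ 1) one_pos
    (hasDerivAt_Lp_norm_rpow hq f g)
  simp only [slope, sub_zero, inv_one, one_smul, zero_smul, add_zero, vsub_eq_sub] at h
  linarith

end Convexity

/-! ### Minimisation over a quotient sphere -/

section Minimisation

variable {E : Type*} [NormedAddCommGroup E] [InnerProductSpace ℝ E] {q : ℝ}
  [Fact ((1 : ℝ≥0∞) ≤ ENNReal.ofReal q)] {X Y V : Type*} [MeasurableSpace X] [MeasurableSpace Y]
  {ν : Measure X} {m : Measure Y} [AddCommGroup V] [Module ℝ V]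

/-- A bounded sequence in `L^q` has convex combinations of its tails that form a Cauchy sequence.
The combinations almost minimise the norm over the convex hulls of the tails; uniform convexity
does the rest. -/
lemma exists_mem_convexHull_tail_cauchySeq [FiniteDimensional ℝ E] (hq : 1 < q)
    (D : V →ₗ[ℝ] Lp E (ENNReal.ofReal q) ν)
    (v : ℕ → V) {R : ℝ} (hR : ∀ n, ‖D (v n)‖ ^ q ≤ R) :
    ∃ w : ℕ → V, (∀ k, w k ∈ convexHull ℝ (v '' Ici k)) ∧ CauchySeq fun k => D (w k) := by
  have hq0 : 0 < q := by linarith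
  set A : ℕ → Set V := fun k => convexHull ℝ (v '' Ici k) with hA
  have hAanti : ∀ j k, j ≤ k → A k ⊆ A j := fun j k hjk =>
    convexHull_mono (image_mono (Ici_subset_Ici.2 hjk))
  have hAv : ∀ k, v k ∈ A k := fun k => subset_convexHull ℝ _ ⟨k, mem_Ici.2 le_rfl, rfl⟩
  set Φ : V → ℝ := fun x => ‖D x‖ ^ q with hΦ
  have hbdd : ∀ k, BddBelow (Φ '' A k) := fun k => ⟨0, by
    rintro _ ⟨x, -, rfl⟩; simp only [hΦ]; positivity⟩
  set i : ℕ → ℝ := fun k => sInf (Φ '' A k) with hi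
  have hile : ∀ k, ∀ x ∈ A k, i k ≤ Φ x := fun k x hx => csInf_le (hbdd k) ⟨x, hx, rfl⟩
  have hne : ∀ k, (Φ '' A k).Nonempty := fun k => ⟨_, v k, hAv k, rfl⟩
  have himono : Monotone i := fun j k hjk =>
    csInf_le_csInf (hbdd j) (hne k) (image_mono (hAanti j k hjk))
  have hiR : ∀ k, i k ≤ R := fun k => (hile k _ (hAv k)).trans (hR k)
  have hilim : Tendsto i atTop (𝓝 (⨆ k, i k)) :=
    tendsto_atTop_ciSup himono ⟨R, by rintro _ ⟨k, rfl⟩; exact hiR k⟩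
  set L := ⨆ k, i k
  have hiL : ∀ k, i k ≤ L := fun k => le_ciSup (f := i) ⟨R, by rintro _ ⟨k, rfl⟩; exact hiR k⟩ k
  have hex : ∀ k : ℕ, ∃ x ∈ A k, Φ x < i k + 1 / ((k : ℝ) + 1) := by
    intro k
    have hlt : i k < i k + 1 / ((k : ℝ) + 1) := by
      have : (0 : ℝ) < 1 / ((k : ℝ) + 1) := by positivity
      linarith
    obtain ⟨_, ⟨x, hx, rfl⟩, hx2⟩ := exists_lt_of_csInf_lt (hne k) hlt
    exact ⟨x, hx, hx2⟩
  choose w hwA hw using hex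
  refine ⟨w, hwA, ?_⟩
  have hone : ∀ k : ℕ, 1 / ((k : ℝ) + 1) ≤ 1 := fun k => by
    rw [div_le_one (by positivity)]
    have : (0 : ℝ) ≤ k := by positivity
    linarith
  have hwR : ∀ k, ‖D (w k)‖ ^ q ≤ R + 1 := fun k => by
    have := hw k
    simp only [hΦ] at this
    linarith [hiR k, hone k]
  rw [Metric.cauchySeq_iff']
  intro ε hε
  obtain ⟨δ, hδ, H⟩ := Lp_norm_sub_lt_of_midpoint (ν := ν) (E := E) hq (R + 1) hε
  have h1 : ∀ᶠ k in atTop, L - δ / 2 < i k := hilim.eventually_const_lt (by linarith)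
  have h2 : ∀ᶠ k : ℕ in atTop, 1 / ((k : ℝ) + 1) < δ / 2 :=
    tendsto_one_div_add_atTop_nhds_zero_nat.eventually_lt_const (by positivity)
  obtain ⟨N, hN1, hN2⟩ := (h1.and h2).exists
  refine ⟨N, fun n hn => ?_⟩
  rw [dist_eq_norm]
  refine H _ _ (hwR n) (hwR N) ?_
  have hmem : (1 / 2 : ℝ) • w n + (1 / 2 : ℝ) • w N ∈ A N :=
    convex_convexHull ℝ _ (hAanti N n hn (hwA n)) (hwA N) (by norm_num) (by norm_num)
      (by norm_num)
  have h3 := hile N _ hmem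
  simp only [hΦ, map_add, map_smul, ← smul_add] at h3
  have h4 := hw n
  have h5 := hw N
  simp only [hΦ] at h4 h5
  have h6 : 1 / ((n : ℝ) + 1) ≤ 1 / ((N : ℝ) + 1) := by
    have : (N : ℝ) ≤ n := by exact_mod_cast hn
    gcongr
  have h7 := hiL n
  linarith

/-- `v` is centred if the constant that best approximates `M v` is `0`; here `e` plays the role
of the constant function `1`. -/
def IsCentred {F : Type*} [NormedAddCommGroup F] [NormedSpace ℝ F] (M : V →ₗ[ℝ] F) (e v : V) :
    Prop :=
  ∀ c : ℝ, ‖M v‖ ≤ ‖M v - c • M e‖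

section Centred

variable {F : Type*} [NormedAddCommGroup F] [NormedSpace ℝ F] {M : V →ₗ[ℝ] F} {e : V}

lemma exists_isCentred_sub_smul (he : M e ≠ 0) (v : V) : ∃ c : ℝ, IsCentred M e (v - c • e) := by
  have hcont : Continuous fun c : ℝ => ‖M v - c • M e‖ := by fun_prop
  have hco : Tendsto (fun c : ℝ => ‖M v - c • M e‖) (cocompact ℝ) atTop := by
    have h1 : Tendsto (fun c : ℝ => ‖c‖ * ‖M e‖ - ‖M v‖) (cocompact ℝ) atTop :=
      tendsto_atTop_add_const_right _ _
        (tendsto_norm_cocompact_atTop.atTop_mul_const (norm_pos_iff.2 he))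
    refine tendsto_atTop_mono (fun c => ?_) h1
    rw [← norm_smul, norm_sub_rev (M v)]
    exact norm_sub_norm_le _ _
  obtain ⟨c, hc⟩ := hcont.exists_forall_le hco
  refine ⟨c, fun d => ?_⟩
  have h := hc (c + d)
  simpa only [map_sub, map_smul, add_smul, sub_sub] using h

lemma IsCentred.smul {v : V} (hv : IsCentred M e v) (s : ℝ) : IsCentred M e (s • v) := by
  intro c
  rcases eq_or_ne s 0 with rfl | hs
  · simp
  · have h : M (s • v) - c • M e = s • (M v - (s⁻¹ * c) • M e) := by
      rw [smul_sub, smul_smul, mul_inv_cancel_left₀ hs, map_smul]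
    rw [h, map_smul, norm_smul, norm_smul]
    exact mul_le_mul_of_nonneg_left (hv _) (norm_nonneg _)

end Centred

variable {D : V →ₗ[ℝ] Lp E (ENNReal.ofReal q) ν} {M : V →ₗ[ℝ] Lp ℝ (ENNReal.ofReal q) m} {e : V}

lemma IsCentred.firstVariation_eq_zero (hq : 1 < q) {v : V} (hv : IsCentred M e v) :
    firstVariation q m (M v) (M e) = 0 := by
  have h1 := hasDerivAt_Lp_norm_rpow hq (M v) (M e)
  have h2 : IsLocalMin (fun t : ℝ => ‖M v + t • M e‖ ^ q) 0 := by
    refine .of_forall fun t => ?_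
    simp only [zero_smul, add_zero]
    have := hv (-t)
    rw [neg_smul, sub_neg_eq_add] at this
    exact Real.rpow_le_rpow (norm_nonneg _) this (by linarith)
  have h3 := h2.hasDerivAt_eq_zero h1
  exact (mul_eq_zero.1 h3).resolve_left (by linarith)

lemma isCentred_iff_firstVariation_eq_zero (hq : 1 < q) {v : V} :
    IsCentred M e v ↔ firstVariation q m (M v) (M e) = 0 := by
  refine ⟨fun h => h.firstVariation_eq_zero hq, fun h c => ?_⟩
  have h1 := Lp_norm_rpow_add_firstVariation_le hq (M v) ((0 : ℝ) • M e - c • M e)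
  rw [firstVariation_Lp_smul_sub_smul hq, h, zero_smul, zero_sub, ← sub_eq_add_neg] at h1
  refine (Real.rpow_le_rpow_iff (norm_nonneg _) (norm_nonneg _) (by linarith : 0 < q)).1 ?_
  linarith

/-- Existence of a minimiser of `‖D u‖` among centred `u` with `‖M u‖ = 1`, from compactness of
`M` and closedness of the pair `(D, M)`. -/
theorem exists_isCentred_minimiser [FiniteDimensional ℝ E] (hq : 1 < q) (hMe : M e ≠ 0)
    (hcomp : ∀ v : ℕ → V, (∃ R, ∀ n, ‖D (v n)‖ ≤ R ∧ ‖M (v n)‖ ≤ R) →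
      ∃ φ : ℕ → ℕ, StrictMono φ ∧ ∃ y, Tendsto (fun n => M (v (φ n))) atTop (𝓝 y))
    (hclosed : ∀ w : ℕ → V, CauchySeq (fun n => D (w n)) → CauchySeq (fun n => M (w n)) →
      ∃ v, Tendsto (fun n => D (w n)) atTop (𝓝 (D v)) ∧
        Tendsto (fun n => M (w n)) atTop (𝓝 (M v)))
    (hker : ∀ v, D v = 0 → ∃ c : ℝ, M v = c • M e)
    (hne : ∃ v, ∀ c : ℝ, M v ≠ c • M e) :
    ∃ u, IsCentred M e u ∧ ‖M u‖ = 1 ∧ 0 < ‖D u‖ ∧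
      ∀ v, IsCentred M e v → ‖D u‖ * ‖M v‖ ≤ ‖D v‖ := by
  have hq0 : 0 < q := by linarith
  set S : Set V := {v | IsCentred M e v ∧ ‖M v‖ = 1} with hS
  have hSne : S.Nonempty := by
    obtain ⟨v, hv⟩ := hne
    obtain ⟨c, hc⟩ := exists_isCentred_sub_smul hMe v
    have h0 : M (v - c • e) ≠ 0 := fun h => hv c (by
      rw [map_sub, map_smul, sub_eq_zero] at h; exact h)
    refine ⟨‖M (v - c • e)‖⁻¹ • (v - c • e), hc.smul _, ?_⟩
    rw [map_smul, norm_smul, norm_inv, norm_norm, inv_mul_cancel₀ (norm_ne_zero_iff.2 h0)]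
  have hbdd : BddBelow ((fun v => ‖D v‖) '' S) := ⟨0, by rintro _ ⟨x, -, rfl⟩; positivity⟩
  set d := sInf ((fun v => ‖D v‖) '' S) with hd
  obtain ⟨t, -, ht, htS⟩ := exists_seq_tendsto_sInf (hSne.image fun v => ‖D v‖) hbdd
  choose v hvS hvt using htS
  simp only at hvt
  have htd : Tendsto (fun n => ‖D (v n)‖) atTop (𝓝 d) := by simpa only [hvt] using ht
  obtain ⟨R, hR⟩ := htd.bddAbove_range
  obtain ⟨φ, hφ, y, hy⟩ := hcomp v ⟨max R 1, fun n =>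
    ⟨le_max_of_le_left (hR ⟨n, rfl⟩), (hvS n).2.trans_le (le_max_right _ _)⟩⟩
  obtain ⟨w, hw, hwD⟩ := exists_mem_convexHull_tail_cauchySeq hq D (fun n => v (φ n))
    (R := R ^ q) fun n => Real.rpow_le_rpow (norm_nonneg _) (hR ⟨φ n, rfl⟩) hq0.le
  have hwM : Tendsto (fun n => M (w n)) atTop (𝓝 y) := by
    rw [Metric.tendsto_atTop]
    intro ε hε
    obtain ⟨N, hN⟩ := Metric.tendsto_atTop.1 hy ε hε
    refine ⟨N, fun n hn => ?_⟩
    have h1 : convexHull ℝ ((fun n => v (φ n)) '' Ici n) ⊆ M ⁻¹' Metric.ball y ε := by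
      refine convexHull_min ?_ ((convex_ball y ε).linear_preimage M)
      rintro _ ⟨k, hk, rfl⟩
      exact hN k (hn.trans hk)
    exact h1 (hw n)
  obtain ⟨u, hDu, hMu⟩ := hclosed w hwD hwM.cauchySeq
  have hMuy : M u = y := tendsto_nhds_unique hMu hwM
  have hDud : ‖D u‖ ≤ d := by
    refine le_of_forall_pos_le_add fun ε hε => ?_
    have h0 : ∀ᶠ n in atTop, ‖D (v (φ n))‖ ≤ d + ε :=
      (htd.comp hφ.tendsto_atTop).eventually_le_const (by linarith)
    obtain ⟨N, hN⟩ := eventually_atTop.1 h0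
    refine le_of_tendsto hDu.norm (eventually_atTop.2 ⟨N, fun n hn => ?_⟩)
    have h1 : convexHull ℝ ((fun n => v (φ n)) '' Ici n) ⊆
        D ⁻¹' Metric.closedBall 0 (d + ε) := by
      refine convexHull_min ?_ ((convex_closedBall _ _).linear_preimage D)
      rintro _ ⟨k, hk, rfl⟩
      simpa using hN k (hn.trans hk)
    simpa using h1 (hw n)
  have hMu1 : ‖M u‖ = 1 := by
    rw [hMuy]
    refine tendsto_nhds_unique hy.norm ?_
    simp only [(hvS _).2, tendsto_const_nhds]
  have huc : IsCentred M e u := by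
    intro c
    rw [hMuy]
    exact le_of_tendsto_of_tendsto' hy.norm (hy.sub_const (c • M e)).norm
      fun n => (hvS (φ n)).1 c
  refine ⟨u, huc, hMu1, ?_, fun z hz => ?_⟩
  · rw [norm_pos_iff]
    intro h0
    obtain ⟨c, hc⟩ := hker u h0
    have := huc c
    rw [hMu1, hc, sub_self, norm_zero] at this
    linarith
  · rcases eq_or_ne (M z) 0 with h0 | h0
    · simp [h0]
    · have h1 : ‖M z‖⁻¹ • z ∈ S := ⟨hz.smul _, by
        rw [map_smul, norm_smul, norm_inv, norm_norm, inv_mul_cancel₀ (norm_ne_zero_iff.2 h0)]⟩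
      have h2 : ‖D u‖ ≤ ‖D (‖M z‖⁻¹ • z)‖ := hDud.trans (csInf_le hbdd ⟨_, h1, rfl⟩)
      rw [map_smul, norm_smul, norm_inv, norm_norm, inv_mul_eq_div,
        le_div_iff₀ (norm_pos_iff.2 h0)] at h2
      exact h2

/-- The Euler--Lagrange equation of the constrained problem. No multiplier rule is needed: with
`λ = ‖D u‖^q`, minimality gives `λ min_c ‖M v - c M e‖^q ≤ ‖D v‖^q` for *all* `v`, and since
`‖·‖^q` lies above its tangent at `M u`, whose slope in the direction `M e` vanishes, the function
`t ↦ ‖D u + t D w‖^q - λ (1 + t q B(M u, M w))` is minimal at `t = 0`. -/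
theorem firstVariation_eq_of_minimiser (hq : 1 < q) (hMe : M e ≠ 0) (hDe : D e = 0) {u : V}
    (hu : IsCentred M e u) (hu1 : ‖M u‖ = 1)
    (hmin : ∀ v, IsCentred M e v → ‖D u‖ * ‖M v‖ ≤ ‖D v‖) (w : V) :
    firstVariation q ν (D u) (D w) = ‖D u‖ ^ q * firstVariation q m (M u) (M w) := by
  have hq0 : 0 < q := by linarith
  have hder : HasDerivAt (fun t : ℝ => ‖D u + t • D w‖ ^ q -
      ‖D u‖ ^ q * (1 + t * (q * firstVariation q m (M u) (M w))))
      (q * firstVariation q ν (D u) (D w) -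
        ‖D u‖ ^ q * (q * firstVariation q m (M u) (M w))) 0 := by
    refine (hasDerivAt_Lp_norm_rpow hq (D u) (D w)).sub (HasDerivAt.const_mul _ ?_)
    exact (hasDerivAt_mul_const _).const_add 1
  have hloc : IsLocalMin (fun t : ℝ => ‖D u + t • D w‖ ^ q -
      ‖D u‖ ^ q * (1 + t * (q * firstVariation q m (M u) (M w)))) 0 := by
    refine .of_forall fun t => ?_
    simp only [zero_smul, add_zero, zero_mul, mul_one, sub_self, sub_nonneg]
    obtain ⟨c, hc⟩ := exists_isCentred_sub_smul hMe (u + t • w)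
    have h1 := hmin _ hc
    have h2 := Real.rpow_le_rpow (by positivity) h1 hq0.le
    rw [Real.mul_rpow (norm_nonneg _) (norm_nonneg _)] at h2
    simp only [map_sub, map_add, map_smul, hDe, smul_zero, sub_zero, add_sub_assoc] at h2
    refine le_trans ?_ h2
    gcongr
    have h3 := Lp_norm_rpow_add_firstVariation_le hq (M u) (t • M w - c • M e)
    rw [firstVariation_Lp_smul_sub_smul hq, hu.firstVariation_eq_zero hq, hu1, Real.one_rpow] at h3
    linarith
  have h := hloc.hasDerivAt_eq_zero hder
  have h' : q * (firstVariation q ν (D u) (D w) -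
      ‖D u‖ ^ q * firstVariation q m (M u) (M w)) = 0 := by linarith
  linarith [(mul_eq_zero.1 h').resolve_left hq0.ne']

end Minimisation

/-! ### Weak gradients -/

section WeakGradient

variable {N : ℕ} {Ω : Set (Eucl N)}

lemma integrable_test_smul {F : Type*} [NormedAddCommGroup F] [NormedSpace ℝ F]
    {f : Eucl N → F} (hf : LocallyIntegrableOn f Ω volume) {ψ : Eucl N → ℝ} (hψ : Continuous ψ)
    (hc : HasCompactSupport ψ) (hs : tsupport ψ ⊆ Ω) : Integrable (fun x => ψ x • f x) := by
  have h1 := (hf.integrableOn_compact_subset hs hc).continuousOn_smul hψ.continuousOn hc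
  refine (integrableOn_iff_integrable_of_support_subset ?_).1 h1
  intro x hx
  refine subset_tsupport ψ ?_
  rw [Function.mem_support] at hx ⊢
  exact fun h => hx (by simp [h])

lemma setIntegral_test_smul {F : Type*} [NormedAddCommGroup F] [NormedSpace ℝ F]
    {f : Eucl N → F} {ψ : Eucl N → ℝ} (hs : tsupport ψ ⊆ Ω) :
    ∫ x in Ω, ψ x • f x = ∫ x, ψ x • f x := by
  refine setIntegral_eq_integral_of_forall_compl_eq_zero fun x hx => ?_
  rw [image_eq_zero_of_notMem_tsupport fun h => hx (hs h), zero_smul]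

lemma tsupport_fderiv_apply_subset (φ : Eucl N → ℝ) (v : Eucl N) :
    tsupport (fun x => fderiv ℝ φ x v) ⊆ tsupport φ := by
  refine closure_minimal (fun x hx => ?_) (isClosed_tsupport φ)
  refine support_fderiv_subset ℝ (fun h => hx ?_)
  simp [h]

lemma continuous_fderiv_apply {φ : Eucl N → ℝ} (hφ : ContDiff ℝ ∞ φ) (v : Eucl N) :
    Continuous fun x => fderiv ℝ φ x v :=
  (hφ.continuous_fderiv (by simp)).clm_apply continuous_const

lemma hasCompactSupport_fderiv_apply {φ : Eucl N → ℝ} (hφ : HasCompactSupport φ) (v : Eucl N) :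
    HasCompactSupport fun x => fderiv ℝ φ x v :=
  hφ.of_isClosed_subset (isClosed_tsupport _) (tsupport_fderiv_apply_subset φ v)

lemma integral_inner_mul_test {g : Eucl N → Eucl N} (hg : LocallyIntegrableOn g Ω volume)
    {ψ : Eucl N → ℝ} (hψ : Continuous ψ) (hc : HasCompactSupport ψ) (hs : tsupport ψ ⊆ Ω)
    (v : Eucl N) : ∫ x in Ω, inner ℝ (g x) v * ψ x = inner ℝ v (∫ x in Ω, ψ x • g x) := by
  rw [← integral_inner (integrable_test_smul hg hψ hc hs).integrableOn v]
  refine integral_congr_ae (.of_forall fun x => ?_)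
  simp only [inner_smul_right, real_inner_comm v]
  ring

/-- The form of the defining identity in which the direction `v` is taken out of the integral, so
that the right-hand side involves a vector-valued integral of `g`. -/
lemma hasWeakGradient_iff {u : Eucl N → ℝ} {g : Eucl N → Eucl N}
    (hu : LocallyIntegrableOn u Ω volume) (hg : LocallyIntegrableOn g Ω volume) :
    HasWeakGradient Ω u g ↔ ∀ φ : Eucl N → ℝ, ContDiff ℝ ∞ φ → HasCompactSupport φ →
      tsupport φ ⊆ Ω → ∀ v : Eucl N,
        ∫ x in Ω, fderiv ℝ φ x v • u x = -inner ℝ v (∫ x in Ω, φ x • g x) := by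
  have key : ∀ φ : Eucl N → ℝ, ContDiff ℝ ∞ φ → HasCompactSupport φ →
      tsupport φ ⊆ Ω → ∀ v : Eucl N, ((∫ x in Ω, u x * fderiv ℝ φ x v =
        -∫ x in Ω, inner ℝ (g x) v * φ x) ↔
      (∫ x in Ω, fderiv ℝ φ x v • u x = -inner ℝ v (∫ x in Ω, φ x • g x))) := by
    intro φ h1 h2 h3 v
    rw [integral_inner_mul_test hg h1.continuous h2 h3]
    simp only [smul_eq_mul, mul_comm]
  constructor
  · rintro ⟨-, -, h⟩ φ h1 h2 h3 v
    exact (key φ h1 h2 h3 v).1 (h φ h1 h2 h3 v)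
  · intro h
    exact ⟨hu, hg, fun φ h1 h2 h3 v => (key φ h1 h2 h3 v).2 (h φ h1 h2 h3 v)⟩

lemma HasWeakGradient.integral_eq {u : Eucl N → ℝ} {g : Eucl N → Eucl N}
    (h : HasWeakGradient Ω u g) {φ : Eucl N → ℝ} (h1 : ContDiff ℝ ∞ φ) (h2 : HasCompactSupport φ)
    (h3 : tsupport φ ⊆ Ω) (v : Eucl N) :
    ∫ x in Ω, fderiv ℝ φ x v • u x = -inner ℝ v (∫ x in Ω, φ x • g x) :=
  (hasWeakGradient_iff h.1 h.2.1).1 h φ h1 h2 h3 v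

lemma HasWeakGradient.unique (hΩ : IsOpen Ω) {u u' : Eucl N → ℝ} {g g' : Eucl N → Eucl N}
    (h : HasWeakGradient Ω u g) (h' : HasWeakGradient Ω u' g')
    (huu : u =ᵐ[volume.restrict Ω] u') : g =ᵐ[volume.restrict Ω] g' := by
  have h0 := hΩ.ae_eq_zero_of_integral_contDiff_smul_eq_zero (h.2.1.sub h'.2.1) (fun φ h1 h2 h3 => by
    have i1 := integrable_test_smul h.2.1 h1.continuous h2 h3
    have i2 := integrable_test_smul h'.2.1 h1.continuous h2 h3
    have e : ∫ x in Ω, φ x • g x = ∫ x in Ω, φ x • g' x := by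
      refine ext_inner_left ℝ fun v => ?_
      have e1 := h.integral_eq h1 h2 h3 v
      have e2 := h'.integral_eq h1 h2 h3 v
      have e3 : ∫ x in Ω, fderiv ℝ φ x v • u x = ∫ x in Ω, fderiv ℝ φ x v • u' x := by
        refine integral_congr_ae ?_
        filter_upwards [huu] with x hx
        rw [hx]
      linarith
    rw [setIntegral_test_smul h3, setIntegral_test_smul h3] at e
    simp only [Pi.sub_apply, smul_sub]
    rw [integral_sub i1 i2, e, sub_self])
  rw [Filter.EventuallyEq, ae_restrict_iff' hΩ.measurableSet]
  filter_upwards [h0] with x hx hxΩ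
  exact sub_eq_zero.1 (hx hxΩ)

lemma weakGrad_ae_eq (hΩ : IsOpen Ω) {u : Eucl N → ℝ} {g : Eucl N → Eucl N}
    (h : HasWeakGradient Ω u g) : weakGrad Ω u =ᵐ[volume.restrict Ω] g := by
  have hex : ∃ g, HasWeakGradient Ω u g := ⟨g, h⟩
  rw [weakGrad, dif_pos hex]
  exact hex.choose_spec.unique hΩ h (ae_eq_refl _)

lemma HasWeakGradient.add {u u' : Eucl N → ℝ} {g g' : Eucl N → Eucl N}
    (h : HasWeakGradient Ω u g) (h' : HasWeakGradient Ω u' g') :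
    HasWeakGradient Ω (u + u') (g + g') := by
  rw [hasWeakGradient_iff (h.1.add h'.1) (h.2.1.add h'.2.1)]
  intro φ h1 h2 h3 v
  have e1 := h.integral_eq h1 h2 h3 v
  have e2 := h'.integral_eq h1 h2 h3 v
  simp only [Pi.add_apply, smul_add]
  have hsub := (tsupport_fderiv_apply_subset φ v).trans h3
  rw [integral_add
      (integrable_test_smul h.1 (continuous_fderiv_apply h1 v)
        (hasCompactSupport_fderiv_apply h2 v) hsub).integrableOn
      (integrable_test_smul h'.1 (continuous_fderiv_apply h1 v)
        (hasCompactSupport_fderiv_apply h2 v) hsub).integrableOn,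
    integral_add (integrable_test_smul h.2.1 h1.continuous h2 h3).integrableOn
      (integrable_test_smul h'.2.1 h1.continuous h2 h3).integrableOn, inner_add_right, e1, e2]
  ring

lemma HasWeakGradient.const_smul {u : Eucl N → ℝ} {g : Eucl N → Eucl N}
    (h : HasWeakGradient Ω u g) (c : ℝ) : HasWeakGradient Ω (c • u) (c • g) := by
  rw [hasWeakGradient_iff (h.1.smul c) (h.2.1.smul c)]
  intro φ h1 h2 h3 v
  simp only [Pi.smul_apply, smul_comm _ c, integral_smul, inner_smul_right,
    h.integral_eq h1 h2 h3 v]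
  simp

lemma gradient_continuous {φ : Eucl N → ℝ} (hφ : ContDiff ℝ ∞ φ) : Continuous (gradient φ) := by
  unfold gradient
  exact (InnerProductSpace.toDual ℝ (Eucl N)).symm.continuous.comp
    (hφ.continuous_fderiv (by simp))

lemma hasWeakGradient_of_contDiff {φ : Eucl N → ℝ} (hφ : ContDiff ℝ ∞ φ) :
    HasWeakGradient Ω φ (gradient φ) := by
  refine ⟨(hφ.continuous.locallyIntegrable).locallyIntegrableOn _,
    (gradient_continuous hφ).locallyIntegrable.locallyIntegrableOn _, fun ψ h1 h2 h3 v => ?_⟩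
  have hsub := (tsupport_fderiv_apply_subset ψ v).trans h3
  have c1 := continuous_fderiv_apply hφ v
  have c2 := continuous_fderiv_apply h1 v
  have s2 := hasCompactSupport_fderiv_apply h2 v
  have e1 : ∫ x in Ω, φ x * fderiv ℝ ψ x v = ∫ x, φ x * fderiv ℝ ψ x v := by
    simpa only [smul_eq_mul, mul_comm] using setIntegral_test_smul (f := φ) hsub
  have e2 : ∫ x in Ω, inner ℝ (gradient φ x) v * ψ x = ∫ x, fderiv ℝ φ x v * ψ x := by
    simp only [inner_gradient_left]
    simpa only [smul_eq_mul, mul_comm] using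
      setIntegral_test_smul (f := fun x => fderiv ℝ φ x v) h3
  rw [e1, e2]
  refine integral_mul_fderiv_eq_neg_fderiv_mul_of_integrable ?_ ?_ ?_
    (fun x _ => hφ.contDiffAt.differentiableAt (by simp))
    (fun x _ => h1.contDiffAt.differentiableAt (by simp))
  · exact (c1.mul h1.continuous).integrable_of_hasCompactSupport h2.mul_left
  · exact (hφ.continuous.mul c2).integrable_of_hasCompactSupport s2.mul_left
  · exact (hφ.continuous.mul h1.continuous).integrable_of_hasCompactSupport h2.mul_left

lemma tendsto_integral_smul_of_tendsto_eLpNorm {F X : Type*} [NormedAddCommGroup F]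
    [NormedSpace ℝ F] [MeasurableSpace X] {ν : Measure X} [IsFiniteMeasure ν] {p : ℝ≥0∞}
    (hp : 1 ≤ p) {f : ℕ → X → F} {g : X → F} (hf : ∀ n, MemLp (f n) p ν) (hg : MemLp g p ν)
    (h : Tendsto (fun n => eLpNorm (f n - g) p ν) atTop (𝓝 0)) {ψ : X → ℝ}
    (hψ : AEStronglyMeasurable ψ ν) {C : ℝ} (hC : ∀ x, ‖ψ x‖ ≤ C) :
    Tendsto (fun n => ∫ x, ψ x • f n x ∂ν) atTop (𝓝 (∫ x, ψ x • g x ∂ν)) := by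
  have hi : ∀ w : X → F, MemLp w p ν → Integrable (fun x => ψ x • w x) ν := fun w hw =>
    (hw.integrable hp).bdd_smul C hψ (.of_forall hC)
  refine tendsto_integral_of_L1' _ (hi g hg).1 (.of_forall fun n => hi _ (hf n)) ?_
  have hle : ∀ n, eLpNorm ((fun x => ψ x • f n x) - fun x => ψ x • g x) 1 ν ≤
      ENNReal.ofReal C * (eLpNorm (f n - g) p ν * ν univ ^ (1 - 1 / p.toReal)) := by
    intro n
    refine (eLpNorm_le_mul_eLpNorm_of_ae_le_mul (g := f n - g) (c := C)
      (.of_forall fun x => ?_) 1).trans ?_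
    · simp only [Pi.sub_apply, ← smul_sub, norm_smul]
      gcongr
      exact hC x
    · gcongr
      have := eLpNorm_le_eLpNorm_mul_rpow_measure_univ hp ((hf n).sub hg).1
      simpa using this
  refine tendsto_of_tendsto_of_tendsto_of_le_of_le tendsto_const_nhds ?_ (fun _ => zero_le) hle
  have hfin : ν univ ^ (1 - 1 / p.toReal) ≠ ⊤ := by
    refine ENNReal.rpow_ne_top_of_nonneg ?_ (measure_ne_top _ _)
    rcases eq_or_ne p ∞ with rfl | hpt
    · simp
    · have : 1 ≤ p.toReal := by
        rw [← ENNReal.toReal_one]; exact ENNReal.toReal_mono hpt hp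
      rw [sub_nonneg, div_le_one (by linarith)]
      exact this
  have h1 := ENNReal.Tendsto.mul_const (b := ν univ ^ (1 - 1 / p.toReal)) h (Or.inr hfin)
  rw [zero_mul] at h1
  have h2 := ENNReal.Tendsto.const_mul (a := ENNReal.ofReal C) h1 (Or.inr ENNReal.ofReal_ne_top)
  rwa [mul_zero] at h2

lemma MemLp.locallyIntegrableOn_of_finite {F : Type*} [NormedAddCommGroup F]
    [IsFiniteMeasure (volume.restrict Ω)] {p : ℝ≥0∞} (hp : 1 ≤ p) {f : Eucl N → F}
    (hf : MemLp f p (volume.restrict Ω)) : LocallyIntegrableOn f Ω volume :=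
  IntegrableOn.locallyIntegrableOn (hf.integrable hp)

/-- The weak gradient is a closed operator in `L^p`. -/
lemma hasWeakGradient_of_tendsto [IsFiniteMeasure (volume.restrict Ω)] {p : ℝ≥0∞}
    (hp : 1 ≤ p) {u : ℕ → Eucl N → ℝ} {g : ℕ → Eucl N → Eucl N} {u' : Eucl N → ℝ}
    {g' : Eucl N → Eucl N} (h : ∀ n, HasWeakGradient Ω (u n) (g n))
    (hu : ∀ n, MemLp (u n) p (volume.restrict Ω)) (hg : ∀ n, MemLp (g n) p (volume.restrict Ω))
    (hu' : MemLp u' p (volume.restrict Ω)) (hg' : MemLp g' p (volume.restrict Ω))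
    (hlu : Tendsto (fun n => eLpNorm (u n - u') p (volume.restrict Ω)) atTop (𝓝 0))
    (hlg : Tendsto (fun n => eLpNorm (g n - g') p (volume.restrict Ω)) atTop (𝓝 0)) :
    HasWeakGradient Ω u' g' := by
  rw [hasWeakGradient_iff (MemLp.locallyIntegrableOn_of_finite hp hu')
    (MemLp.locallyIntegrableOn_of_finite hp hg')]
  intro φ h1 h2 h3 v
  obtain ⟨C, hC⟩ := h2.exists_bound_of_continuous h1.continuous
  obtain ⟨C', hC'⟩ := (hasCompactSupport_fderiv_apply h2 v).exists_bound_of_continuous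
    (continuous_fderiv_apply h1 v)
  have t1 := tendsto_integral_smul_of_tendsto_eLpNorm hp hu hu' hlu
    (continuous_fderiv_apply h1 v).aestronglyMeasurable hC'
  have t2 := tendsto_integral_smul_of_tendsto_eLpNorm hp hg hg' hlg
    h1.continuous.aestronglyMeasurable hC
  simp only [fun n => (h n).integral_eq h1 h2 h3 v] at t1
  exact tendsto_nhds_unique t1 ((tendsto_const_nhds.inner t2).neg)

end WeakGradient

/-! ### Mollification -/

section Mollifier

variable {N : ℕ} {F : Type*} [NormedAddCommGroup F] [NormedSpace ℝ F] {q : ℝ}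

/-- A smooth compactly supported probability density, not necessarily centred at the origin. -/
structure IsMollifier (k : Eucl N → ℝ) : Prop where
  contDiff : ContDiff ℝ ∞ k
  compact : HasCompactSupport k
  nonneg : ∀ x, 0 ≤ k x
  integral_eq : ∫ x, k x = 1

lemma exists_isMollifier (c : Eucl N) {ρ : ℝ} (hρ : 0 < ρ) :
    ∃ k : Eucl N → ℝ, IsMollifier k ∧ tsupport k ⊆ Metric.closedBall c ρ := by
  let f : ContDiffBump c := ⟨ρ / 2, ρ, by positivity, by linarith⟩
  refine ⟨f.normed volume, ⟨f.contDiff_normed, f.hasCompactSupport_normed, f.nonneg_normed,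
    f.integral_normed⟩, ?_⟩
  rw [f.tsupport_normed_eq]

/-- The convolution `k ⋆ f`. -/
noncomputable def mollify (k : Eucl N → ℝ) (f : Eucl N → F) (x : Eucl N) : F :=
  ∫ t, k t • f (x - t)

lemma mollify_eq_convolution (k : Eucl N → ℝ) (f : Eucl N → F) :
    mollify k f = convolution k f (ContinuousLinearMap.lsmul ℝ ℝ) volume := rfl

lemma mollify_eq_swap (k : Eucl N → ℝ) (f : Eucl N → F) (x : Eucl N) :
    mollify k f x = ∫ y, k (x - y) • f y := by
  rw [mollify_eq_convolution, convolution_lsmul_swap]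

lemma aestronglyMeasurable_comp_sub {F : Type*} [NormedAddCommGroup F] {f : Eucl N → F} (hf : AEStronglyMeasurable f volume)
    (A : Set (Eucl N)) : AEStronglyMeasurable (Function.uncurry fun x t : Eucl N => f (x - t))
      ((volume.restrict A).prod volume) := by
  have h1 : AEStronglyMeasurable (fun z : Eucl N × Eucl N => f (z.1 - z.2))
      ((volume : Measure (Eucl N)).prod volume) :=
    hf.comp_quasiMeasurePreserving
      (quasiMeasurePreserving_sub_of_right_invariant (volume : Measure (Eucl N)) volume)
  exact h1.mono_ac
    (Measure.restrict_le_self.absolutelyContinuous.prod Measure.AbsolutelyContinuous.rfl)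

namespace IsMollifier

variable {k : Eucl N → ℝ} (hk : IsMollifier k)
include hk

lemma integrable : Integrable k :=
  hk.contDiff.continuous.integrable_of_hasCompactSupport hk.compact

lemma lintegral_ofReal : ∫⁻ x, ENNReal.ofReal (k x) = 1 := by
  rw [← ofReal_integral_eq_lintegral_ofReal hk.integrable (.of_forall hk.nonneg), hk.integral_eq,
    ENNReal.ofReal_one]

lemma isProbabilityMeasure :
    IsProbabilityMeasure (volume.withDensity fun x => ENNReal.ofReal (k x)) :=
  ⟨by rw [withDensity_apply _ MeasurableSet.univ, Measure.restrict_univ, hk.lintegral_ofReal]⟩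

/-- Minkowski's inequality for averages with weight `k`. -/
lemma lintegral_enorm_integral_smul_rpow_le {X : Type*} [MeasurableSpace X] {ν : Measure X}
    [SFinite ν] (hq : 1 ≤ q) {f : X → Eucl N → F}
    (hf : AEStronglyMeasurable (Function.uncurry f) (ν.prod volume)) {B : ℝ≥0∞}
    (hB : ∀ t ∈ tsupport k, ∫⁻ x, ‖f x t‖ₑ ^ q ∂ν ≤ B) :
    ∫⁻ x, ‖∫ t, k t • f x t‖ₑ ^ q ∂ν ≤ B := by
  have := hk.isProbabilityMeasure
  set P : Measure (Eucl N) := volume.withDensity fun x => ENNReal.ofReal (k x) with hP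
  have hmk : Measurable fun x => ENNReal.ofReal (k x) :=
    hk.contDiff.continuous.measurable.ennreal_ofReal
  have hf' : AEStronglyMeasurable (Function.uncurry f) (ν.prod P) :=
    hf.mono_ac (Measure.AbsolutelyContinuous.rfl.prod (withDensity_absolutelyContinuous _ _))
  have h1 := lintegral_enorm_integral_rpow_le hq hf'
  have e1 : ∀ x, ∫ z, f x z ∂P = ∫ t, k t • f x t := by
    intro x
    rw [hP, integral_withDensity_eq_integral_toReal_smul hmk
      (.of_forall fun _ => ENNReal.ofReal_lt_top)]
    simp only [ENNReal.toReal_ofReal (hk.nonneg _)]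
  simp only [e1] at h1
  refine h1.trans ?_
  have h2 : ∀ᵐ t ∂P, ∫⁻ x, ‖f x t‖ₑ ^ q ∂ν ≤ B := by
    rw [hP, ae_withDensity_iff hmk]
    refine .of_forall fun t ht => hB t (subset_tsupport k ?_)
    rw [Function.mem_support]
    exact fun h => ht (by simp [h])
  calc _ ≤ ∫⁻ _, B ∂P := lintegral_mono_ae h2
    _ = B := by simp

lemma integrable_smul_comp_sub {f : Eucl N → F} (hf : LocallyIntegrable f) (x : Eucl N) :
    Integrable fun t => k t • f (x - t) :=
  hk.compact.convolutionExists_left (ContinuousLinearMap.lsmul ℝ ℝ) hk.contDiff.continuous hf x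

lemma mollify_sub_self [CompleteSpace F] {f : Eucl N → F} (hf : LocallyIntegrable f) (x : Eucl N) :
    mollify k f x - f x = ∫ t, k t • (f (x - t) - f x) := by
  simp only [smul_sub]
  rw [integral_sub (hk.integrable_smul_comp_sub hf x) (hk.integrable.smul_const _),
    integral_smul_const, hk.integral_eq, one_smul]
  rfl

/-- The mollification error on `A` is controlled by the translation errors on `A`. -/
lemma lintegral_mollify_sub_le [CompleteSpace F] (hq : 1 ≤ q) {f : Eucl N → F} (hf : LocallyIntegrable f)
    {A : Set (Eucl N)} {B : ℝ≥0∞}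
    (hB : ∀ t ∈ tsupport k, ∫⁻ x in A, ‖f (x - t) - f x‖ₑ ^ q ≤ B) :
    ∫⁻ x in A, ‖mollify k f x - f x‖ₑ ^ q ≤ B := by
  simp only [hk.mollify_sub_self hf]
  refine hk.lintegral_enorm_integral_smul_rpow_le hq
    (f := fun x t => f (x - t) - f x) ?_ hB
  exact (aestronglyMeasurable_comp_sub hf.aestronglyMeasurable A).sub
    (hf.aestronglyMeasurable.restrict.comp_fst)

lemma lintegral_mollify_le (hq : 1 ≤ q) {f : Eucl N → F} (hf : AEStronglyMeasurable f volume) :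
    ∫⁻ x, ‖mollify k f x‖ₑ ^ q ≤ ∫⁻ x, ‖f x‖ₑ ^ q := by
  have h := hk.lintegral_enorm_integral_smul_rpow_le (ν := volume) hq
    (f := fun x t => f (x - t)) (B := ∫⁻ x, ‖f x‖ₑ ^ q) ?_ fun t _ => ?_
  · exact h
  · simpa using aestronglyMeasurable_comp_sub hf univ
  · exact (lintegral_sub_right_eq_self (fun x => ‖f x‖ₑ ^ q) t).le

lemma contDiff_mollify {f : Eucl N → F} (hf : LocallyIntegrable f) :
    ContDiff ℝ ∞ (mollify k f) := by
  rw [mollify_eq_convolution]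
  exact hk.compact.contDiff_convolution_left (n := ⊤) _ hk.contDiff hf

lemma fderiv_mollify_apply {f : Eucl N → ℝ} (hf : LocallyIntegrable f) (x v : Eucl N) :
    fderiv ℝ (mollify k f) x v = ∫ y, fderiv ℝ k (x - y) v * f y := by
  have e : mollify k f = convolution f k (ContinuousLinearMap.mul ℝ ℝ) volume := by
    ext x
    rw [mollify_eq_swap, convolution_mul]
    simp only [smul_eq_mul, mul_comm]
  have h1 := hk.compact.hasFDerivAt_convolution_right (ContinuousLinearMap.mul ℝ ℝ) hf
    (hk.contDiff.of_le (by simp)) x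
  rw [e, h1.fderiv, convolution_precompR_apply _ hf (hk.compact.fderiv ℝ)
    (hk.contDiff.continuous_fderiv (by simp)), convolution_mul]
  simp only [mul_comm]

end IsMollifier

/-- Mollification converges in `L^q` as the support of the kernel shrinks to the origin. -/
lemma exists_eLpNorm_mollify_sub_le [CompleteSpace F] (hq : 1 ≤ q) {f : Eucl N → F}
    (hf : MemLp f (ENNReal.ofReal q) volume) {ε : ℝ≥0∞} (hε : 0 < ε) :
    ∃ ρ : ℝ, 0 < ρ ∧ ∀ k : Eucl N → ℝ, IsMollifier k → tsupport k ⊆ Metric.closedBall 0 ρ →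
      eLpNorm (mollify k f - f) (ENNReal.ofReal q) volume ≤ ε := by
  have hq0 : 0 < q := by linarith
  have hp1 : (1 : ℝ≥0∞) ≤ ENNReal.ofReal q := by
    rw [← ENNReal.ofReal_one]; exact ENNReal.ofReal_le_ofReal hq
  have : Fact ((1 : ℝ≥0∞) ≤ ENNReal.ofReal q) := ⟨hp1⟩
  have : Fact (ENNReal.ofReal q ≠ ⊤) := ⟨ENNReal.ofReal_ne_top⟩
  -- continuity of translations in `L^q`
  have hcont : Continuous fun t : Eucl N => DomAddAct.mk (-t) +ᵥ hf.toLp f := by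
    have h1 : Continuous fun c : (Eucl N)ᵈᵃᵃ => c +ᵥ hf.toLp f := by fun_prop
    exact h1.comp (DomAddAct.continuous_mk.comp continuous_neg)
  have h0 : Tendsto (fun t : Eucl N => ‖(DomAddAct.mk (-t) +ᵥ hf.toLp f) - hf.toLp f‖ₑ)
      (𝓝 0) (𝓝 0) := by
    have h2 := ((hcont.sub (continuous_const (y := hf.toLp f))).enorm).tendsto 0
    have e : DomAddAct.mk (-(0 : Eucl N)) +ᵥ hf.toLp f = hf.toLp f := by
      rw [neg_zero, DomAddAct.mk_zero, zero_vadd]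
    simp only [Pi.sub_apply] at h2
    rwa [e, sub_self, enorm_zero] at h2
  have h1 := h0.eventually (ge_mem_nhds hε)
  obtain ⟨ρ, hρ, hρ'⟩ := Metric.nhds_basis_closedBall.eventually_iff.1 h1
  refine ⟨ρ, hρ, fun k hk hks => ?_⟩
  have hloc : LocallyIntegrable f := hf.locallyIntegrable hp1
  have hB : ∀ t ∈ tsupport k, ∫⁻ x in univ, ‖f (x - t) - f x‖ₑ ^ q ≤ ε ^ q := by
    intro t ht
    rw [Measure.restrict_univ, ← eLpNorm_rpow_eq_lintegral hq0]
    refine ENNReal.rpow_le_rpow ?_ hq0.le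
    have h2 := hρ' (hks ht)
    rw [DomAddAct.mk_vadd_toLp, ← MemLp.toLp_sub, Lp.enorm_toLp] at h2
    refine le_trans (le_of_eq ?_) h2
    congr 1
    ext x
    simp [sub_eq_neg_add]
  have h3 := hk.lintegral_mollify_sub_le hq hloc hB
  rw [Measure.restrict_univ] at h3
  refine (ENNReal.rpow_le_rpow_iff hq0).1 ?_
  rw [eLpNorm_rpow_eq_lintegral hq0]
  exact h3

end Mollifier

/-! ### The uniform cone property -/

section Cone

variable {N : ℕ} {Ω : Set (Eucl N)}

/-- Near `x`, moving from a point of `Ω` a distance less than `s₀` into the open cone generated by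
the ball of radius `δ` about `v` does not leave `Ω`. (At interior points `v = 0` is allowed.) -/
structure InwardCone (Ω : Set (Eucl N)) (x v : Eucl N) (r δ s₀ : ℝ) : Prop where
  r_pos : 0 < r
  δ_pos : 0 < δ
  s_pos : 0 < s₀
  mem : ∀ y ∈ Ω, y ∈ Metric.ball x r → ∀ s, 0 < s → s < s₀ → ∀ z, ‖z - v‖ < δ → y + s • z ∈ Ω

/-- A boundary chart, shrunk so that the graph function is Lipschitz on it. -/
lemma HasSmoothBoundary.exists_lipschitz_chart (h : HasSmoothBoundary Ω) {x : Eucl N}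
    (hx : x ∈ frontier Ω) :
    ∃ (r : ℝ) (e : Eucl N ≃ₗᵢ[ℝ] WithLp 2 (Eucl (N - 1) × ℝ)) (γ : Eucl (N - 1) → ℝ) (K : NNReal),
      0 < r ∧ Continuous γ ∧ LipschitzOnWith K γ (Metric.ball (e x).fst r) ∧
        ∀ y ∈ Metric.ball x r, (y ∈ Ω ↔ γ (e y).fst < (e y).snd) := by
  obtain ⟨r, hr, e, γ, hγ, hy⟩ := h x hx
  obtain ⟨K, t, ht, hK⟩ := (hγ.of_le (m := 1) (by simp)).locallyLipschitz (e x).fst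
  obtain ⟨r', hr', hrt⟩ := Metric.mem_nhds_iff.1 ht
  refine ⟨min r r', e, γ, K, lt_min hr hr', hγ.continuous,
    hK.mono ((Metric.ball_subset_ball (min_le_right _ _)).trans hrt), fun y hy' =>
      hy y (Metric.ball_subset_ball (min_le_left _ _) hy')⟩

lemma dist_chart_fst_le (e : Eucl N ≃ₗᵢ[ℝ] WithLp 2 (Eucl (N - 1) × ℝ)) (x y : Eucl N) :
    dist (e y).fst (e x).fst ≤ dist y x :=
  (WithLp.dist_fst_le _ _).trans (e.dist_map y x).le

/-- At a boundary point, the cone about the vertical direction of a chart whose opening is small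
compared with the Lipschitz constant of the graph function; at an interior point a ball suffices. -/
theorem exists_inwardCone (hΩ : IsOpen Ω) (h : HasSmoothBoundary Ω) {x : Eucl N}
    (hx : x ∈ closure Ω) : ∃ v r δ s₀, InwardCone Ω x v r δ s₀ := by
  by_cases hxΩ : x ∈ Ω
  · obtain ⟨r, hr, hrΩ⟩ := Metric.isOpen_iff.1 hΩ x hxΩ
    refine ⟨0, r / 2, 1, r / 2, ⟨by positivity, one_pos, by positivity, ?_⟩⟩
    intro y _ hyx s hs hsr z hz
    apply hrΩ
    rw [mem_ball_iff_norm] at hyx ⊢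
    rw [sub_zero] at hz
    calc ‖y + s • z - x‖ = ‖(y - x) + s • z‖ := by congr 1; abel
      _ ≤ ‖y - x‖ + ‖s • z‖ := norm_add_le _ _
      _ < r / 2 + r / 2 := by
        refine add_lt_add_of_lt_of_le hyx ?_
        rw [norm_smul, Real.norm_of_nonneg hs.le]
        nlinarith [norm_nonneg z]
      _ = r := by ring
  · have hxf : x ∈ frontier Ω := by
      rw [frontier, hΩ.interior_eq]; exact ⟨hx, hxΩ⟩
    obtain ⟨r, e, γ, K, hr, -, hK, hy⟩ := h.exists_lipschitz_chart hxf
    set v : Eucl N := e.symm (WithLp.toLp 2 (0, 1)) with hv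
    have hev : e v = WithLp.toLp 2 (0, 1) := by simp [hv]
    have hvn : ‖v‖ = 1 := by
      rw [hv, LinearIsometryEquiv.norm_map, WithLp.prod_norm_eq_of_L2]; simp
    refine ⟨v, r / 2, 1 / ((K : ℝ) + 1), r / 4,
      ⟨by positivity, by positivity, by positivity, ?_⟩⟩
    intro y hyΩ hyx s hs hsr z hz
    have hδ1 : 1 / ((K : ℝ) + 1) ≤ 1 := by
      rw [div_le_one (by positivity)]; linarith [K.coe_nonneg]
    have hzn : ‖z‖ ≤ 2 := by
      calc ‖z‖ = ‖(z - v) + v‖ := by rw [sub_add_cancel]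
        _ ≤ ‖z - v‖ + ‖v‖ := norm_add_le _ _
        _ ≤ 2 := by rw [hvn]; linarith
    have hmem : y + s • z ∈ Metric.ball x r := by
      rw [mem_ball_iff_norm] at hyx ⊢
      calc ‖y + s • z - x‖ = ‖(y - x) + s • z‖ := by congr 1; abel
        _ ≤ ‖y - x‖ + ‖s • z‖ := norm_add_le _ _
        _ < r / 2 + r / 2 := by
          refine add_lt_add_of_lt_of_le hyx ?_
          rw [norm_smul, Real.norm_of_nonneg hs.le]
          nlinarith [norm_nonneg z]
        _ = r := by ring
    have hyr : y ∈ Metric.ball x r := Metric.ball_subset_ball (by linarith) hyx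
    rw [hy _ hmem]
    have h1 := (hy y hyr).1 hyΩ
    have hd : ‖e z - e v‖ < 1 / ((K : ℝ) + 1) := by
      rw [← map_sub, e.norm_map]; exact hz
    have hf : ‖(e z).fst‖ < 1 / ((K : ℝ) + 1) := by
      have h2 := (WithLp.norm_fst_le _ (e z - e v)).trans_lt hd
      have h3 : (e z - e v).fst = (e z).fst := by
        rw [WithLp.sub_fst, hev]; exact sub_zero _
      rwa [h3] at h2
    have hsn : 1 - 1 / ((K : ℝ) + 1) < (e z).snd := by
      have h2 := (WithLp.norm_snd_le _ (e z - e v)).trans_lt hd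
      have h3 : (e z - e v).snd = (e z).snd - 1 := by
        rw [WithLp.sub_snd, hev]; rfl
      rw [h3, Real.norm_eq_abs, abs_lt] at h2
      linarith [h2.1]
    have hL := hK.dist_le_mul (e (y + s • z)).fst
      ((dist_chart_fst_le e x _).trans_lt hmem) (e y).fst ((dist_chart_fst_le e x _).trans_lt hyr)
    simp only [map_add, map_smul, WithLp.add_fst, WithLp.smul_fst, WithLp.add_snd,
      WithLp.smul_snd, smul_eq_mul] at hL ⊢
    rw [dist_eq_norm, dist_eq_norm, add_sub_cancel_left, norm_smul, Real.norm_of_nonneg hs.le,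
      Real.norm_eq_abs] at hL
    have h3 := (abs_le.1 hL).2
    have h4 : (K : ℝ) * (s * ‖(e z).fst‖) ≤ K * (s * (1 / ((K : ℝ) + 1))) := by gcongr
    have h5 : (K : ℝ) * (s * (1 / ((K : ℝ) + 1))) = s * (1 - 1 / ((K : ℝ) + 1)) := by
      field_simp; ring
    have h6 : s * (1 - 1 / ((K : ℝ) + 1)) < s * (e z).snd := by gcongr
    linarith

end Cone

/-! ### Density of smooth functions -/

section Density

variable {N : ℕ} {Ω : Set (Eucl N)}

lemma tsupport_comp_sub_subset (k : Eucl N → ℝ) (x : Eucl N) :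
    tsupport (fun y => k (x - y)) ⊆ {y | x - y ∈ tsupport k} :=
  closure_minimal (fun _ hy => subset_tsupport k hy)
    ((isClosed_tsupport k).preimage (continuous_const.sub continuous_id))

lemma HasCompactSupport.comp_sub {k : Eucl N → ℝ} (hk : HasCompactSupport k) (x : Eucl N) :
    HasCompactSupport fun y => k (x - y) :=
  hk.comp_homeomorph (Homeomorph.subLeft x)

/-- Mollification commutes with the weak gradient of `ζ u`, at points `x` for which
`y ↦ k (x - y) ζ y` is a test function in `Ω`. -/
lemma IsMollifier.gradient_mollify {k : Eucl N → ℝ} (hk : IsMollifier k) (hΩ : IsOpen Ω)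
    {u : Eucl N → ℝ} {g : Eucl N → Eucl N} (h : HasWeakGradient Ω u g) {ζ : Eucl N → ℝ}
    (hζ : ContDiff ℝ ∞ ζ) (hU : LocallyIntegrable (Ω.indicator fun y => ζ y * u y))
    (hG : LocallyIntegrable (Ω.indicator fun y => ζ y • g y + u y • gradient ζ y)) {x : Eucl N}
    (hx : ∀ y ∈ tsupport ζ, x - y ∈ tsupport k → y ∈ Ω) :
    gradient (mollify k (Ω.indicator fun y => ζ y * u y)) x =
      mollify k (Ω.indicator fun y => ζ y • g y + u y • gradient ζ y) x := by
  refine ext_inner_right ℝ fun v => ?_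
  rw [inner_gradient_left, hk.fderiv_mollify_apply hU]
  set κ : Eucl N → ℝ := fun y => k (x - y) with hκ
  have hκs : ContDiff ℝ ∞ κ := hk.contDiff.comp (contDiff_const.sub contDiff_id)
  have hκc : HasCompactSupport κ := HasCompactSupport.comp_sub hk.compact x
  have hκd : ∀ y, fderiv ℝ κ y v = -fderiv ℝ k (x - y) v := by
    intro y
    have h1 : HasFDerivAt k (fderiv ℝ k (x - y)) (x - y) :=
      (hk.contDiff.differentiable (by simp) _).hasFDerivAt
    have h2 : HasFDerivAt (fun y => x - y) (-ContinuousLinearMap.id ℝ (Eucl N)) y :=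
      (hasFDerivAt_id y).const_sub x
    have h3 : HasFDerivAt κ ((fderiv ℝ k (x - y)).comp (-ContinuousLinearMap.id ℝ (Eucl N))) y :=
      h1.comp y h2
    rw [h3.fderiv]
    simp
  have hin : ∀ f f' : Eucl N → ℝ, tsupport f ⊆ tsupport κ → tsupport f' ⊆ tsupport ζ →
      tsupport (fun y => f y * f' y) ⊆ Ω := fun f f' hf hf' y hy =>
    hx y (hf' (tsupport_mul_subset_right hy))
      (tsupport_comp_sub_subset k x (hf (tsupport_mul_subset_left hy)))
  have hκ' := tsupport_fderiv_apply_subset κ v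
  have hζ' := tsupport_fderiv_apply_subset ζ v
  -- the test function and its derivative
  have hψd : ∀ y, fderiv ℝ (fun y => κ y * ζ y) y v =
      κ y * fderiv ℝ ζ y v + fderiv ℝ κ y v * ζ y := by
    intro y
    rw [fderiv_fun_mul (hκs.differentiable (by simp) _) (hζ.differentiable (by simp) _)]
    simp [mul_comm]
  have hw := h.integral_eq (hκs.mul hζ) (hκc.mul_right) (hin κ ζ subset_rfl subset_rfl) v
  have i1 : Integrable fun y => (κ y * fderiv ℝ ζ y v) • u y := integrable_test_smul h.1 (hκs.continuous.mul (continuous_fderiv_apply hζ v))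
    hκc.mul_right (hin _ _ subset_rfl hζ')
  have i2 : Integrable fun y => (fderiv ℝ κ y v * ζ y) • u y := integrable_test_smul h.1 ((continuous_fderiv_apply hκs v).mul hζ.continuous)
    (hasCompactSupport_fderiv_apply hκc v).mul_right (hin _ _ hκ' subset_rfl)
  have i3 : Integrable fun y => (κ y * ζ y) • g y := integrable_test_smul h.2.1 (hκs.continuous.mul hζ.continuous)
    hκc.mul_right (hin _ _ subset_rfl subset_rfl)
  simp only [hψd, add_smul] at hw
  rw [integral_add i1.integrableOn i2.integrableOn] at hw
  have e1 : ∫ y, fderiv ℝ k (x - y) v * Ω.indicator (fun y => ζ y * u y) y =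
      -∫ y in Ω, (fderiv ℝ κ y v * ζ y) • u y := by
    rw [← integral_neg, ← integral_indicator hΩ.measurableSet]
    refine integral_congr_ae (.of_forall fun y => ?_)
    by_cases hy : y ∈ Ω
    · simp only [indicator_of_mem hy, hκd, smul_eq_mul]; ring
    · simp only [indicator_of_notMem hy, mul_zero]
  have iG : Integrable fun y => κ y • Ω.indicator (fun y => ζ y • g y + u y • gradient ζ y) y :=
    (hk.compact.convolutionExists_left (ContinuousLinearMap.lsmul ℝ ℝ)
      hk.contDiff.continuous hG x).integrable_swap
  have e2 : inner ℝ (mollify k (Ω.indicator fun y => ζ y • g y + u y • gradient ζ y) x) v =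
      inner ℝ v (∫ y in Ω, (κ y * ζ y) • g y) + ∫ y in Ω, (κ y * fderiv ℝ ζ y v) • u y := by
    have i4 : Integrable (fun y => inner ℝ v ((κ y * ζ y) • g y)) (volume.restrict Ω) :=
      (i3.const_inner (𝕜 := ℝ) v).integrableOn
    rw [mollify_eq_swap, real_inner_comm, ← integral_inner iG, ← integral_inner i3.integrableOn,
      ← integral_add i4 i1.integrableOn,
      ← integral_indicator hΩ.measurableSet]
    refine integral_congr_ae (.of_forall fun y => ?_)
    by_cases hy : y ∈ Ω
    · simp only [indicator_of_mem hy, inner_smul_right, inner_add_right, smul_eq_mul]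
      rw [inner_gradient_right]
      simp only [conj_trivial]
      ring
    · simp only [indicator_of_notMem hy, smul_zero, inner_zero_right]
  rw [e1, e2]
  linarith

variable {q : ℝ}

/-- `u` and `g` are approximated in `L^q(Ω)` by a smooth function and its gradient. -/
def SmoothApprox (Ω : Set (Eucl N)) (q : ℝ) (u : Eucl N → ℝ) (g : Eucl N → Eucl N) : Prop :=
  ∀ ε : ℝ≥0∞, 0 < ε → ∃ φ : Eucl N → ℝ, ContDiff ℝ ∞ φ ∧
    eLpNorm (φ - u) (ENNReal.ofReal q) (volume.restrict Ω) ≤ ε ∧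
    eLpNorm (gradient φ - g) (ENNReal.ofReal q) (volume.restrict Ω) ≤ ε

lemma memLp_bdd_smul {F : Type*} [NormedAddCommGroup F] [NormedSpace ℝ F] {p : ℝ≥0∞}
    {ν : Measure (Eucl N)} {f : Eucl N → F} (hf : MemLp f p ν)
    {ψ : Eucl N → ℝ} (hψ : Continuous ψ) (hc : HasCompactSupport ψ) :
    MemLp (fun y => ψ y • f y) p ν := by
  obtain ⟨C, hC⟩ := hc.exists_bound_of_continuous hψ
  refine hf.of_le_mul (c := C) (hψ.aestronglyMeasurable.smul hf.1) (.of_forall fun y => ?_)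
  rw [norm_smul]
  gcongr
  exact hC y

lemma memLp_indicator_smul {p : ℝ≥0∞} (hΩ : IsOpen Ω) {u : Eucl N → ℝ} {g : Eucl N → Eucl N}
    (hu : MemLp u p (volume.restrict Ω)) (hg : MemLp g p (volume.restrict Ω))
    {ζ : Eucl N → ℝ} (hζ : ContDiff ℝ ∞ ζ) (hζc : HasCompactSupport ζ) :
    MemLp (Ω.indicator fun y => ζ y * u y) p volume ∧
      MemLp (Ω.indicator fun y => ζ y • g y + u y • gradient ζ y) p volume := by
  constructor
  · rw [memLp_indicator_iff_restrict hΩ.measurableSet]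
    exact memLp_bdd_smul hu hζ.continuous hζc
  · rw [memLp_indicator_iff_restrict hΩ.measurableSet]
    refine (memLp_bdd_smul hg hζ.continuous hζc).add ?_
    have hgc : HasCompactSupport (gradient ζ) :=
      (hζc.fderiv ℝ).comp_left (map_zero (InnerProductSpace.toDual ℝ (Eucl N)).symm)
    obtain ⟨C, hC⟩ := hgc.exists_bound_of_continuous (gradient_continuous hζ)
    refine hu.of_le_mul (c := C) (hu.1.smul (gradient_continuous hζ).aestronglyMeasurable)
      (.of_forall fun y => ?_)
    rw [norm_smul, mul_comm]
    gcongr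
    exact hC y

/-- A mollifier supported near the origin in the opposite of the inward cone. -/
lemma InwardCone.exists_mollifier {x v : Eucl N} {r δ s₀ : ℝ} (h : InwardCone Ω x v r δ s₀)
    {m : ℝ} (hm : 0 < m) : ∃ k : Eucl N → ℝ, IsMollifier k ∧ ∀ t ∈ tsupport k, ‖t‖ ≤ m ∧
      ∀ y ∈ Ω, y ∈ Metric.ball x r → ∀ τ : ℝ, 0 < τ → τ ≤ 1 → y - τ • t ∈ Ω := by
  have hδp := h.δ_pos
  have hsp := h.s_pos
  set R := ‖v‖ + δ with hR
  have hRp : 0 < R := by positivity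
  set s := min (s₀ / 2) (m / R) with hs
  have hs0 : 0 < s := lt_min (by positivity) (by positivity)
  have hss : s < s₀ := (min_le_left _ _).trans_lt (by linarith)
  have hsR : s * R ≤ m := by
    rw [← le_div_iff₀ hRp]; exact min_le_right _ _
  obtain ⟨k, hk, hks⟩ := exists_isMollifier (-(s • v)) (ρ := s * (δ / 2)) (by positivity)
  refine ⟨k, hk, fun t ht => ?_⟩
  have h1 := hks ht
  rw [mem_closedBall_iff_norm, sub_neg_eq_add] at h1
  have h2 : ‖s⁻¹ • (-t) - v‖ ≤ δ / 2 := by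
    have e : s⁻¹ • (-t) - v = -(s⁻¹ • (t + s • v)) := by
      rw [smul_add, smul_smul, inv_mul_cancel₀ hs0.ne', one_smul, smul_neg]; abel
    rw [e, norm_neg, norm_smul, norm_inv, Real.norm_of_nonneg hs0.le, inv_mul_le_iff₀ hs0]
    exact h1
  have h3 : -t = s • (s⁻¹ • (-t)) := by rw [smul_smul, mul_inv_cancel₀ hs0.ne', one_smul]
  have h4 : ‖s⁻¹ • (-t)‖ ≤ R := by
    calc ‖s⁻¹ • (-t)‖ = ‖(s⁻¹ • (-t) - v) + v‖ := by rw [sub_add_cancel]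
      _ ≤ _ := norm_add_le _ _
      _ ≤ R := by rw [hR]; linarith
  refine ⟨?_, fun y hy hyx τ hτ hτ1 => ?_⟩
  · calc ‖t‖ = s * ‖s⁻¹ • (-t)‖ := by
          rw [← norm_neg t, h3, norm_smul, Real.norm_of_nonneg hs0.le, ← h3]
      _ ≤ s * R := by gcongr
      _ ≤ m := hsR
  · have h5 := h.mem y hy hyx (τ * s) (by positivity) (by nlinarith) (s⁻¹ • (-t)) (by linarith)
    rwa [mul_smul, ← h3, smul_neg, ← sub_eq_add_neg] at h5

/-- Approximation of `ζ u` when `ζ` is supported in a chart: mollify the extension of `ζ u` by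
zero with a kernel supported in the opposite of the inward cone, so that at points of `Ω` only
values of `u` in `Ω` are used. -/
lemma smoothApprox_of_inwardCone (hΩ : IsOpen Ω) (hq : 1 < q) {x v : Eucl N} {r δ s₀ : ℝ}
    (hcone : InwardCone Ω x v r δ s₀) {u : Eucl N → ℝ} {g : Eucl N → Eucl N}
    (h : HasWeakGradient Ω u g) (hu : MemLp u (ENNReal.ofReal q) (volume.restrict Ω))
    (hg : MemLp g (ENNReal.ofReal q) (volume.restrict Ω)) {ζ : Eucl N → ℝ}
    (hζ : ContDiff ℝ ∞ ζ) (hζs : tsupport ζ ⊆ Metric.ball x (r / 2)) :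
    SmoothApprox Ω q (fun y => ζ y * u y) (fun y => ζ y • g y + u y • gradient ζ y) := by
  intro ε hε
  have hp1 : (1 : ℝ≥0∞) ≤ ENNReal.ofReal q := by
    rw [← ENNReal.ofReal_one]; exact ENNReal.ofReal_le_ofReal hq.le
  have hζc : HasCompactSupport ζ :=
    (isCompact_closedBall x (r / 2)).of_isClosed_subset (isClosed_tsupport ζ)
      (hζs.trans Metric.ball_subset_closedBall)
  obtain ⟨hU, hG⟩ := memLp_indicator_smul hΩ hu hg hζ hζc
  obtain ⟨ρ₁, hρ₁, H₁⟩ := exists_eLpNorm_mollify_sub_le hq.le hU hε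
  obtain ⟨ρ₂, hρ₂, H₂⟩ := exists_eLpNorm_mollify_sub_le hq.le hG hε
  have hrp := hcone.r_pos
  set m := min (min ρ₁ ρ₂) (r / 2) with hm
  have hmp : 0 < m := lt_min (lt_min hρ₁ hρ₂) (by positivity)
  obtain ⟨k, hk, hkz⟩ := hcone.exists_mollifier hmp
  have hkball : ∀ ρ, m ≤ ρ → tsupport k ⊆ Metric.closedBall 0 ρ := fun ρ hρ t ht => by
    rw [mem_closedBall_zero_iff]; exact (hkz t ht).1.trans hρ
  have hm1 : m ≤ ρ₁ := (min_le_left _ _).trans (min_le_left _ _)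
  have hm2 : m ≤ ρ₂ := (min_le_left _ _).trans (min_le_right _ _)
  have hUl := hU.locallyIntegrable hp1
  have hGl := hG.locallyIntegrable hp1
  refine ⟨mollify k (Ω.indicator fun y => ζ y * u y), hk.contDiff_mollify hUl, ?_, ?_⟩
  · refine le_trans (le_trans (le_of_eq ?_) (eLpNorm_restrict_le _ _ _ Ω)) (H₁ k hk (hkball _ hm1))
    refine eLpNorm_congr_ae ?_
    filter_upwards [ae_restrict_mem hΩ.measurableSet] with y hy
    simp only [Pi.sub_apply, indicator_of_mem hy]
  · refine le_trans (le_trans (le_of_eq ?_) (eLpNorm_restrict_le _ _ _ Ω)) (H₂ k hk (hkball _ hm2))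
    refine eLpNorm_congr_ae ?_
    filter_upwards [ae_restrict_mem hΩ.measurableSet] with y hy
    simp only [Pi.sub_apply, indicator_of_mem hy]
    congr 1
    refine hk.gradient_mollify hΩ h hζ hUl hGl fun z hz hyz => ?_
    obtain ⟨hw1, hw2⟩ := hkz _ hyz
    have h6 := hw2 y hy ?_ 1 one_pos le_rfl
    · rwa [one_smul, sub_sub_cancel] at h6
    have h5 := hζs hz
    rw [mem_ball_iff_norm] at h5 ⊢
    calc ‖y - x‖ = ‖(z - x) + (y - z)‖ := by congr 1; abel
      _ ≤ ‖z - x‖ + ‖y - z‖ := norm_add_le _ _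
      _ < r := by linarith [min_le_right (min ρ₁ ρ₂) (r / 2)]

lemma SmoothApprox.congr {u u' : Eucl N → ℝ} {g g' : Eucl N → Eucl N}
    (h : SmoothApprox Ω q u g) (hu : u =ᵐ[volume.restrict Ω] u')
    (hg : g =ᵐ[volume.restrict Ω] g') : SmoothApprox Ω q u' g' := by
  intro ε hε
  obtain ⟨φ, h1, h2, h3⟩ := h ε hε
  refine ⟨φ, h1, ?_, ?_⟩
  · rwa [← eLpNorm_congr_ae ((ae_eq_refl φ).sub hu)]
  · rwa [← eLpNorm_congr_ae ((ae_eq_refl (gradient φ)).sub hg)]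

lemma gradient_add_apply {φ ψ : Eucl N → ℝ} (hφ : ContDiff ℝ ∞ φ) (hψ : ContDiff ℝ ∞ ψ) :
    gradient (φ + ψ) = gradient φ + gradient ψ := by
  ext1 x
  unfold gradient
  rw [fderiv_add (hφ.differentiable (by simp) _) (hψ.differentiable (by simp) _), map_add]
  rfl

lemma SmoothApprox.add (hq : 1 < q) {u u' : Eucl N → ℝ} {g g' : Eucl N → Eucl N}
    (h : SmoothApprox Ω q u g) (h' : SmoothApprox Ω q u' g')
    (hu : AEStronglyMeasurable u (volume.restrict Ω))
    (hu' : AEStronglyMeasurable u' (volume.restrict Ω))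
    (hg : AEStronglyMeasurable g (volume.restrict Ω))
    (hg' : AEStronglyMeasurable g' (volume.restrict Ω)) :
    SmoothApprox Ω q (u + u') (g + g') := by
  have hp1 : (1 : ℝ≥0∞) ≤ ENNReal.ofReal q := by
    rw [← ENNReal.ofReal_one]; exact ENNReal.ofReal_le_ofReal hq.le
  intro ε hε
  obtain ⟨φ, h1, h2, h3⟩ := h (ε / 2) (ENNReal.half_pos hε.ne')
  obtain ⟨ψ, k1, k2, k3⟩ := h' (ε / 2) (ENNReal.half_pos hε.ne')
  refine ⟨φ + ψ, h1.add k1, ?_, ?_⟩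
  · rw [add_sub_add_comm, ← ENNReal.add_halves ε]
    exact (eLpNorm_add_le (h1.continuous.aestronglyMeasurable.sub hu)
      (k1.continuous.aestronglyMeasurable.sub hu') hp1).trans (add_le_add h2 k2)
  · rw [gradient_add_apply h1 k1, add_sub_add_comm, ← ENNReal.add_halves ε]
    exact (eLpNorm_add_le ((gradient_continuous h1).aestronglyMeasurable.sub hg)
      ((gradient_continuous k1).aestronglyMeasurable.sub hg') hp1).trans (add_le_add h3 k3)

/-- Smooth functions on `ℝ^N` are dense in `W^{1,q}(Ω)`. -/
theorem smoothApprox_of_hasWeakGradient (hΩ : IsOpen Ω) (hb : Bornology.IsBounded Ω)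
    (hs : HasSmoothBoundary Ω) (hq : 1 < q) {u : Eucl N → ℝ} {g : Eucl N → Eucl N}
    (h : HasWeakGradient Ω u g) (hu : MemLp u (ENNReal.ofReal q) (volume.restrict Ω))
    (hg : MemLp g (ENNReal.ofReal q) (volume.restrict Ω)) : SmoothApprox Ω q u g := by
  choose! v r δ s₀ hcone using fun x (hx : x ∈ closure Ω) => exists_inwardCone hΩ hs hx
  have hcpt : IsCompact (closure Ω) := hb.isCompact_closure
  obtain ⟨t, htΩ, ht⟩ := hcpt.elim_nhds_subcover (fun x => Metric.ball x (r x / 2))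
    fun x hx => Metric.ball_mem_nhds x (half_pos (hcone x hx).r_pos)
  obtain ⟨f, hf⟩ := SmoothPartitionOfUnity.exists_isSubordinate (modelWithCornersSelf ℝ (Eucl N))
    hcpt.isClosed (fun i : t => Metric.ball (i : Eucl N) (r i / 2)) (fun i => Metric.isOpen_ball)
    (fun y hy => by
      obtain ⟨i, hi, hyi⟩ := mem_iUnion₂.1 (ht hy)
      exact mem_iUnion.2 ⟨⟨i, hi⟩, hyi⟩)
  have hfs : ∀ i, ContDiff ℝ ∞ (f i) := fun i => contMDiff_iff_contDiff.1 (f i).contMDiff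
  have hfsum : ∀ y ∈ closure Ω, ∑ i : t, f i y = 1 := fun y hy => by
    rw [← finsum_eq_sum_of_fintype]; exact f.sum_eq_one hy
  have hfc : ∀ i, HasCompactSupport (f i) := fun i =>
    (isCompact_closedBall (i : Eucl N) (r i / 2)).of_isClosed_subset (isClosed_tsupport _)
      ((hf i).trans Metric.ball_subset_closedBall)
  have hmeas : ∀ i, AEStronglyMeasurable (fun y => f i y * u y) (volume.restrict Ω) ∧
      AEStronglyMeasurable (fun y => f i y • g y + u y • gradient (f i) y)
        (volume.restrict Ω) := fun i =>
    ⟨(hfs i).continuous.aestronglyMeasurable.mul hu.1,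
      ((hfs i).continuous.aestronglyMeasurable.smul hg.1).add
        (hu.1.smul (gradient_continuous (hfs i)).aestronglyMeasurable)⟩
  have hloc : ∀ i : t, SmoothApprox Ω q (fun y => f i y * u y)
      (fun y => f i y • g y + u y • gradient (f i) y) := fun i =>
    smoothApprox_of_inwardCone hΩ hq (hcone i (htΩ i i.2)) h hu hg (hfs i) (hf i)
  have hsum : ∀ S : Finset t, SmoothApprox Ω q (∑ i ∈ S, fun y => f i y * u y)
      (∑ i ∈ S, fun y => f i y • g y + u y • gradient (f i) y) := by
    classical
    intro S
    induction S using Finset.induction_on with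
    | empty =>
      intro ε _
      refine ⟨0, contDiff_const, by simp, ?_⟩
      have : gradient (0 : Eucl N → ℝ) = 0 := by
        ext1 x
        exact gradient_const x 0
      simp [this]
    | insert i S hi ih =>
      rw [Finset.sum_insert hi, Finset.sum_insert hi]
      exact (hloc i).add hq ih (hmeas i).1
        (Finset.aestronglyMeasurable_sum S fun j _ => (hmeas j).1) (hmeas i).2
        (Finset.aestronglyMeasurable_sum S fun j _ => (hmeas j).2)
  refine (hsum Finset.univ).congr ?_ ?_
  · filter_upwards [ae_restrict_mem hΩ.measurableSet] with y hy
    rw [Finset.sum_apply, ← Finset.sum_mul, hfsum y (subset_closure hy), one_mul]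
  · filter_upwards [ae_restrict_mem hΩ.measurableSet] with y hy
    have hz : ∑ i : t, gradient (f i) y = 0 := by
      have h1 : (fun z => ∑ i : t, f i z) =ᶠ[𝓝 y] fun _ => (1 : ℝ) := by
        filter_upwards [hΩ.mem_nhds hy] with z hz
        exact hfsum z (subset_closure hz)
      have h2 := h1.fderiv_eq (𝕜 := ℝ)
      rw [fderiv_fun_sum fun i _ => (hfs i).differentiable (by simp) _] at h2
      unfold gradient
      rw [← map_sum, h2]
      simp
    rw [Finset.sum_apply, Finset.sum_add_distrib, ← Finset.sum_smul,
      hfsum y (subset_closure hy), one_smul, ← Finset.smul_sum, hz, smul_zero, add_zero]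

end Density

/-! ### Translation and mollification errors in `W^{1,q}` -/

section Translation

variable {N : ℕ} {Ω : Set (Eucl N)} {q : ℝ}

lemma enorm_fderiv_apply_le (φ : Eucl N → ℝ) (x v : Eucl N) :
    ‖fderiv ℝ φ x v‖ₑ ≤ ‖v‖ₑ * ‖gradient φ x‖ₑ := by
  rw [← inner_gradient_left, ← ofReal_norm, ← ofReal_norm, ← ofReal_norm,
    ← ENNReal.ofReal_mul (norm_nonneg _), mul_comm]
  exact ENNReal.ofReal_le_ofReal (norm_inner_le_norm _ _)

lemma lintegral_comp_sub_le (hΩ : IsOpen Ω) {A : Set (Eucl N)} (hA : MeasurableSet A) {t : Eucl N}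
    (h : ∀ x ∈ A, x - t ∈ Ω) (f : Eucl N → ℝ≥0∞) :
    ∫⁻ x in A, f (x - t) ≤ ∫⁻ x in Ω, f x := by
  rw [← lintegral_indicator hA, ← lintegral_indicator hΩ.measurableSet,
    ← lintegral_sub_right_eq_self (Ω.indicator f) t]
  refine lintegral_mono fun x => ?_
  by_cases hx : x ∈ A
  · rw [indicator_of_mem hx, indicator_of_mem (h x hx)]
  · rw [indicator_of_notMem hx]; exact zero_le

/-- Translation error of a smooth function along segments that stay in `Ω`. -/
lemma lintegral_translate_sub_le (hΩ : IsOpen Ω) (hq : 1 ≤ q) {φ : Eucl N → ℝ}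
    (hφ : ContDiff ℝ ∞ φ) {A : Set (Eucl N)} (hA : MeasurableSet A) {t : Eucl N}
    (h : ∀ x ∈ A, ∀ τ : ℝ, 0 < τ → τ ≤ 1 → x - τ • t ∈ Ω) :
    ∫⁻ x in A, ‖φ (x - t) - φ x‖ₑ ^ q ≤ ‖t‖ₑ ^ q * ∫⁻ x in Ω, ‖gradient φ x‖ₑ ^ q := by
  have hq0 : 0 < q := by linarith
  set P : Measure ℝ := volume.restrict (Ioc 0 1) with hP
  have hprob : IsProbabilityMeasure P := ⟨by simp [hP]⟩
  have hFTC : ∀ x, φ (x - t) - φ x = ∫ τ, fderiv ℝ φ (x - τ • t) (-t) ∂P := by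
    intro x
    have hd : ∀ τ : ℝ, HasDerivAt (fun τ : ℝ => φ (x - τ • t)) (fderiv ℝ φ (x - τ • t) (-t)) τ := by
      intro τ
      have h1 : HasFDerivAt φ (fderiv ℝ φ (x - τ • t)) (x - τ • t) :=
        (hφ.differentiable (by simp) _).hasFDerivAt
      have h2 : HasDerivAt (fun τ : ℝ => x - τ • t) (-t) τ := by
        simpa using ((hasDerivAt_id τ).smul_const t).const_sub x
      exact h1.comp_hasDerivAt τ h2
    have hc : Continuous fun τ : ℝ => fderiv ℝ φ (x - τ • t) (-t) :=
      (continuous_fderiv_apply hφ (-t)).comp (by fun_prop)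
    have h3 := intervalIntegral.integral_eq_sub_of_hasDerivAt (a := 0) (b := 1)
      (fun τ _ => hd τ) (hc.intervalIntegrable 0 1)
    rw [intervalIntegral.integral_of_le zero_le_one] at h3
    simp only [one_smul, zero_smul, sub_zero] at h3
    exact h3.symm
  simp only [hFTC]
  have hcont : Continuous (Function.uncurry fun (x : Eucl N) (τ : ℝ) =>
      fderiv ℝ φ (x - τ • t) (-t)) :=
    (continuous_fderiv_apply hφ (-t)).comp (by fun_prop)
  refine (lintegral_enorm_integral_rpow_le (P := P) hq hcont.aestronglyMeasurable).trans ?_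
  have hτ : ∀ᵐ τ ∂P, ∫⁻ x in A, ‖fderiv ℝ φ (x - τ • t) (-t)‖ₑ ^ q ≤
      ‖t‖ₑ ^ q * ∫⁻ x in Ω, ‖gradient φ x‖ₑ ^ q := by
    rw [hP]
    filter_upwards [ae_restrict_mem measurableSet_Ioc] with τ hτ
    calc ∫⁻ x in A, ‖fderiv ℝ φ (x - τ • t) (-t)‖ₑ ^ q
        ≤ ∫⁻ x in A, ‖t‖ₑ ^ q * ‖gradient φ (x - τ • t)‖ₑ ^ q := by
          refine lintegral_mono fun x => ?_
          rw [← ENNReal.mul_rpow_of_nonneg _ _ hq0.le]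
          refine ENNReal.rpow_le_rpow ?_ hq0.le
          simpa using enorm_fderiv_apply_le φ (x - τ • t) (-t)
      _ = ‖t‖ₑ ^ q * ∫⁻ x in A, ‖gradient φ (x - τ • t)‖ₑ ^ q := by
          rw [lintegral_const_mul']
          exact ENNReal.rpow_ne_top_of_nonneg hq0.le enorm_ne_top
      _ ≤ _ := mul_le_mul' le_rfl (lintegral_comp_sub_le hΩ hA
            (fun x hx => h x hx τ hτ.1 hτ.2) fun x => ‖gradient φ x‖ₑ ^ q)
  calc _ ≤ ∫⁻ _, (‖t‖ₑ ^ q * ∫⁻ x in Ω, ‖gradient φ x‖ₑ ^ q) ∂P := lintegral_mono_ae hτ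
    _ = _ := by simp

lemma eLpNorm_indicator_smooth (hΩ : IsOpen Ω) (f : Eucl N → ℝ) (p : ℝ≥0∞) :
    eLpNorm (Ω.indicator f) p volume = eLpNorm f p (volume.restrict Ω) :=
  eLpNorm_indicator_eq_eLpNorm_restrict hΩ.measurableSet

lemma IsMollifier.eLpNorm_mollify_le {k : Eucl N → ℝ} (hk : IsMollifier k) (hq : 1 ≤ q)
    {f : Eucl N → ℝ} (hf : AEStronglyMeasurable f volume) :
    eLpNorm (mollify k f) (ENNReal.ofReal q) volume ≤ eLpNorm f (ENNReal.ofReal q) volume := by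
  have := eLpNorm_le_of_lintegral_le (q := q) (by linarith) (C := 1)
    (by simpa using hk.lintegral_mollify_le hq hf)
  simpa using this

lemma IsMollifier.mollify_sub {k : Eucl N → ℝ} (hk : IsMollifier k) {f g : Eucl N → ℝ}
    (hf : LocallyIntegrable f) (hg : LocallyIntegrable g) :
    mollify k (f - g) = mollify k f - mollify k g := by
  ext x
  simp only [mollify, Pi.sub_apply, smul_sub]
  exact integral_sub (hk.integrable_smul_comp_sub hf x) (hk.integrable_smul_comp_sub hg x)

/-- The error of an inward mollification, on a set `A` from which the support of the kernel only
reaches points of `Ω`. -/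
lemma eLpNorm_mollify_indicator_sub_le (hΩ : IsOpen Ω) (hb : Bornology.IsBounded Ω)
    (hs : HasSmoothBoundary Ω) (hq : 1 < q) {u : Eucl N → ℝ} {g : Eucl N → Eucl N}
    (h : HasWeakGradient Ω u g) (hu : MemLp u (ENNReal.ofReal q) (volume.restrict Ω))
    (hg : MemLp g (ENNReal.ofReal q) (volume.restrict Ω)) {k : Eucl N → ℝ} (hk : IsMollifier k)
    {A : Set (Eucl N)} (hA : MeasurableSet A) (hAΩ : A ⊆ Ω) {m : ℝ}
    (hkA : ∀ t ∈ tsupport k, ‖t‖ ≤ m ∧ ∀ y ∈ A, ∀ τ : ℝ, 0 < τ → τ ≤ 1 → y - τ • t ∈ Ω) :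
    eLpNorm (mollify k (Ω.indicator u) - u) (ENNReal.ofReal q) (volume.restrict A) ≤
      ENNReal.ofReal m * eLpNorm g (ENNReal.ofReal q) (volume.restrict Ω) := by
  have hq0 : 0 < q := by linarith
  have hp1 : (1 : ℝ≥0∞) ≤ ENNReal.ofReal q := by
    rw [← ENNReal.ofReal_one]; exact ENNReal.ofReal_le_ofReal hq.le
  have hU : MemLp (Ω.indicator u) (ENNReal.ofReal q) volume :=
    (memLp_indicator_iff_restrict hΩ.measurableSet).2 hu
  have hUA : Ω.indicator u =ᵐ[volume.restrict A] u := by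
    filter_upwards [ae_restrict_mem hA] with x hx
    rw [indicator_of_mem (hAΩ hx)]
  set p := ENNReal.ofReal q with hp
  refine ENNReal.le_of_forall_pos_le_add fun ε hε _ => ?_
  set c : ℝ≥0∞ := 2 + ENNReal.ofReal m with hc
  have hc0 : c ≠ 0 := by simp [hc]
  have hct : c ≠ ⊤ := by simp [hc]
  set ε' : ℝ≥0∞ := ε / c with hε'
  have hε'0 : 0 < ε' := ENNReal.div_pos (by simpa using hε.ne') hct
  obtain ⟨φ, hφ, hφ1, hφ2⟩ := smoothApprox_of_hasWeakGradient hΩ hb hs hq h hu hg ε' hε'0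
  have hcφ : AEStronglyMeasurable φ (volume.restrict Ω) := hφ.continuous.aestronglyMeasurable
  have hφu : MemLp (φ - u) p (volume.restrict Ω) := by
    refine ⟨hcφ.sub hu.1, hφ1.trans_lt (ENNReal.div_lt_top ENNReal.coe_ne_top hc0)⟩
  have hφL : MemLp φ p (volume.restrict Ω) := by simpa using hφu.add hu
  have hΦ : MemLp (Ω.indicator φ) p volume :=
    (memLp_indicator_iff_restrict hΩ.measurableSet).2 hφL
  have hind : Ω.indicator u - Ω.indicator φ = Ω.indicator (u - φ) := (indicator_sub' _ _ _).symm
  have hφ1' : eLpNorm (Ω.indicator u - Ω.indicator φ) p volume ≤ ε' := by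
    rw [hind, eLpNorm_indicator_smooth hΩ, eLpNorm_sub_comm]; exact hφ1
  have hUl := hU.locallyIntegrable hp1
  have hΦl := hΦ.locallyIntegrable hp1
  have hgφ : eLpNorm (gradient φ) p (volume.restrict Ω) ≤ eLpNorm g p (volume.restrict Ω) + ε' := by
    have e : gradient φ = g + (gradient φ - g) := by abel
    rw [e]
    exact (eLpNorm_add_le hg.1 ((gradient_continuous hφ).aestronglyMeasurable.sub hg.1) hp1).trans
      (add_le_add le_rfl hφ2)
  -- the smooth case
  have hsm : eLpNorm (mollify k (Ω.indicator φ) - Ω.indicator φ) p (volume.restrict A) ≤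
      ENNReal.ofReal m * eLpNorm (gradient φ) p (volume.restrict Ω) := by
    refine eLpNorm_le_of_lintegral_le hq0 ?_
    refine hk.lintegral_mollify_sub_le hq.le hΦl fun t ht => ?_
    obtain ⟨htm, htA⟩ := hkA t ht
    calc ∫⁻ x in A, ‖Ω.indicator φ (x - t) - Ω.indicator φ x‖ₑ ^ q
        = ∫⁻ x in A, ‖φ (x - t) - φ x‖ₑ ^ q := by
          refine setLIntegral_congr_fun hA fun x hx => ?_
          have h1 := htA x hx 1 one_pos le_rfl
          rw [one_smul] at h1
          simp only [indicator_of_mem h1, indicator_of_mem (hAΩ hx)]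
      _ ≤ ‖t‖ₑ ^ q * ∫⁻ x in Ω, ‖gradient φ x‖ₑ ^ q :=
          lintegral_translate_sub_le hΩ hq.le hφ hA htA
      _ ≤ _ := by
          gcongr
          rw [← ofReal_norm]
          exact ENNReal.ofReal_le_ofReal htm
  have hm1 : AEStronglyMeasurable (mollify k (Ω.indicator u)) volume :=
    (hk.contDiff_mollify hUl).continuous.aestronglyMeasurable
  have hm2 : AEStronglyMeasurable (mollify k (Ω.indicator φ)) volume :=
    (hk.contDiff_mollify hΦl).continuous.aestronglyMeasurable
  have e : mollify k (Ω.indicator u) - Ω.indicator u =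
      (mollify k (Ω.indicator u - Ω.indicator φ) - (Ω.indicator u - Ω.indicator φ)) +
        (mollify k (Ω.indicator φ) - Ω.indicator φ) := by
    rw [hk.mollify_sub hUl hΦl]; abel
  have hT : eLpNorm (mollify k (Ω.indicator u - Ω.indicator φ)) p volume ≤ ε' :=
    (hk.eLpNorm_mollify_le hq.le (hU.1.sub hΦ.1)).trans hφ1'
  have hmd : AEStronglyMeasurable (mollify k (Ω.indicator u - Ω.indicator φ)) volume := by
    rw [hk.mollify_sub hUl hΦl]; exact hm1.sub hm2
  calc eLpNorm (mollify k (Ω.indicator u) - u) p (volume.restrict A)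
      = eLpNorm (mollify k (Ω.indicator u) - Ω.indicator u) p (volume.restrict A) :=
        eLpNorm_congr_ae ((ae_eq_refl _).sub hUA.symm)
    _ ≤ eLpNorm (mollify k (Ω.indicator u - Ω.indicator φ) - (Ω.indicator u - Ω.indicator φ)) p
          (volume.restrict A) +
        eLpNorm (mollify k (Ω.indicator φ) - Ω.indicator φ) p (volume.restrict A) := by
        rw [e]
        exact eLpNorm_add_le (hmd.sub (hU.1.sub hΦ.1)).restrict (hm2.sub hΦ.1).restrict hp1
    _ ≤ (ε' + ε') + ENNReal.ofReal m * (eLpNorm g p (volume.restrict Ω) + ε') := by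
        refine add_le_add ?_ (hsm.trans (by gcongr))
        refine (eLpNorm_restrict_le _ _ _ A).trans ?_
        exact (eLpNorm_sub_le hmd (hU.1.sub hΦ.1) hp1).trans (add_le_add hT hφ1')
    _ = ENNReal.ofReal m * eLpNorm g p (volume.restrict Ω) + c * ε' := by rw [hc]; ring
    _ ≤ _ := by
        gcongr
        exact ENNReal.mul_div_le

end Translation

/-! ### Functions with vanishing weak gradient -/

section ZeroGradient

variable {N : ℕ} {Ω : Set (Eucl N)} {q : ℝ}

/-- A mollification of `u` has zero gradient near `x`, so it is constant there, and its distance to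
`u` is at most a multiple of the norm of the weak gradient, that is, zero. -/
lemma exists_ball_ae_eq_const (hΩ : IsOpen Ω) (hb : Bornology.IsBounded Ω)
    (hs : HasSmoothBoundary Ω) (hq : 1 < q) {u : Eucl N → ℝ} (h : HasWeakGradient Ω u 0)
    (hu : MemLp u (ENNReal.ofReal q) (volume.restrict Ω)) {x : Eucl N} (hx : x ∈ Ω) :
    ∃ ρ > 0, Metric.ball x ρ ⊆ Ω ∧ ∃ c : ℝ, ∀ᵐ y ∂volume.restrict (Metric.ball x ρ), u y = c := by
  have hq0 : 0 < q := by linarith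
  have hp1 : (1 : ℝ≥0∞) ≤ ENNReal.ofReal q := by
    rw [← ENNReal.ofReal_one]; exact ENNReal.ofReal_le_ofReal hq.le
  obtain ⟨r, hr, hrΩ⟩ := Metric.isOpen_iff.1 hΩ x hx
  have hsub : Metric.ball x (r / 2) ⊆ Ω := (Metric.ball_subset_ball (by linarith)).trans hrΩ
  refine ⟨r / 2, by positivity, hsub, ?_⟩
  obtain ⟨k, hk, hks⟩ := exists_isMollifier (0 : Eucl N) (ρ := r / 2) (by positivity)
  have hkn : ∀ t ∈ tsupport k, ‖t‖ ≤ r / 2 := fun t ht => by simpa using hks ht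
  have hin : ∀ y ∈ Metric.ball x (r / 2), ∀ z, ‖y - z‖ ≤ r / 2 → z ∈ Ω := by
    intro y hy z hz
    apply hrΩ
    rw [mem_ball_iff_norm] at hy ⊢
    calc ‖z - x‖ = ‖(y - x) - (y - z)‖ := by congr 1; abel
      _ ≤ ‖y - x‖ + ‖y - z‖ := norm_sub_le _ _
      _ < r := by linarith
  have hU : MemLp (Ω.indicator u) (ENNReal.ofReal q) volume :=
    (memLp_indicator_iff_restrict hΩ.measurableSet).2 hu
  have hUl := hU.locallyIntegrable hp1
  have h1 := eLpNorm_mollify_indicator_sub_le hΩ hb hs hq h hu MemLp.zero hk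
    (A := Metric.ball x (r / 2)) measurableSet_ball hsub (m := r / 2) fun t ht =>
      ⟨hkn t ht, fun y hy τ hτ hτ1 => hin y hy _ (by
        rw [sub_sub_cancel, norm_smul, Real.norm_of_nonneg hτ.le]
        nlinarith [hkn t ht, norm_nonneg t])⟩
  rw [eLpNorm_zero, mul_zero, nonpos_iff_eq_zero, eLpNorm_eq_zero_iff
    ((hk.contDiff_mollify hUl).continuous.aestronglyMeasurable.sub
      (hu.1.mono_measure (Measure.restrict_mono hsub le_rfl)))
    (by simpa using hq0)] at h1
  have hgrad : ∀ y ∈ Metric.ball x (r / 2), fderiv ℝ (mollify k (Ω.indicator u)) y = 0 := by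
    intro y hy
    have e1 : (Ω.indicator u) = Ω.indicator fun y => (fun _ => (1 : ℝ)) y * u y := by simp
    have e2 : (Ω.indicator fun y => (fun _ => (1 : ℝ)) y • (0 : Eucl N → Eucl N) y +
        u y • gradient (fun _ : Eucl N => (1 : ℝ)) y) = 0 := by
      simp only [gradient_fun_const, Pi.zero_apply, smul_zero, add_zero]
      exact indicator_zero _ _
    have h2 := hk.gradient_mollify hΩ h (ζ := fun _ => (1 : ℝ)) contDiff_const
      (by rwa [← e1]) (by rw [e2]; exact locallyIntegrable_zero) (x := y)
      (fun z _ hz => hin y hy z (hkn _ hz))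
    rw [e2, ← e1] at h2
    have h3 : gradient (mollify k (Ω.indicator u)) y = 0 := by
      rw [h2]; simp [mollify]
    unfold gradient at h3
    simpa using h3
  obtain ⟨c, hc⟩ := Metric.isOpen_ball.exists_is_const_of_fderiv_eq_zero
    (convex_ball x (r / 2)).isPreconnected
    ((hk.contDiff_mollify hUl).differentiable (by simp)).differentiableOn hgrad
  refine ⟨c, ?_⟩
  filter_upwards [h1, ae_restrict_mem measurableSet_ball] with y hy hyb
  rw [Pi.sub_apply, hc y hyb, Pi.zero_apply, sub_eq_zero] at hy
  exact hy.symm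

/-- On a connected open set a function with zero weak gradient is constant. -/
theorem ae_eq_const_of_hasWeakGradient_zero (hΩ : IsOpen Ω) (hc : IsConnected Ω)
    (hb : Bornology.IsBounded Ω) (hs : HasSmoothBoundary Ω) (hq : 1 < q) {u : Eucl N → ℝ}
    (h : HasWeakGradient Ω u 0) (hu : MemLp u (ENNReal.ofReal q) (volume.restrict Ω)) :
    ∃ c : ℝ, ∀ᵐ y ∂volume.restrict Ω, u y = c := by
  choose! ρ hρ hρΩ c hcρ using fun x (hx : x ∈ Ω) =>
    exists_ball_ae_eq_const hΩ hb hs hq h hu hx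
  have hloc : ∀ x ∈ Ω, ∀ y ∈ Ω, y ∈ Metric.ball x (ρ x) → c x = c y := by
    intro x hx y hy hyx
    set O := Metric.ball x (ρ x) ∩ Metric.ball y (ρ y) with hO
    have hOo : IsOpen O := Metric.isOpen_ball.inter Metric.isOpen_ball
    have hpos : volume O ≠ 0 :=
      (hOo.measure_pos volume ⟨y, hyx, Metric.mem_ball_self (hρ y hy)⟩).ne'
    have : NeZero (volume.restrict O) := ⟨by rwa [Ne, Measure.restrict_eq_zero]⟩
    have h1 : ∀ᵐ z ∂volume.restrict O, u z = c x :=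
      ae_restrict_of_ae_restrict_of_subset inter_subset_left (hcρ x hx)
    have h2 : ∀ᵐ z ∂volume.restrict O, u z = c y :=
      ae_restrict_of_ae_restrict_of_subset inter_subset_right (hcρ y hy)
    obtain ⟨z, hz1, hz2⟩ := (h1.and h2).exists
    rw [← hz1, hz2]
  have hconst : ∀ x ∈ Ω, ∀ y ∈ Ω, c x = c y := by
    intro x hx y hy
    refine hc.isPreconnected.induction₂ (fun x y => c x = c y) (fun x hx => ?_)
      (fun x y z _ _ _ h1 h2 => h1.trans h2) (fun x y _ _ h1 => h1.symm) hx hy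
    filter_upwards [inter_mem_nhdsWithin Ω (Metric.ball_mem_nhds x (hρ x hx))] with y hy
    exact hloc x hx y hy.1 hy.2
  obtain ⟨x₀, hx₀⟩ := hc.nonempty
  refine ⟨c x₀, ?_⟩
  rw [ae_restrict_iff' hΩ.measurableSet, ae_iff]
  refine measure_null_of_locally_null _ fun x hx => ?_
  simp only [Classical.not_imp, mem_ofPred_eq] at hx
  refine ⟨_, inter_mem_nhdsWithin _ (Metric.ball_mem_nhds x (hρ x hx.1)), ?_⟩
  have h1 := hcρ x hx.1
  rw [ae_restrict_iff' measurableSet_ball, ae_iff] at h1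
  refine measure_mono_null ?_ h1
  rintro z ⟨hz1, hz2⟩
  simp only [Classical.not_imp, mem_ofPred_eq] at hz1 ⊢
  exact ⟨hz2, by rw [hconst x hx.1 x₀ hx₀]; exact hz1.2⟩

end ZeroGradient

/-! ### Rellich compactness -/

section Rellich

variable {N : ℕ} {Ω : Set (Eucl N)} {q : ℝ}

/-- The ball of radius `R` in `W^{1,q}(Ω)`. -/
def sobolevBall (Ω : Set (Eucl N)) (q R : ℝ) : Set (Eucl N → ℝ) :=
  {u | MemLp u (ENNReal.ofReal q) (volume.restrict Ω) ∧
    eLpNorm u (ENNReal.ofReal q) (volume.restrict Ω) ≤ ENNReal.ofReal R ∧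
    ∃ g : Eucl N → Eucl N, HasWeakGradient Ω u g ∧
      MemLp g (ENNReal.ofReal q) (volume.restrict Ω) ∧
      eLpNorm g (ENNReal.ofReal q) (volume.restrict Ω) ≤ ENNReal.ofReal R}

lemma sub_mem_sobolevBall (hq : 1 < q) {R : ℝ} (hR : 0 ≤ R) {u w : Eucl N → ℝ}
    (hu : u ∈ sobolevBall Ω q R) (hw : w ∈ sobolevBall Ω q R) :
    u - w ∈ sobolevBall Ω q (2 * R) := by
  have hp1 : (1 : ℝ≥0∞) ≤ ENNReal.ofReal q := by
    rw [← ENNReal.ofReal_one]; exact ENNReal.ofReal_le_ofReal hq.le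
  obtain ⟨h1, h2, g, h3, h4, h5⟩ := hu
  obtain ⟨k1, k2, g', k3, k4, k5⟩ := hw
  have e : ENNReal.ofReal (2 * R) = ENNReal.ofReal R + ENNReal.ofReal R := by
    rw [two_mul, ENNReal.ofReal_add hR hR]
  refine ⟨h1.sub k1, ?_, g - g', ?_, h4.sub k4, ?_⟩
  · rw [e]; exact (eLpNorm_sub_le h1.1 k1.1 hp1).trans (add_le_add h2 k2)
  · have h6 := h3.add (k3.const_smul (-1))
    simpa [sub_eq_add_neg] using h6
  · rw [e]; exact (eLpNorm_sub_le h4.1 k4.1 hp1).trans (add_le_add h5 k5)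

/-- `∫_Ω |u| ≤ C ‖u‖_{L^q(Ω)}` on a set of finite measure. -/
lemma exists_integral_norm_le [IsFiniteMeasure (volume.restrict Ω)] (hq : 1 < q) :
    ∃ C : ℝ, 0 ≤ C ∧ ∀ u : Eucl N → ℝ, MemLp u (ENNReal.ofReal q) (volume.restrict Ω) →
      ∀ R : ℝ, 0 ≤ R → eLpNorm u (ENNReal.ofReal q) (volume.restrict Ω) ≤ ENNReal.ofReal R →
      ∫ x in Ω, ‖u x‖ ≤ C * R := by
  have hp1 : (1 : ℝ≥0∞) ≤ ENNReal.ofReal q := by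
    rw [← ENNReal.ofReal_one]; exact ENNReal.ofReal_le_ofReal hq.le
  set V : ℝ≥0∞ := volume.restrict Ω univ ^
    (1 / (1 : ℝ≥0∞).toReal - 1 / (ENNReal.ofReal q).toReal) with hV
  have hVt : V ≠ ⊤ := by
    refine ENNReal.rpow_ne_top_of_nonneg ?_ (measure_ne_top _ _)
    rw [ENNReal.toReal_ofReal (by linarith), ENNReal.toReal_one, sub_nonneg, div_one,
      div_le_one (by linarith)]
    exact hq.le
  refine ⟨V.toReal, ENNReal.toReal_nonneg, fun u hu R hR huR => ?_⟩
  have h1 := eLpNorm_le_eLpNorm_mul_rpow_measure_univ hp1 hu.1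
  rw [integral_norm_eq_lintegral_enorm hu.1, ← eLpNorm_one_eq_lintegral_enorm]
  refine ENNReal.toReal_le_of_le_ofReal (by positivity) ?_
  rw [ENNReal.ofReal_mul ENNReal.toReal_nonneg, ENNReal.ofReal_toReal hVt, mul_comm]
  exact h1.trans (mul_le_mul' huR le_rfl)

/-- In one chart, finitely many values of an inward mollification determine a function in a ball
of `W^{1,q}(Ω)` up to a small error in `L^q`. -/
lemma exists_finite_discretization_chart (hΩ : IsOpen Ω) (hb : Bornology.IsBounded Ω)
    (hs : HasSmoothBoundary Ω) (hq : 1 < q) {x v : Eucl N} {r δ s₀ : ℝ}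
    (hcone : InwardCone Ω x v r δ s₀) {R : ℝ} (hR : 0 < R) {ε : ℝ} (hε : 0 < ε) :
    ∃ (β : Type) (_ : Fintype β) (Q : (Eucl N → ℝ) → β), ∀ u ∈ sobolevBall Ω q R,
      ∀ w ∈ sobolevBall Ω q R, Q u = Q w →
        eLpNorm (u - w) (ENNReal.ofReal q) (volume.restrict (Ω ∩ Metric.ball x r)) ≤
          ENNReal.ofReal ε := by
  have hq0 : 0 < q := by linarith
  have hp1 : (1 : ℝ≥0∞) ≤ ENNReal.ofReal q := by
    rw [← ENNReal.ofReal_one]; exact ENNReal.ofReal_le_ofReal hq.le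
  have hfin : IsFiniteMeasure (volume.restrict Ω) := ⟨by simpa using hb.measure_lt_top⟩
  set A := Ω ∩ Metric.ball x r with hA
  have hAm : MeasurableSet A := hΩ.measurableSet.inter measurableSet_ball
  set m := ε / 2 / (2 * R) with hm
  have hmp : 0 < m := by positivity
  obtain ⟨k, hk, hkz⟩ := hcone.exists_mollifier hmp
  obtain ⟨L, hL⟩ := (hk.contDiff.of_le (m := 1) (by simp)).lipschitzWith_of_hasCompactSupport
    hk.compact (by simp)
  obtain ⟨B, hB⟩ := hk.compact.exists_bound_of_continuous hk.contDiff.continuous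
  obtain ⟨C, hC0, hC⟩ := exists_integral_norm_le (Ω := Ω) (N := N) hq
  set W : ℝ := ((volume.restrict A univ) ^ (1 / q)).toReal with hW
  have hWt : (volume.restrict A univ) ^ (1 / q) ≠ ⊤ := by
    refine ENNReal.rpow_ne_top_of_nonneg (by positivity) ?_
    rw [Measure.restrict_apply_univ]
    exact ((measure_mono inter_subset_left).trans_lt hb.measure_lt_top).ne
  -- `η` is the mesh in the values and `d` the mesh in space
  set η := ε / 4 / (W + 1) with hη
  have hW0 : 0 ≤ W := ENNReal.toReal_nonneg
  have hηp : 0 < η := by positivity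
  set d := η / (L * (C * (2 * R)) + 1) with hd
  have hdp : 0 < d := by positivity
  obtain ⟨S, hSΩ, hSfin, hS⟩ := totallyBounded_iff_subset.1
    (hb.isCompact_closure.totallyBounded.subset subset_closure) _ (Metric.dist_mem_uniformity hdp)
  set T : (Eucl N → ℝ) → Eucl N → ℝ := fun u => mollify k (Ω.indicator u) with hT
  have hTle : ∀ u ∈ sobolevBall Ω q R, ∀ y, |T u y| ≤ B * (C * R) := by
    intro u hu y
    have h1 : T u y = ∫ z in Ω, k (y - z) * u z := by
      simp only [hT]
      rw [mollify_eq_swap, ← integral_indicator hΩ.measurableSet]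
      refine integral_congr_ae (.of_forall fun z => ?_)
      by_cases hz : z ∈ Ω
      · simp only [indicator_of_mem hz, smul_eq_mul]
      · simp only [indicator_of_notMem hz, smul_zero]
    have hB0 : 0 ≤ B := (norm_nonneg _).trans (hB 0)
    rw [h1, ← Real.norm_eq_abs]
    calc ‖∫ z in Ω, k (y - z) * u z‖ ≤ ∫ z in Ω, B * ‖u z‖ := by
          refine norm_integral_le_of_norm_le ((hu.1.integrable hp1).norm.const_mul B)
            (.of_forall fun z => ?_)
          rw [norm_mul]
          gcongr
          exact hB _
      _ = B * ∫ z in Ω, ‖u z‖ := integral_const_mul _ _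
      _ ≤ B * (C * R) := by
          gcongr
          exact hC u hu.1 R hR.le hu.2.1
  set K : ℤ := ⌈B * (C * R) / η⌉ + 1 with hK
  have hSft : Fintype S := hSfin.fintype
  have hKK : -K ≤ K := by
    have h0 : 0 ≤ B * (C * R) / η := by
      have hB0 : 0 ≤ B := (norm_nonneg _).trans (hB 0)
      positivity
    have : 0 ≤ ⌈B * (C * R) / η⌉ := Int.ceil_nonneg h0
    omega
  classical
  refine ⟨Fin (Fintype.card S) → Icc (-K) K, inferInstance,
    fun u j => projIcc (-K) K hKK ⌊T u ((Fintype.equivFin S).symm j) / η⌋, ?_⟩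
  intro u hu w hw hQ
  have hfloor : ∀ u ∈ sobolevBall Ω q R, ∀ y, ⌊T u y / η⌋ ∈ Icc (-K) K := by
    intro u hu y
    have h1 := abs_le.1 (hTle u hu y)
    have h2 : T u y / η ≤ B * (C * R) / η := by gcongr; exact h1.2
    have h3 : -(B * (C * R) / η) ≤ T u y / η := by
      rw [← neg_div]; gcongr; exact h1.1
    have h4 := Int.le_ceil (B * (C * R) / η)
    constructor
    · rw [Int.le_floor, hK]; push_cast; linarith
    · have h5 := Int.floor_le (T u y / η)
      have h6 : (⌊T u y / η⌋ : ℝ) ≤ ⌈B * (C * R) / η⌉ := by linarith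
      have h7 : ⌊T u y / η⌋ ≤ ⌈B * (C * R) / η⌉ := by exact_mod_cast h6
      omega
  have hval : ∀ y ∈ S, |T u y - T w y| ≤ η := by
    intro y hy
    have h1 := congrFun hQ (Fintype.equivFin S ⟨y, hy⟩)
    simp only [Equiv.symm_apply_apply] at h1
    rw [projIcc_of_mem hKK (hfloor u hu y), projIcc_of_mem hKK (hfloor w hw y)] at h1
    have h2 : ⌊T u y / η⌋ = ⌊T w y / η⌋ := congrArg Subtype.val h1
    have h3 := Int.abs_sub_lt_one_of_floor_eq_floor h2
    rw [← sub_div, abs_div, abs_of_pos hηp, div_lt_one hηp] at h3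
    exact h3.le
  have hz := sub_mem_sobolevBall hq hR.le hu hw
  set z := u - w with hzdef
  have hind : ∀ f : Eucl N → ℝ, MemLp f (ENNReal.ofReal q) (volume.restrict Ω) →
      LocallyIntegrable (Ω.indicator f) volume := fun f hf =>
    ((memLp_indicator_iff_restrict hΩ.measurableSet).2 hf).locallyIntegrable hp1
  have hTz : T z = T u - T w := by
    simp only [hT, hzdef, indicator_sub']
    exact hk.mollify_sub (hind u hu.1) (hind w hw.1)
  have hTlip : ∀ y y', |T z y - T z y'| ≤ L * dist y y' * (C * (2 * R)) := by
    intro y y'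
    have iz := (memLp_indicator_iff_restrict hΩ.measurableSet).2 hz.1
    have h1 : ∀ y, Integrable fun t => k (y - t) • Ω.indicator z t := fun y =>
      (hk.compact.convolutionExists_left (ContinuousLinearMap.lsmul ℝ ℝ)
        hk.contDiff.continuous (hind z hz.1) y).integrable_swap
    simp only [hT]
    rw [mollify_eq_swap, mollify_eq_swap, ← integral_sub (h1 y) (h1 y'), ← Real.norm_eq_abs]
    have h2 : ∫ t, ‖Ω.indicator z t‖ = ∫ t in Ω, ‖z t‖ := by
      rw [← integral_indicator hΩ.measurableSet]
      refine integral_congr_ae (.of_forall fun t => ?_)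
      simp only [norm_indicator_eq_indicator_norm]
    have hi : Integrable fun t => ‖Ω.indicator z t‖ :=
      ((integrable_indicator_iff hΩ.measurableSet).2 (hz.1.integrable hp1)).norm
    calc _ ≤ ∫ t, L * dist y y' * ‖Ω.indicator z t‖ := by
          refine norm_integral_le_of_norm_le (hi.const_mul _) (.of_forall fun t => ?_)
          rw [← sub_smul, norm_smul]
          gcongr
          have h3 := hL.dist_le_mul (y - t) (y' - t)
          rwa [dist_eq_norm, dist_sub_right] at h3
      _ = L * dist y y' * ∫ t in Ω, ‖z t‖ := by rw [integral_const_mul, h2]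
      _ ≤ _ := by
          gcongr
          exact hC z hz.1 _ (by positivity) hz.2.1
  have hTA : ∀ y ∈ A, |T z y| ≤ 2 * η := by
    intro y hy
    obtain ⟨y', hy'S, hyy'⟩ := mem_iUnion₂.1 (hS hy.1)
    have hyy'' : dist y y' < d := hyy'
    have h1 := hTlip y y'
    have h2 := hval y' hy'S
    have h3 : T z y' = T u y' - T w y' := by rw [hTz]; rfl
    rw [← h3] at h2
    have h4 : L * dist y y' * (C * (2 * R)) ≤ η := by
      calc L * dist y y' * (C * (2 * R)) ≤ L * d * (C * (2 * R)) := by gcongr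
        _ = η * ((L * (C * (2 * R))) / (L * (C * (2 * R)) + 1)) := by rw [hd]; ring
        _ ≤ η * 1 := by
          gcongr
          rw [div_le_one (by positivity)]; linarith
        _ = η := mul_one _
    have h5 : T z y = (T z y - T z y') + T z y' := by ring
    rw [h5]
    exact (abs_add_le _ _).trans (by linarith)
  obtain ⟨-, -, g, hg1, hg2, hg3⟩ := id hz
  have hmoll : eLpNorm (T z - z) (ENNReal.ofReal q) (volume.restrict A) ≤
      ENNReal.ofReal (ε / 2) := by
    refine (eLpNorm_mollify_indicator_sub_le hΩ hb hs hq hg1 hz.1 hg2 hk hAm inter_subset_left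
      (m := m) fun t ht => ⟨(hkz t ht).1, fun y hy => (hkz t ht).2 y hy.1 hy.2⟩).trans ?_
    refine (mul_le_mul' le_rfl hg3).trans ?_
    rw [← ENNReal.ofReal_mul hmp.le, hm]
    refine ENNReal.ofReal_le_ofReal (le_of_eq ?_)
    field_simp
  have hTsmall : eLpNorm (T z) (ENNReal.ofReal q) (volume.restrict A) ≤
      ENNReal.ofReal (ε / 2) := by
    refine (eLpNorm_le_of_ae_bound (C := 2 * η) ?_).trans ?_
    · filter_upwards [ae_restrict_mem hAm] with y hy
      exact hTA y hy
    · rw [ENNReal.toReal_ofReal hq0.le, ← one_div, ← ENNReal.ofReal_toReal hWt, ← hW,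
        ← ENNReal.ofReal_mul hW0]
      refine ENNReal.ofReal_le_ofReal ?_
      calc W * (2 * η) = ε / 2 * (W / (W + 1)) := by rw [hη]; field_simp; ring
        _ ≤ ε / 2 * 1 := by
          gcongr
          rw [div_le_one (by positivity)]; linarith
        _ = _ := mul_one _
  have hTm : AEStronglyMeasurable (T z) (volume.restrict A) :=
    (hk.contDiff_mollify (hind z hz.1)).continuous.aestronglyMeasurable
  have hzm : AEStronglyMeasurable z (volume.restrict A) :=
    hz.1.1.mono_measure (Measure.restrict_mono inter_subset_left le_rfl)
  have e : z = T z - (T z - z) := by abel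
  calc eLpNorm z (ENNReal.ofReal q) (volume.restrict A)
      = eLpNorm (T z - (T z - z)) (ENNReal.ofReal q) (volume.restrict A) := by rw [← e]
    _ ≤ _ := eLpNorm_sub_le hTm (hTm.sub hzm) hp1
    _ ≤ ENNReal.ofReal (ε / 2) + ENNReal.ofReal (ε / 2) := add_le_add hTsmall hmoll
    _ = ENNReal.ofReal ε := by
      rw [← ENNReal.ofReal_add (by positivity) (by positivity), add_halves]

/-- Balls of `W^{1,q}(Ω)` are totally bounded in `L^q(Ω)`. -/
theorem totallyBounded_sobolevBall (hΩ : IsOpen Ω) (hb : Bornology.IsBounded Ω)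
    (hs : HasSmoothBoundary Ω) (hq : 1 < q) [Fact ((1 : ℝ≥0∞) ≤ ENNReal.ofReal q)] (R : ℝ) :
    TotallyBounded {f : Lp ℝ (ENNReal.ofReal q) (volume.restrict Ω) |
      (f : Eucl N → ℝ) ∈ sobolevBall Ω q R} := by
  have hq0 : 0 < q := by linarith
  refine TotallyBounded.subset (s₂ := {f : Lp ℝ (ENNReal.ofReal q) (volume.restrict Ω) |
      (f : Eucl N → ℝ) ∈ sobolevBall Ω q (max R 1)}) ?_ ?_
  · rintro f ⟨h1, h2, g, h3, h4, h5⟩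
    have hle := ENNReal.ofReal_le_ofReal (le_max_left R 1)
    exact ⟨h1, h2.trans hle, g, h3, h4, h5.trans hle⟩
  have hR : 0 < max R 1 := lt_max_of_lt_right one_pos
  set R' := max R 1
  choose! v r δ s₀ hcone using fun x (hx : x ∈ closure Ω) => exists_inwardCone hΩ hs hx
  obtain ⟨t, htΩ, ht⟩ := hb.isCompact_closure.elim_nhds_subcover (fun x => Metric.ball x (r x))
    fun x hx => Metric.ball_mem_nhds x (hcone x hx).r_pos
  refine Metric.totallyBounded_of_finite_discretization fun ε hε => ?_
  set n : ℝ := (t.card : ℝ) + 1 with hn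
  have hn0 : 0 < n := by positivity
  set ε' := ε / 2 / n ^ (1 / q) with hε'
  have hε'0 : 0 < ε' := by positivity
  have hch : ∀ i : t, ∃ (β : Type) (_ : Fintype β) (Q : (Eucl N → ℝ) → β),
      ∀ u ∈ sobolevBall Ω q R', ∀ w ∈ sobolevBall Ω q R', Q u = Q w →
        eLpNorm (u - w) (ENNReal.ofReal q) (volume.restrict (Ω ∩ Metric.ball i (r i))) ≤
          ENNReal.ofReal ε' := fun i =>
    exists_finite_discretization_chart hΩ hb hs hq (hcone i (htΩ i i.2)) hR hε'0
  choose β hβ Q hQ using hch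
  classical
  obtain ⟨M, ⟨eM⟩⟩ : ∃ M : ℕ, Nonempty ((∀ i, β i) ≃ Fin M) := ⟨_, ⟨Fintype.equivFin _⟩⟩
  refine ⟨ULift (Fin M), inferInstance, fun f => ⟨eM fun i => Q i f.1⟩, fun f f' hff' => ?_⟩
  have hQi : ∀ i, Q i f.1 = Q i f'.1 := fun i => by
    have h1 := eM.injective (ULift.up_injective hff')
    exact congrFun h1 i
  have hpow : eLpNorm ((f.1 : Eucl N → ℝ) - (f'.1 : Eucl N → ℝ)) (ENNReal.ofReal q) (volume.restrict Ω) ^ q ≤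
      ENNReal.ofReal (ε / 2) ^ q := by
    rw [eLpNorm_rpow_eq_lintegral hq0]
    calc ∫⁻ x in Ω, ‖((f.1 : Eucl N → ℝ) - (f'.1 : Eucl N → ℝ)) x‖ₑ ^ q
        ≤ ∫⁻ x in ⋃ i : t, Ω ∩ Metric.ball (i : Eucl N) (r i),
            ‖((f.1 : Eucl N → ℝ) - (f'.1 : Eucl N → ℝ)) x‖ₑ ^ q := by
          refine lintegral_mono_set fun y hy => ?_
          obtain ⟨i, hi, hyi⟩ := mem_iUnion₂.1 (ht (subset_closure hy))
          exact mem_iUnion.2 ⟨⟨i, hi⟩, hy, hyi⟩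
      _ ≤ ∑' i : t, ∫⁻ x in Ω ∩ Metric.ball (i : Eucl N) (r i),
            ‖((f.1 : Eucl N → ℝ) - (f'.1 : Eucl N → ℝ)) x‖ₑ ^ q := lintegral_iUnion_le _ _
      _ ≤ ∑' _ : t, ENNReal.ofReal ε' ^ q := by
          refine ENNReal.tsum_le_tsum fun i => ?_
          rw [← eLpNorm_rpow_eq_lintegral hq0]
          exact ENNReal.rpow_le_rpow (hQ i _ f.2 _ f'.2 (hQi i)) hq0.le
      _ = ENNReal.ofReal (t.card * ε' ^ q) := by
          rw [tsum_fintype, Finset.sum_const, nsmul_eq_mul, Finset.card_univ, Fintype.card_coe,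
            ENNReal.ofReal_mul (by positivity), ENNReal.ofReal_rpow_of_pos hε'0,
            ENNReal.ofReal_natCast]
      _ ≤ ENNReal.ofReal ((ε / 2) ^ q) := by
          refine ENNReal.ofReal_le_ofReal ?_
          rw [hε', Real.div_rpow (by positivity) (by positivity), ← Real.rpow_mul hn0.le,
            one_div, inv_mul_cancel₀ hq0.ne', Real.rpow_one, mul_div_assoc', div_le_iff₀ hn0,
            mul_comm]
          gcongr
          linarith
      _ = _ := by rw [ENNReal.ofReal_rpow_of_pos (by positivity)]
  have h2 := (ENNReal.rpow_le_rpow_iff hq0).1 hpow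
  rw [Lp.dist_def]
  refine lt_of_le_of_lt (ENNReal.toReal_le_of_le_ofReal (by positivity) h2) (by linarith)

end Rellich

/-! ### Surface integrals on boundary charts -/

section Surface

variable {N : ℕ} {Ω : Set (Eucl N)} {q : ℝ}

/-- The graph parametrisation `y' ↦ (y', γ y')` in the chart `e`. -/
noncomputable def graphPoint (e : Eucl N ≃ₗᵢ[ℝ] WithLp 2 (Eucl (N - 1) × ℝ)) (γ : Eucl (N - 1) → ℝ)
    (y : Eucl (N - 1)) : Eucl N :=
  e.symm (WithLp.toLp 2 (y, γ y))

/-- The vertical unit vector of the chart `e`. -/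
noncomputable def chartUp (e : Eucl N ≃ₗᵢ[ℝ] WithLp 2 (Eucl (N - 1) × ℝ)) : Eucl N :=
  e.symm (WithLp.toLp 2 (0, 1))

variable (e : Eucl N ≃ₗᵢ[ℝ] WithLp 2 (Eucl (N - 1) × ℝ)) {γ : Eucl (N - 1) → ℝ}

lemma norm_chartUp : ‖chartUp e‖ = 1 := by
  rw [chartUp, LinearIsometryEquiv.norm_map, WithLp.prod_norm_eq_of_L2]
  simp

lemma graphPoint_add_smul (y : Eucl (N - 1)) (s : ℝ) :
    graphPoint e γ y + s • chartUp e = e.symm (WithLp.toLp 2 (y, γ y + s)) := by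
  rw [graphPoint, chartUp, ← map_smul, ← map_add]
  congr 1
  rw [← WithLp.toLp_smul, ← WithLp.toLp_add]
  simp

lemma continuous_graphPoint (hγ : Continuous γ) : Continuous (graphPoint e γ) := by
  unfold graphPoint
  fun_prop

lemma lipschitzOnWith_graphPoint {K : NNReal} {S : Set (Eucl (N - 1))}
    (h : LipschitzOnWith K γ S) : LipschitzOnWith (1 + K) (graphPoint e γ) S := by
  refine LipschitzOnWith.of_dist_le_mul fun y hy z hz => ?_
  rw [graphPoint, graphPoint, e.symm.dist_map, dist_eq_norm, ← WithLp.toLp_sub,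
    WithLp.prod_norm_eq_of_L2]
  have h1 := h.dist_le_mul y hy z hz
  rw [dist_eq_norm] at h1
  refine Real.sqrt_le_iff.2 ⟨by positivity, ?_⟩
  simp only [NNReal.coe_add, NNReal.coe_one, dist_eq_norm] at h1 ⊢
  change ‖y - z‖ ^ 2 + ‖γ y - γ z‖ ^ 2 ≤ _
  have h2 := norm_nonneg (y - z)
  have h3 := norm_nonneg (γ y - γ z)
  have h4 : ‖γ y - γ z‖ ^ 2 ≤ (K * ‖y - z‖) ^ 2 := by gcongr
  have h5 : 0 ≤ 2 * (K : ℝ) * ‖y - z‖ ^ 2 := by positivity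
  nlinarith

lemma measurePreserving_graphPoint_add (hγ : Continuous γ) :
    MeasurePreserving (fun p : Eucl (N - 1) × ℝ => graphPoint e γ p.1 + p.2 • chartUp e)
      ((volume : Measure (Eucl (N - 1))).prod volume) volume := by
  have h1 : MeasurePreserving (fun p : Eucl (N - 1) × ℝ => (p.1, γ p.1 + p.2))
      ((volume : Measure (Eucl (N - 1))).prod volume)
      ((volume : Measure (Eucl (N - 1))).prod volume) :=
    (MeasurePreserving.id volume).skew_product (g := fun y s => γ y + s)
      (by fun_prop) (.of_forall fun y => map_add_left_eq_self volume (γ y))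
  have h2 := (e.symm.measurePreserving.comp
    (WithLp.volume_preserving_toLp (Eucl (N - 1)) ℝ)).comp h1
  have h3 : (fun p : Eucl (N - 1) × ℝ => graphPoint e γ p.1 + p.2 • chartUp e) =
      (e.symm ∘ WithLp.toLp 2) ∘ fun p : Eucl (N - 1) × ℝ => (p.1, γ p.1 + p.2) :=
    funext fun p => graphPoint_add_smul e p.1 p.2
  rw [h3]
  exact h2

/-- Integration over a collar above a piece of the graph. -/
lemma lintegral_collar_le (hΩ : IsOpen Ω) (hγ : Continuous γ) {S : Set (Eucl (N - 1))}
    (hS : MeasurableSet S) {h : ℝ}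
    (hin : ∀ y ∈ S, ∀ s, 0 < s → s ≤ h → graphPoint e γ y + s • chartUp e ∈ Ω)
    {W : Eucl N → ℝ≥0∞} (hW : Measurable W) :
    ∫⁻ s in Ioc 0 h, ∫⁻ y in S, W (graphPoint e γ y + s • chartUp e) ≤ ∫⁻ x in Ω, W x := by
  have hm := measurePreserving_graphPoint_add e hγ
  have h1 : ∫⁻ s in Ioc 0 h, ∫⁻ y in S, W (graphPoint e γ y + s • chartUp e) =
      ∫⁻ p in S ×ˢ Ioc 0 h, W (graphPoint e γ p.1 + p.2 • chartUp e)
        ∂((volume : Measure (Eucl (N - 1))).prod volume) := by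
    rw [← Measure.prod_restrict]
    exact (lintegral_prod_symm' _ (hW.comp hm.measurable)).symm
  rw [h1, ← lintegral_indicator (hS.prod measurableSet_Ioc),
    ← lintegral_indicator hΩ.measurableSet,
    ← hm.lintegral_comp (hW.indicator hΩ.measurableSet)]
  refine lintegral_mono fun p => ?_
  by_cases hp : p ∈ S ×ˢ Ioc 0 h
  · rw [indicator_of_mem hp, indicator_of_mem (hin p.1 hp.1 p.2 hp.2.1 hp.2.2)]
  · rw [indicator_of_notMem hp]; exact zero_le

/-- A smooth function on a graph is controlled by its values and derivatives in a collar: with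
`P` the uniform probability on `(0, h]`, `φ(z) = ∫ (φ(z + s n) - (h - s) ∂_n φ(z + s n)) dP(s)`. -/
lemma lintegral_graph_le (hΩ : IsOpen Ω) (hγ : Continuous γ) {S : Set (Eucl (N - 1))}
    (hS : MeasurableSet S) {h : ℝ} (hh : 0 < h) (hq : 1 ≤ q)
    (hin : ∀ y ∈ S, ∀ s, 0 < s → s ≤ h → graphPoint e γ y + s • chartUp e ∈ Ω)
    {φ : Eucl N → ℝ} (hφ : ContDiff ℝ ∞ φ) :
    ∫⁻ y in S, ‖φ (graphPoint e γ y)‖ₑ ^ q ≤ 2 ^ (q - 1) * (ENNReal.ofReal h)⁻¹ *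
      ((∫⁻ x in Ω, ‖φ x‖ₑ ^ q) + ENNReal.ofReal h ^ q * ∫⁻ x in Ω, ‖gradient φ x‖ₑ ^ q) := by
  have hq0 : 0 < q := by linarith
  set n := chartUp e with hn
  set c : ℝ≥0∞ := (ENNReal.ofReal h)⁻¹ with hc
  have hh0 : ENNReal.ofReal h ≠ 0 := by simpa using hh
  set P : Measure ℝ := c • volume.restrict (Ioc 0 h) with hP
  have hprob : IsProbabilityMeasure P :=
    ⟨by simp [hP, hc, ENNReal.inv_mul_cancel hh0 ENNReal.ofReal_ne_top]⟩
  have hctop : c.toReal = h⁻¹ := by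
    rw [hc, ENNReal.toReal_inv, ENNReal.toReal_ofReal hh.le]
  have hcd := continuous_fderiv_apply hφ n
  have hcφ := hφ.continuous
  have hrep : ∀ z, φ z = ∫ s, (φ (z + s • n) - (h - s) * fderiv ℝ φ (z + s • n) n) ∂P := by
    intro z
    have hd : ∀ s : ℝ, HasDerivAt (fun s : ℝ => -((h - s) * φ (z + s • n)))
        (φ (z + s • n) - (h - s) * fderiv ℝ φ (z + s • n) n) s := by
      intro s
      have h1 : HasFDerivAt φ (fderiv ℝ φ (z + s • n)) (z + s • n) :=
        (hφ.differentiable (by simp) _).hasFDerivAt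
      have h2 : HasDerivAt (fun s : ℝ => z + s • n) n s := by
        simpa using ((hasDerivAt_id s).smul_const n).const_add z
      have h3 := (((hasDerivAt_id s).const_sub h).mul (h1.comp_hasDerivAt s h2)).neg
      refine h3.congr_deriv ?_
      simp only [id, Function.comp]
      ring
    have h4 := intervalIntegral.integral_eq_sub_of_hasDerivAt (a := 0) (b := h)
      (fun s _ => hd s) ((by fun_prop : Continuous fun s : ℝ =>
        φ (z + s • n) - (h - s) * fderiv ℝ φ (z + s • n) n).intervalIntegrable 0 h)
    rw [intervalIntegral.integral_of_le hh.le] at h4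
    rw [hP, integral_smul_measure, h4, hctop]
    simp only [sub_self, zero_mul, neg_zero, sub_zero, zero_smul, add_zero, zero_sub, neg_neg,
      smul_eq_mul]
    field_simp
  set W : Eucl N → ℝ≥0∞ := fun x =>
    2 ^ (q - 1) * (‖φ x‖ₑ ^ q + ENNReal.ofReal h ^ q * ‖gradient φ x‖ₑ ^ q) with hWdef
  have hcg := gradient_continuous hφ
  have hm1 : Measurable fun x => ‖φ x‖ₑ ^ q := hcφ.measurable.enorm.pow_const q
  have hm2 : Measurable fun x => ‖gradient φ x‖ₑ ^ q := hcg.measurable.enorm.pow_const q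
  have hW : Measurable W := (hm1.add (hm2.const_mul _)).const_mul _
  have hcG := continuous_graphPoint e hγ
  have hcont : Continuous (Function.uncurry fun (y : Eucl (N - 1)) (s : ℝ) =>
      φ (graphPoint e γ y + s • n) - (h - s) * fderiv ℝ φ (graphPoint e γ y + s • n) n) := by
    unfold Function.uncurry
    fun_prop
  have h2t : (2 : ℝ≥0∞) ^ (q - 1) ≠ ⊤ :=
    ENNReal.rpow_ne_top_of_nonneg (by linarith) ENNReal.ofNat_ne_top
  calc ∫⁻ y in S, ‖φ (graphPoint e γ y)‖ₑ ^ q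
      = ∫⁻ y in S, ‖∫ s, (φ (graphPoint e γ y + s • n) -
          (h - s) * fderiv ℝ φ (graphPoint e γ y + s • n) n) ∂P‖ₑ ^ q := by
        simp only [← hrep]
    _ ≤ ∫⁻ s, (∫⁻ y in S, ‖φ (graphPoint e γ y + s • n) -
          (h - s) * fderiv ℝ φ (graphPoint e γ y + s • n) n‖ₑ ^ q) ∂P :=
        lintegral_enorm_integral_rpow_le hq hcont.aestronglyMeasurable
    _ = c * ∫⁻ s in Ioc 0 h, ∫⁻ y in S, ‖φ (graphPoint e γ y + s • n) -
          (h - s) * fderiv ℝ φ (graphPoint e γ y + s • n) n‖ₑ ^ q := by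
        rw [hP, lintegral_smul_measure, smul_eq_mul]
    _ ≤ c * ∫⁻ s in Ioc 0 h, ∫⁻ y in S, W (graphPoint e γ y + s • n) := by
        refine mul_le_mul' le_rfl (setLIntegral_mono' measurableSet_Ioc fun s hs =>
          lintegral_mono fun y => ?_)
        set z := graphPoint e γ y + s • n
        have h1 : ‖(h - s) * fderiv ℝ φ z n‖ₑ ≤ ENNReal.ofReal h * ‖gradient φ z‖ₑ := by
          rw [enorm_mul]
          refine mul_le_mul' ?_ ?_
          · rw [← ofReal_norm, Real.norm_eq_abs]
            refine ENNReal.ofReal_le_ofReal (abs_le.2 ⟨by linarith [hs.2], by linarith [hs.1]⟩)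
          · refine (enorm_fderiv_apply_le φ z n).trans (le_of_eq ?_)
            rw [← ofReal_norm, hn, norm_chartUp, ENNReal.ofReal_one, one_mul]
        calc ‖φ z - (h - s) * fderiv ℝ φ z n‖ₑ ^ q
            ≤ (‖φ z‖ₑ + ENNReal.ofReal h * ‖gradient φ z‖ₑ) ^ q :=
              ENNReal.rpow_le_rpow (enorm_sub_le.trans (add_le_add le_rfl h1)) hq0.le
          _ ≤ _ := ENNReal.rpow_add_le_mul_rpow_add_rpow _ _ hq
          _ = W z := by rw [ENNReal.mul_rpow_of_nonneg _ _ hq0.le]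
    _ ≤ c * ∫⁻ x in Ω, W x := mul_le_mul' le_rfl (lintegral_collar_le e hΩ hγ hS hin hW)
    _ = _ := by
        rw [hWdef, lintegral_const_mul' _ _ h2t, lintegral_add_left hm1, lintegral_const_mul'
          _ _ (ENNReal.rpow_ne_top_of_nonneg hq0.le ENNReal.ofReal_ne_top)]
        ring

variable {e} in
/-- In a chart the boundary lies on the graph. -/
lemma eq_graphPoint_of_mem_frontier (hΩ : IsOpen Ω) (hγ : Continuous γ) {x : Eucl N} {r : ℝ}
    (hch : ∀ y ∈ Metric.ball x r, (y ∈ Ω ↔ γ (e y).fst < (e y).snd)) {y : Eucl N}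
    (hy : y ∈ frontier Ω) (hyr : y ∈ Metric.ball x r) : y = graphPoint e γ (e y).fst := by
  have h1 : y ∉ Ω := fun h => (hΩ.frontier_eq ▸ hy : y ∈ closure Ω \ Ω).2 h
  have h2 : (e y).snd = γ (e y).fst := by
    by_contra hne
    have h3 : (e y).snd < γ (e y).fst :=
      lt_of_le_of_ne (not_lt.1 fun h => h1 ((hch y hyr).2 h)) hne
    have h4 : ∀ᶠ z in 𝓝 y, (e z).snd < γ (e z).fst := by
      have c1 : Continuous fun z => (e z).snd := by fun_prop
      have c2 : Continuous fun z => γ (e z).fst := by fun_prop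
      exact c1.continuousAt.eventually_lt c2.continuousAt h3
    have h5 := h4.and (Metric.isOpen_ball.mem_nhds hyr)
    obtain ⟨z, ⟨hz1, hz2⟩, hz3⟩ := mem_closure_iff_nhds.1 (frontier_subset_closure hy) _ h5
    exact absurd ((hch z hz2).1 hz3) (not_lt.2 hz1.le)
  rw [graphPoint, ← h2]
  exact (e.symm_apply_apply y).symm

variable {e} in
/-- Surface measure in a chart is at most a constant times Lebesgue measure of the parameters. -/
lemma surfaceMeasure_restrict_le (hΩ : IsOpen Ω) (hγ : Continuous γ) {x : Eucl N} {r r' : ℝ}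
    {K : NNReal} (hr : r' ≤ r) (hK : LipschitzOnWith K γ (Metric.ball (e x).fst r))
    (hch : ∀ y ∈ Metric.ball x r, (y ∈ Ω ↔ γ (e y).fst < (e y).snd)) :
    (surfaceMeasure Ω).restrict (Metric.ball x r') ≤
      ((1 + K : NNReal) : ℝ≥0∞) ^ (N - 1) • (volume.restrict
        (Metric.ball (e x).fst r ∩ graphPoint e γ ⁻¹' Metric.ball x r')).map (graphPoint e γ) := by
  have hcG := continuous_graphPoint e hγ
  refine Measure.le_iff.2 fun A hA => ?_
  rw [Measure.smul_apply, smul_eq_mul, Measure.map_apply hcG.measurable hA,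
    Measure.restrict_apply (hcG.measurable hA), Measure.restrict_apply hA, surfaceMeasure,
    Measure.restrict_apply (hA.inter measurableSet_ball)]
  set T := graphPoint e γ ⁻¹' A ∩ (Metric.ball (e x).fst r ∩ graphPoint e γ ⁻¹' Metric.ball x r')
  have hsub : A ∩ Metric.ball x r' ∩ frontier Ω ⊆ graphPoint e γ '' T := by
    rintro y ⟨⟨hyA, hyr⟩, hyΩ⟩
    have hyr2 : y ∈ Metric.ball x r := Metric.ball_subset_ball hr hyr
    have h1 := eq_graphPoint_of_mem_frontier hΩ hγ hch hyΩ hyr2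
    refine ⟨(e y).fst, ⟨?_, ?_, ?_⟩, h1.symm⟩
    · rw [mem_preimage, ← h1]; exact hyA
    · exact (dist_chart_fst_le e x y).trans_lt hyr2
    · rw [mem_preimage, ← h1]; exact hyr
  refine (measure_mono hsub).trans ?_
  have h2 : LipschitzOnWith (1 + K) (graphPoint e γ) T :=
    (lipschitzOnWith_graphPoint e hK).mono fun y hy => hy.2.1
  have h3 := h2.hausdorffMeasure_image_le (d := ((N - 1 : ℕ) : ℝ)) (Nat.cast_nonneg _)
  have h4 : (volume : Measure (Eucl (N - 1))) = Measure.euclideanHausdorffMeasure (N - 1) :=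
    (EuclideanSpace.euclideanHausdorffMeasure_eq_volume (N - 1)).symm
  rw [h4, Measure.euclideanHausdorffMeasure_def, Measure.euclideanHausdorffMeasure_def,
    Measure.smul_apply, Measure.smul_apply, ENNReal.smul_def, ENNReal.smul_def, smul_eq_mul,
    smul_eq_mul, mul_left_comm]
  refine mul_le_mul' le_rfl ?_
  rwa [ENNReal.rpow_natCast] at h3

/-- **Trace inequality** for smooth functions, with a free collar width `h`. -/
theorem exists_trace_inequality (hΩ : IsOpen Ω) (hb : Bornology.IsBounded Ω)
    (hs : HasSmoothBoundary Ω) (hq : 1 ≤ q) :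
    ∃ C : ℝ≥0∞, C ≠ ⊤ ∧ ∃ h₀ : ℝ, 0 < h₀ ∧ ∀ h, 0 < h → h ≤ h₀ →
      ∀ φ : Eucl N → ℝ, ContDiff ℝ ∞ φ →
        ∫⁻ x, ‖φ x‖ₑ ^ q ∂(surfaceMeasure Ω) ≤ C * (ENNReal.ofReal h)⁻¹ *
          ((∫⁻ x in Ω, ‖φ x‖ₑ ^ q) + ENNReal.ofReal h ^ q * ∫⁻ x in Ω, ‖gradient φ x‖ₑ ^ q) := by
  choose r e γ K hr hγ hK hch using fun x (hx : x ∈ frontier Ω) => hs.exists_lipschitz_chart hx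
  have hcpt : IsCompact (frontier Ω) :=
    hb.isCompact_closure.of_isClosed_subset isClosed_frontier frontier_subset_closure
  obtain ⟨t, ht⟩ := hcpt.elim_nhds_subcover' (fun x hx => Metric.ball x (r x hx / 2))
    fun x hx => Metric.ball_mem_nhds (x : Eucl N) (half_pos (hr x hx))
  obtain ⟨h₀, hh₀, hh₀r⟩ : ∃ h₀ : ℝ, 0 < h₀ ∧ ∀ x ∈ t, h₀ ≤ r x x.2 / 2 := by
    rcases t.eq_empty_or_nonempty with rfl | hne
    · exact ⟨1, one_pos, by simp⟩
    · refine ⟨t.inf' hne fun x => r x x.2 / 2, ?_, fun x hx => Finset.inf'_le _ hx⟩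
      rw [Finset.lt_inf'_iff]
      exact fun x _ => half_pos (hr x x.2)
  refine ⟨∑ x ∈ t, ((1 + K x x.2 : NNReal) : ℝ≥0∞) ^ (N - 1) * 2 ^ (q - 1), ?_, h₀, hh₀, ?_⟩
  · refine ENNReal.sum_ne_top.2 fun x _ => ENNReal.mul_ne_top (ENNReal.pow_ne_top
      ENNReal.coe_ne_top) (ENNReal.rpow_ne_top_of_nonneg (by linarith) ENNReal.ofNat_ne_top)
  intro h hh hhh φ hφ
  have hsum : surfaceMeasure Ω ≤
      ∑ x ∈ t, (surfaceMeasure Ω).restrict (Metric.ball (x : Eucl N) (r x x.2 / 2)) := by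
    refine Measure.le_iff.2 fun A hA => ?_
    rw [Measure.finsetSum_apply]
    have h1 : surfaceMeasure Ω A ≤ surfaceMeasure Ω (⋃ x ∈ t, A ∩ Metric.ball (x : Eucl N) (r x x.2 / 2)) := by
      rw [surfaceMeasure, Measure.restrict_apply hA]
      refine le_trans (measure_mono ?_) (Measure.le_restrict_apply _ _)
      rintro y ⟨hyA, hyΩ⟩
      obtain ⟨x, hx, hyx⟩ := mem_iUnion₂.1 (ht hyΩ)
      exact ⟨mem_iUnion₂.2 ⟨x, hx, hyA, hyx⟩, hyΩ⟩
    refine h1.trans ((measure_biUnion_finset_le _ _).trans (Finset.sum_le_sum fun x _ => ?_))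
    rw [Measure.restrict_apply hA]
  refine (lintegral_mono' hsum le_rfl).trans ?_
  rw [lintegral_finsetSum_measure, Finset.sum_mul, Finset.sum_mul]
  refine Finset.sum_le_sum fun x hx => ?_
  have hxΩ := x.2
  refine (lintegral_mono' (surfaceMeasure_restrict_le hΩ (hγ x hxΩ)
    (by linarith [hr x hxΩ]) (hK x hxΩ) (hch x hxΩ)) le_rfl).trans ?_
  have hcG := continuous_graphPoint (e x hxΩ) (hγ x hxΩ)
  rw [lintegral_smul_measure, smul_eq_mul,
    lintegral_map (hφ.continuous.measurable.enorm.pow_const q) hcG.measurable]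
  rw [mul_assoc, mul_assoc, ← mul_assoc (2 ^ (q - 1))]
  refine mul_le_mul' le_rfl (lintegral_graph_le (e x hxΩ) hΩ (hγ x hxΩ)
    (measurableSet_ball.inter (hcG.measurable measurableSet_ball)) hh hq ?_ hφ)
  intro y hy s hs0 hsh
  have h1 : graphPoint (e x hxΩ) (γ x hxΩ) y + s • chartUp (e x hxΩ) ∈ Metric.ball (x : Eucl N) (r x hxΩ) := by
    have h2 : dist (graphPoint (e x hxΩ) (γ x hxΩ) y) (x : Eucl N) < r x x.2 / 2 := hy.2
    rw [Metric.mem_ball]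
    calc _ ≤ dist (graphPoint (e x hxΩ) (γ x hxΩ) y + s • chartUp (e x hxΩ)) (graphPoint (e x hxΩ) (γ x hxΩ) y) +
          dist (graphPoint (e x hxΩ) (γ x hxΩ) y) (x : Eucl N) := dist_triangle _ _ _
      _ < s + r x x.2 / 2 := by
          rw [dist_eq_norm, add_sub_cancel_left, norm_smul, norm_chartUp, Real.norm_eq_abs,
            abs_of_pos hs0, mul_one]
          linarith
      _ ≤ r x hxΩ := by linarith [hh₀r x hx]
  rw [hch x hxΩ _ h1, graphPoint_add_smul, LinearIsometryEquiv.apply_symm_apply]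
  simpa using hs0

end Surface

/-! ### The trace operator -/

section Trace

variable {N : ℕ} {Ω : Set (Eucl N)} {q : ℝ}

lemma gradient_add_smul_apply {φ ψ : Eucl N → ℝ} (hφ : ContDiff ℝ ∞ φ) (hψ : ContDiff ℝ ∞ ψ)
    (c : ℝ) (x : Eucl N) :
    gradient (φ + c • ψ) x = gradient φ x + c • gradient ψ x := by
  have h : ContDiff ℝ ∞ (c • ψ) := hψ.const_smul c
  rw [gradient_add_apply hφ h, Pi.add_apply]
  congr 1
  rw [gradient, gradient, fderiv_const_smul (hψ.differentiable (by simp) x)]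
  simp

lemma isFiniteMeasure_surfaceMeasure (hΩ : IsOpen Ω) (hb : Bornology.IsBounded Ω)
    (hs : HasSmoothBoundary Ω) : IsFiniteMeasure (surfaceMeasure Ω) := by
  obtain ⟨C, hC, h₀, hh₀, h⟩ := exists_trace_inequality hΩ hb hs le_rfl
  have h1 := h h₀ hh₀ le_rfl (fun _ => 1) contDiff_const
  have h2 : gradient (fun _ : Eucl N => (1 : ℝ)) = 0 := by
    ext1 x; simp [gradient]
  simp only [h2, enorm_one, ENNReal.one_rpow, lintegral_const, one_mul, Pi.zero_apply, enorm_zero,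
    ENNReal.zero_rpow_of_pos zero_lt_one, zero_mul, mul_zero, add_zero,
    Measure.restrict_apply_univ] at h1
  refine ⟨h1.trans_lt (ENNReal.mul_lt_top (ENNReal.mul_lt_top hC.lt_top ?_) hb.measure_lt_top)⟩
  exact ENNReal.inv_lt_top.2 (by simpa using hh₀)

lemma memLp_surfaceMeasure_of_continuous [IsFiniteMeasure (surfaceMeasure Ω)]
    (hb : Bornology.IsBounded Ω) {φ : Eucl N → ℝ} (hφ : Continuous φ) (p : ℝ≥0∞) :
    MemLp φ p (surfaceMeasure Ω) := by
  have hcpt : IsCompact (frontier Ω) :=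
    hb.isCompact_closure.of_isClosed_subset isClosed_frontier frontier_subset_closure
  obtain ⟨C, hC⟩ := hcpt.exists_bound_of_continuousOn hφ.continuousOn
  refine MemLp.of_bound hφ.aestronglyMeasurable C ?_
  filter_upwards [ae_restrict_mem isClosed_frontier.measurableSet] with x hx
  exact hC x hx

/-- Trace inequality with an arbitrarily small constant in front of the gradient. -/
theorem exists_eLpNorm_surfaceMeasure_le (hΩ : IsOpen Ω) (hb : Bornology.IsBounded Ω)
    (hs : HasSmoothBoundary Ω) (hq : 1 < q) {ε : ℝ} (hε : 0 < ε) :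
    ∃ C : ℝ, 0 ≤ C ∧ ∀ φ : Eucl N → ℝ, ContDiff ℝ ∞ φ →
      eLpNorm φ (ENNReal.ofReal q) (surfaceMeasure Ω) ≤
        ENNReal.ofReal C * eLpNorm φ (ENNReal.ofReal q) (volume.restrict Ω) +
        ENNReal.ofReal ε * eLpNorm (gradient φ) (ENNReal.ofReal q) (volume.restrict Ω) := by
  have hq0 : 0 < q := by linarith
  obtain ⟨C', hC', h₀, hh₀, H⟩ := exists_trace_inequality hΩ hb hs hq.le
  obtain ⟨C, hC, rfl⟩ : ∃ C : ℝ, 0 ≤ C ∧ ENNReal.ofReal C = C' :=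
    ⟨C'.toReal, ENNReal.toReal_nonneg, ENNReal.ofReal_toReal hC'⟩
  -- the collar width is chosen so that `C h ^ (q - 1) ≤ ε ^ q`
  set h := min h₀ ((ε ^ q / (C + 1)) ^ (1 / (q - 1))) with hh
  have hhp : 0 < h := lt_min hh₀ (by positivity)
  have hq1 : 0 < q - 1 := by linarith
  have hsmall : C * h⁻¹ * h ^ q ≤ ε ^ q := by
    have h1 : h ^ (q - 1) ≤ ε ^ q / (C + 1) := by
      calc h ^ (q - 1) ≤ ((ε ^ q / (C + 1)) ^ (1 / (q - 1))) ^ (q - 1) :=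
            Real.rpow_le_rpow hhp.le (min_le_right _ _) hq1.le
        _ = _ := by
            rw [← Real.rpow_mul (by positivity), one_div, inv_mul_cancel₀ hq1.ne', Real.rpow_one]
    have h2 : h⁻¹ * h ^ q = h ^ (q - 1) := by
      rw [Real.rpow_sub_one hhp.ne']; field_simp
    rw [mul_assoc, h2]
    calc C * h ^ (q - 1) ≤ C * (ε ^ q / (C + 1)) := by gcongr
      _ = ε ^ q * (C / (C + 1)) := by ring
      _ ≤ ε ^ q * 1 := by
          gcongr
          rw [div_le_one (by positivity)]; linarith
      _ = ε ^ q := mul_one _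
  refine ⟨(C * h⁻¹) ^ (1 / q), by positivity, fun φ hφ => ?_⟩
  rw [← ENNReal.rpow_le_rpow_iff hq0]
  refine le_trans ?_ (ENNReal.add_rpow_le_rpow_add _ _ hq.le)
  rw [ENNReal.mul_rpow_of_nonneg _ _ hq0.le, ENNReal.mul_rpow_of_nonneg _ _ hq0.le,
    eLpNorm_rpow_eq_lintegral hq0, eLpNorm_rpow_eq_lintegral hq0, eLpNorm_rpow_eq_lintegral hq0,
    ENNReal.ofReal_rpow_of_nonneg (by positivity) hq0.le,
    ENNReal.ofReal_rpow_of_nonneg hε.le hq0.le,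
    ← Real.rpow_mul (by positivity), one_div, inv_mul_cancel₀ hq0.ne', Real.rpow_one]
  refine (H h hhp (min_le_left _ _) φ hφ).trans ?_
  rw [mul_add, ← ENNReal.ofReal_inv_of_pos hhp, ← ENNReal.ofReal_mul hC, ← mul_assoc]
  refine add_le_add le_rfl (mul_le_mul' ?_ le_rfl)
  rw [ENNReal.ofReal_rpow_of_nonneg hhp.le hq0.le, ← ENNReal.ofReal_mul (by positivity)]
  exact ENNReal.ofReal_le_ofReal hsmall

lemma hasWeakGradient_weakGrad {u : Eucl N → ℝ} (hu : u ∈ sobolev Ω q) :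
    HasWeakGradient Ω u (weakGrad Ω u) := by
  obtain ⟨g, -, hg⟩ := hu.2
  have hex : ∃ g, HasWeakGradient Ω u g := ⟨g, hg⟩
  rw [weakGrad, dif_pos hex]
  exact hex.choose_spec

lemma memLp_weakGrad (hΩ : IsOpen Ω) {u : Eucl N → ℝ} (hu : u ∈ sobolev Ω q) :
    MemLp (weakGrad Ω u) (ENNReal.ofReal q) (volume.restrict Ω) := by
  obtain ⟨g, hg1, hg⟩ := hu.2
  exact hg1.ae_eq (weakGrad_ae_eq hΩ hg).symm

lemma add_smul_mem_sobolev {u w : Eucl N → ℝ} (hu : u ∈ sobolev Ω q) (hw : w ∈ sobolev Ω q)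
    (c : ℝ) : u + c • w ∈ sobolev Ω q := by
  obtain ⟨g, hg1, hg⟩ := hu.2
  obtain ⟨g', hg1', hg'⟩ := hw.2
  exact ⟨hu.1.add (hw.1.const_smul c), g + c • g', hg1.add (hg1'.const_smul c),
    hg.add (hg'.const_smul c)⟩

lemma weakGrad_add_smul (hΩ : IsOpen Ω) {u w : Eucl N → ℝ} (hu : u ∈ sobolev Ω q)
    (hw : w ∈ sobolev Ω q) (c : ℝ) :
    weakGrad Ω (u + c • w) =ᵐ[volume.restrict Ω] weakGrad Ω u + c • weakGrad Ω w :=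
  weakGrad_ae_eq hΩ
    ((hasWeakGradient_weakGrad hu).add ((hasWeakGradient_weakGrad hw).const_smul c))

lemma tendsto_eLpNorm_add_smul_sub {X F : Type*} [MeasurableSpace X] {ν : Measure X}
    [NormedAddCommGroup F] [NormedSpace ℝ F] {p : ℝ≥0∞} (hp : 1 ≤ p) {f g : ℕ → X → F}
    {f' g' : X → F} (hf : ∀ n, AEStronglyMeasurable (f n) ν) (hg : ∀ n, AEStronglyMeasurable (g n) ν)
    (hf' : AEStronglyMeasurable f' ν) (hg' : AEStronglyMeasurable g' ν) (c : ℝ)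
    (h : Tendsto (fun n => eLpNorm (f n - f') p ν) atTop (𝓝 0))
    (h' : Tendsto (fun n => eLpNorm (g n - g') p ν) atTop (𝓝 0)) :
    Tendsto (fun n => eLpNorm ((f n + c • g n) - (f' + c • g')) p ν) atTop (𝓝 0) := by
  have h1 : Tendsto (fun n => eLpNorm (f n - f') p ν + ‖c‖ₑ * eLpNorm (g n - g') p ν) atTop
      (𝓝 0) := by
    simpa using h.add (ENNReal.Tendsto.const_mul h' (.inr enorm_ne_top))
  refine tendsto_of_tendsto_of_tendsto_of_le_of_le tendsto_const_nhds h1 (fun _ => zero_le)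
    fun n => ?_
  have e : (f n + c • g n) - (f' + c • g') = (f n - f') + c • (g n - g') := by
    rw [smul_sub]; abel
  rw [e, ← eLpNorm_const_smul]
  exact eLpNorm_add_le ((hf n).sub hf') (((hg n).sub hg').const_smul c) hp

lemma isTrace_of_contDiff (hΩ : IsOpen Ω) [IsFiniteMeasure (surfaceMeasure Ω)]
    (hb : Bornology.IsBounded Ω) {φ : Eucl N → ℝ} (hφ : ContDiff ℝ ∞ φ) : IsTrace Ω q φ φ := by
  refine ⟨memLp_surfaceMeasure_of_continuous hb hφ.continuous _, fun _ => φ, fun _ => hφ, ?_, ?_, ?_⟩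
  · simp
  · have h1 : ∀ p : ℝ≥0∞, eLpNorm (fun x => gradient φ x - weakGrad Ω φ x) p
        (volume.restrict Ω) = 0 := by
      intro p
      rw [eLpNorm_congr_ae (g := (0 : Eucl N → Eucl N)), eLpNorm_zero]
      filter_upwards [weakGrad_ae_eq hΩ (hasWeakGradient_of_contDiff hφ)] with x hx
      simp [hx]
    simp [h1]
  · simp

lemma IsTrace.eLpNorm_le (hΩ : IsOpen Ω) (hq : 1 < q) {C ε : ℝ}
    (H : ∀ φ : Eucl N → ℝ, ContDiff ℝ ∞ φ →
      eLpNorm φ (ENNReal.ofReal q) (surfaceMeasure Ω) ≤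
        ENNReal.ofReal C * eLpNorm φ (ENNReal.ofReal q) (volume.restrict Ω) +
        ENNReal.ofReal ε * eLpNorm (gradient φ) (ENNReal.ofReal q) (volume.restrict Ω))
    {u t : Eucl N → ℝ} (hu : u ∈ sobolev Ω q) (ht : IsTrace Ω q u t) :
    eLpNorm t (ENNReal.ofReal q) (surfaceMeasure Ω) ≤
      ENNReal.ofReal C * eLpNorm u (ENNReal.ofReal q) (volume.restrict Ω) +
      ENNReal.ofReal ε * eLpNorm (weakGrad Ω u) (ENNReal.ofReal q) (volume.restrict Ω) := by
  have hp1 : (1 : ℝ≥0∞) ≤ ENNReal.ofReal q := by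
    rw [← ENNReal.ofReal_one]; exact ENNReal.ofReal_le_ofReal hq.le
  obtain ⟨htm, φ, hφ, h1, h2, h3⟩ := ht
  have hlim := h3.add ((ENNReal.Tendsto.const_mul (a := ENNReal.ofReal C)
    (h1.add_const (eLpNorm u (ENNReal.ofReal q) (volume.restrict Ω)))
      (.inr ENNReal.ofReal_ne_top)).add (ENNReal.Tendsto.const_mul (a := ENNReal.ofReal ε)
    (h2.add_const (eLpNorm (weakGrad Ω u) (ENNReal.ofReal q) (volume.restrict Ω)))
      (.inr ENNReal.ofReal_ne_top)))
  simp only [zero_add] at hlim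
  refine ge_of_tendsto' hlim fun n => ?_
  have c1 : ∀ ν : Measure (Eucl N), AEStronglyMeasurable (φ n) ν := fun ν =>
    (hφ n).continuous.aestronglyMeasurable
  have c2 := (gradient_continuous (hφ n)).aestronglyMeasurable (μ := volume.restrict Ω)
  have a1 : eLpNorm t (ENNReal.ofReal q) (surfaceMeasure Ω) ≤
      eLpNorm (fun x => φ n x - t x) (ENNReal.ofReal q) (surfaceMeasure Ω) +
        eLpNorm (φ n) (ENNReal.ofReal q) (surfaceMeasure Ω) := by
    have e : t = φ n - (fun x => φ n x - t x) := by ext x; simp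
    conv_lhs => rw [e]
    rw [add_comm]
    exact eLpNorm_sub_le (c1 _) ((c1 _).sub htm.1) hp1
  have a2 : eLpNorm (φ n) (ENNReal.ofReal q) (volume.restrict Ω) ≤
      eLpNorm (fun x => φ n x - u x) (ENNReal.ofReal q) (volume.restrict Ω) +
        eLpNorm u (ENNReal.ofReal q) (volume.restrict Ω) := by
    have e : φ n = (fun x => φ n x - u x) + u := by ext x; simp
    conv_lhs => rw [e]
    exact eLpNorm_add_le ((c1 _).sub hu.1.1) hu.1.1 hp1
  have hg := memLp_weakGrad hΩ hu
  have a3 : eLpNorm (gradient (φ n)) (ENNReal.ofReal q) (volume.restrict Ω) ≤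
      eLpNorm (fun x => gradient (φ n) x - weakGrad Ω u x) (ENNReal.ofReal q)
        (volume.restrict Ω) +
        eLpNorm (weakGrad Ω u) (ENNReal.ofReal q) (volume.restrict Ω) := by
    have e : gradient (φ n) = (fun x => gradient (φ n) x - weakGrad Ω u x) + weakGrad Ω u := by
      ext1 x; simp
    conv_lhs => rw [e]
    exact eLpNorm_add_le (c2.sub hg.1) hg.1 hp1
  exact a1.trans (add_le_add le_rfl ((H _ (hφ n)).trans (by gcongr)))

lemma IsTrace.add_smul (hΩ : IsOpen Ω) (hq : 1 < q) {u u' t t' : Eucl N → ℝ}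
    (hu : u ∈ sobolev Ω q) (hu' : u' ∈ sobolev Ω q) (ht : IsTrace Ω q u t)
    (ht' : IsTrace Ω q u' t') (c : ℝ) : IsTrace Ω q (u + c • u') (t + c • t') := by
  have hp1 : (1 : ℝ≥0∞) ≤ ENNReal.ofReal q := by
    rw [← ENNReal.ofReal_one]; exact ENNReal.ofReal_le_ofReal hq.le
  obtain ⟨htm, φ, hφ, h1, h2, h3⟩ := ht
  obtain ⟨htm', φ', hφ', h1', h2', h3'⟩ := ht'
  refine ⟨htm.add (htm'.const_smul c), fun n => φ n + c • φ' n,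
    fun n => (hφ n).add ((hφ' n).const_smul c), ?_, ?_, ?_⟩
  · exact tendsto_eLpNorm_add_smul_sub hp1 (fun n => (hφ n).continuous.aestronglyMeasurable)
      (fun n => (hφ' n).continuous.aestronglyMeasurable) hu.1.1 hu'.1.1 c h1 h1'
  · have h4 := tendsto_eLpNorm_add_smul_sub hp1
      (fun n => (gradient_continuous (hφ n)).aestronglyMeasurable)
      (fun n => (gradient_continuous (hφ' n)).aestronglyMeasurable)
      (memLp_weakGrad hΩ hu).1 (memLp_weakGrad hΩ hu').1 c h2 h2'
    refine h4.congr fun n => eLpNorm_congr_ae ?_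
    filter_upwards [weakGrad_add_smul hΩ hu hu' c] with x hx
    rw [hx, gradient_add_smul_apply (hφ n) (hφ' n)]
    rfl
  · exact tendsto_eLpNorm_add_smul_sub hp1 (fun n => (hφ n).continuous.aestronglyMeasurable)
      (fun n => (hφ' n).continuous.aestronglyMeasurable) htm.1 htm'.1 c h3 h3'

lemma IsTrace.unique (hΩ : IsOpen Ω) (hb : Bornology.IsBounded Ω) (hs : HasSmoothBoundary Ω)
    (hq : 1 < q) {u t t' : Eucl N → ℝ} (hu : u ∈ sobolev Ω q) (ht : IsTrace Ω q u t)
    (ht' : IsTrace Ω q u t') : t =ᵐ[surfaceMeasure Ω] t' := by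
  obtain ⟨C, -, H⟩ := exists_eLpNorm_surfaceMeasure_le hΩ hb hs hq one_pos
  have hz := add_smul_mem_sobolev hu hu (-1)
  have h1 := IsTrace.eLpNorm_le hΩ hq H hz (ht.add_smul hΩ hq hu hu ht' (-1))
  have e1 : u + (-1 : ℝ) • u = 0 := by simp
  have e2 : weakGrad Ω (u + (-1 : ℝ) • u) =ᵐ[volume.restrict Ω] 0 := by
    filter_upwards [weakGrad_add_smul hΩ hu hu (-1)] with x hx
    rw [hx]
    simp
  rw [eLpNorm_congr_ae e2, e1, eLpNorm_zero, eLpNorm_zero, mul_zero, mul_zero, add_zero,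
    nonpos_iff_eq_zero, eLpNorm_eq_zero_iff (ht.1.1.add (ht'.1.1.const_smul _))
      (by simpa using by linarith)] at h1
  filter_upwards [h1] with x hx
  simp only [Pi.add_apply, Pi.smul_apply, smul_eq_mul, Pi.zero_apply] at hx
  linarith

/-- The boundary values of smooth approximations are Cauchy by the trace inequality. -/
theorem exists_isTrace (hΩ : IsOpen Ω) (hb : Bornology.IsBounded Ω) (hs : HasSmoothBoundary Ω)
    (hq : 1 < q) {u : Eucl N → ℝ} (hu : u ∈ sobolev Ω q) : ∃ t, IsTrace Ω q u t := by
  have hp1 : (1 : ℝ≥0∞) ≤ ENNReal.ofReal q := by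
    rw [← ENNReal.ofReal_one]; exact ENNReal.ofReal_le_ofReal hq.le
  have hfin := isFiniteMeasure_surfaceMeasure hΩ hb hs
  obtain ⟨C, hC, H⟩ := exists_eLpNorm_surfaceMeasure_le hΩ hb hs hq one_pos
  have hg := memLp_weakGrad hΩ hu
  set ε : ℕ → ℝ := fun n => (1 / 2) ^ n / (4 * (C + 1)) with hε
  have hεp : ∀ n, 0 < ε n := fun n => by positivity
  have hεanti : ∀ {m n : ℕ}, m ≤ n → ε n ≤ ε m := fun {m n} hmn => by
    have : ((1 : ℝ) / 2) ^ n ≤ (1 / 2) ^ m :=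
      pow_le_pow_of_le_one (by norm_num) (by norm_num) hmn
    simp only [hε]
    gcongr
  choose φ hφ h1 h2 using fun n => smoothApprox_of_hasWeakGradient hΩ hb hs hq
    (hasWeakGradient_weakGrad hu) hu.1 hg (ENNReal.ofReal (ε n)) (ENNReal.ofReal_pos.2 (hεp n))
  have hlim0 : Tendsto (fun n => ENNReal.ofReal (ε n)) atTop (𝓝 0) := by
    rw [← ENNReal.ofReal_zero]
    refine ENNReal.tendsto_ofReal ?_
    have := (tendsto_pow_atTop_nhds_zero_of_lt_one (r := (1 / 2 : ℝ)) (by norm_num)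
      (by norm_num)).div_const (4 * (C + 1))
    simpa [hε] using this
  have hcau : ∀ k n m : ℕ, k ≤ n → k ≤ m →
      eLpNorm (φ n - φ m) (ENNReal.ofReal q) (surfaceMeasure Ω) < ENNReal.ofReal ((1 / 2) ^ k) := by
    intro k n m hn hm
    have c1 : ∀ n, AEStronglyMeasurable (φ n) (volume.restrict Ω) := fun n =>
      (hφ n).continuous.aestronglyMeasurable
    have c2 : ∀ n, AEStronglyMeasurable (gradient (φ n)) (volume.restrict Ω) := fun n =>
      (gradient_continuous (hφ n)).aestronglyMeasurable
    have b1 : eLpNorm (φ n - φ m) (ENNReal.ofReal q) (volume.restrict Ω) ≤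
        ENNReal.ofReal (2 * ε k) := by
      have e : φ n - φ m = (φ n - u) - (φ m - u) := by abel
      rw [e, two_mul, ENNReal.ofReal_add (hεp k).le (hεp k).le]
      exact (eLpNorm_sub_le ((c1 n).sub hu.1.1) ((c1 m).sub hu.1.1) hp1).trans
        (add_le_add ((h1 n).trans (ENNReal.ofReal_le_ofReal (hεanti hn)))
          ((h1 m).trans (ENNReal.ofReal_le_ofReal (hεanti hm))))
    have b2 : eLpNorm (gradient (φ n - φ m)) (ENNReal.ofReal q) (volume.restrict Ω) ≤
        ENNReal.ofReal (2 * ε k) := by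
      have e : gradient (φ n - φ m) =
          (gradient (φ n) - weakGrad Ω u) - (gradient (φ m) - weakGrad Ω u) := by
        ext1 x
        have e1 : φ n - φ m = φ n + (-1 : ℝ) • φ m := by rw [neg_one_smul, sub_eq_add_neg]
        rw [e1, gradient_add_smul_apply (hφ n) (hφ m)]
        simp [sub_eq_add_neg]
      rw [e, two_mul, ENNReal.ofReal_add (hεp k).le (hεp k).le]
      exact (eLpNorm_sub_le ((c2 n).sub hg.1) ((c2 m).sub hg.1) hp1).trans
        (add_le_add ((h2 n).trans (ENNReal.ofReal_le_ofReal (hεanti hn)))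
          ((h2 m).trans (ENNReal.ofReal_le_ofReal (hεanti hm))))
    refine ((H _ ((hφ n).sub (hφ m))).trans (add_le_add (mul_le_mul' le_rfl b1)
      (mul_le_mul' le_rfl b2))).trans_lt ?_
    rw [← ENNReal.ofReal_mul hC, ← ENNReal.ofReal_mul zero_le_one,
      ← ENNReal.ofReal_add (by have := hεp k; positivity) (by have := hεp k; positivity)]
    refine (ENNReal.ofReal_lt_ofReal_iff (by positivity)).2 ?_
    have e : C * (2 * ε k) + 1 * (2 * ε k) = (1 / 2) ^ k / 2 := by
      simp only [hε]; field_simp; ring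
    rw [e]
    exact half_lt_self (by positivity)
  have hsum : ∑' n : ℕ, ENNReal.ofReal ((1 / 2) ^ n) ≠ ⊤ := by
    rw [← ENNReal.ofReal_tsum_of_nonneg (fun n => by positivity) summable_geometric_two]
    exact ENNReal.ofReal_ne_top
  obtain ⟨t, ht, hlim⟩ := Lp.cauchy_complete_eLpNorm hp1
    (fun n => memLp_surfaceMeasure_of_continuous hb (hφ n).continuous _) hsum hcau
  exact ⟨t, ht, φ, hφ,
    tendsto_of_tendsto_of_tendsto_of_le_of_le tendsto_const_nhds hlim0 (fun _ => zero_le) h1,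
    tendsto_of_tendsto_of_tendsto_of_le_of_le tendsto_const_nhds hlim0 (fun _ => zero_le) h2, hlim⟩

lemma isTrace_trace (hΩ : IsOpen Ω) (hb : Bornology.IsBounded Ω) (hs : HasSmoothBoundary Ω)
    (hq : 1 < q) {u : Eucl N → ℝ} (hu : u ∈ sobolev Ω q) : IsTrace Ω q u (trace Ω q u) := by
  have hex := exists_isTrace hΩ hb hs hq hu
  rw [trace, dif_pos hex]
  exact hex.choose_spec

lemma trace_ae_eq (hΩ : IsOpen Ω) (hb : Bornology.IsBounded Ω) (hs : HasSmoothBoundary Ω)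
    (hq : 1 < q) {u t : Eucl N → ℝ} (hu : u ∈ sobolev Ω q) (ht : IsTrace Ω q u t) :
    trace Ω q u =ᵐ[surfaceMeasure Ω] t :=
  (isTrace_trace hΩ hb hs hq hu).unique hΩ hb hs hq hu ht

lemma trace_add_smul (hΩ : IsOpen Ω) (hb : Bornology.IsBounded Ω) (hs : HasSmoothBoundary Ω)
    (hq : 1 < q) {u w : Eucl N → ℝ} (hu : u ∈ sobolev Ω q) (hw : w ∈ sobolev Ω q) (c : ℝ) :
    trace Ω q (u + c • w) =ᵐ[surfaceMeasure Ω] trace Ω q u + c • trace Ω q w :=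
  trace_ae_eq hΩ hb hs hq (add_smul_mem_sobolev hu hw c)
    ((isTrace_trace hΩ hb hs hq hu).add_smul hΩ hq hu hw (isTrace_trace hΩ hb hs hq hw) c)

lemma mem_sobolev_of_contDiff (hb : Bornology.IsBounded Ω) {φ : Eucl N → ℝ}
    (hφ : ContDiff ℝ ∞ φ) : φ ∈ sobolev Ω q := by
  have hfin : IsFiniteMeasure (volume.restrict Ω) := ⟨by simpa using hb.measure_lt_top⟩
  have hmem : ∀ {F : Type} [NormedAddCommGroup F] [SecondCountableTopology F] {f : Eucl N → F},
      Continuous f → MemLp f (ENNReal.ofReal q) (volume.restrict Ω) := by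
    intro F _ _ f hf
    obtain ⟨C, hC⟩ := hb.isCompact_closure.exists_bound_of_continuousOn hf.continuousOn
    refine MemLp.of_bound hf.aestronglyMeasurable C ?_
    have h1 : ∀ᵐ x ∂volume.restrict (closure Ω), x ∈ closure Ω :=
      ae_restrict_mem isClosed_closure.measurableSet
    filter_upwards [ae_mono (Measure.restrict_mono subset_closure le_rfl) h1] with x hx
    exact hC x hx
  exact ⟨hmem hφ.continuous, _, hmem (gradient_continuous hφ), hasWeakGradient_of_contDiff hφ⟩

end Trace

/-! ### A Poincaré inequality from compactness -/

section Poincare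

variable {V A B F : Type*} [AddCommGroup V] [Module ℝ V] [NormedAddCommGroup A] [NormedSpace ℝ A]
  [NormedAddCommGroup B] [NormedSpace ℝ B] [NormedAddCommGroup F] [NormedSpace ℝ F]
  {I : V →ₗ[ℝ] A} {D : V →ₗ[ℝ] B} {M : V →ₗ[ℝ] F} {e : V}

/-- If the graph norm `‖I v‖ + ‖D v‖` is compact relative to `‖I v‖`, and `D` has kernel spanned
by `e`, on which `M` does not vanish, then `‖I v‖ ≤ C (‖D v‖ + ‖M v‖)`. -/
lemma exists_poincare
    (hrel : ∀ v : ℕ → V, (∃ R, ∀ n, ‖I (v n)‖ ≤ R ∧ ‖D (v n)‖ ≤ R) →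
      ∃ φ : ℕ → ℕ, StrictMono φ ∧ ∃ y, Tendsto (fun n => I (v (φ n))) atTop (𝓝 y))
    (hM : ∀ ε > 0, ∃ C, 0 ≤ C ∧ ∀ v, ‖M v‖ ≤ C * ‖I v‖ + ε * ‖D v‖)
    (hcl : ∀ (w : ℕ → V) (y : A) (z : B), Tendsto (fun n => I (w n)) atTop (𝓝 y) →
      Tendsto (fun n => D (w n)) atTop (𝓝 z) → ∃ v, I v = y ∧ D v = z)
    (hker : ∀ v, D v = 0 → ∃ c : ℝ, I v = c • I e ∧ M v = c • M e) (hMe : M e ≠ 0) :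
    ∃ C, 0 ≤ C ∧ ∀ v, ‖I v‖ ≤ C * (‖D v‖ + ‖M v‖) := by
  by_contra! hcon
  choose u hu using fun n : ℕ => hcon n n.cast_nonneg
  have hpos : ∀ n, 0 < ‖I (u n)‖ := fun n =>
    lt_of_le_of_lt (by positivity) (hu n)
  set v : ℕ → V := fun n => ‖I (u n)‖⁻¹ • u n with hv
  have hv1 : ∀ n, ‖I (v n)‖ = 1 := fun n => by
    simp only [hv, map_smul, norm_smul, norm_inv, norm_norm]
    exact inv_mul_cancel₀ (hpos n).ne'
  have hvs : ∀ n : ℕ, (n : ℝ) * (‖D (v n)‖ + ‖M (v n)‖) ≤ 1 := fun n => by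
    simp only [hv, map_smul, norm_smul, norm_inv, norm_norm]
    rw [← mul_add, mul_left_comm, inv_mul_le_iff₀ (hpos n), mul_one]
    exact (hu n).le
  have hsum : Tendsto (fun n => ‖D (v n)‖ + ‖M (v n)‖) atTop (𝓝 0) := by
    refine tendsto_of_tendsto_of_tendsto_of_le_of_le' tendsto_const_nhds
      tendsto_one_div_atTop_nhds_zero_nat (.of_forall fun n => by positivity) ?_
    filter_upwards [eventually_gt_atTop 0] with n hn
    rw [le_div_iff₀ (by exact_mod_cast hn), mul_comm]
    exact hvs n
  have hD0 : Tendsto (fun n => ‖D (v n)‖) atTop (𝓝 0) :=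
    tendsto_of_tendsto_of_tendsto_of_le_of_le tendsto_const_nhds hsum
      (fun n => norm_nonneg _) fun n => le_add_of_nonneg_right (norm_nonneg _)
  have hM0 : Tendsto (fun n => ‖M (v n)‖) atTop (𝓝 0) :=
    tendsto_of_tendsto_of_tendsto_of_le_of_le tendsto_const_nhds hsum
      (fun n => norm_nonneg _) fun n => le_add_of_nonneg_left (norm_nonneg _)
  obtain ⟨R, hR⟩ := hD0.bddAbove_range
  obtain ⟨φ, hφ, y, hy⟩ := hrel v ⟨max R 1, fun n => ⟨(hv1 n).trans_le (le_max_right _ _),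
    le_max_of_le_left (hR ⟨n, rfl⟩)⟩⟩
  obtain ⟨w, hwI, hwD⟩ := hcl (fun n => v (φ n)) y 0 hy
    (tendsto_zero_iff_norm_tendsto_zero.2 (hD0.comp hφ.tendsto_atTop))
  have hy1 : ‖y‖ = 1 :=
    tendsto_nhds_unique hy.norm (by simp only [hv1]; exact tendsto_const_nhds)
  obtain ⟨c, hc, hcM⟩ := hker w hwD
  obtain ⟨C, hC, h1⟩ := hM 1 one_pos
  have hMw : M w = 0 := by
    have h2 : Tendsto (fun n => C * ‖I (v (φ n)) - y‖ + 1 * ‖D (v (φ n))‖ + ‖M (v (φ n))‖) atTop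
        (𝓝 0) := by
      have h3 := (((tendsto_iff_norm_sub_tendsto_zero.1 hy).const_mul C).add
        ((hD0.comp hφ.tendsto_atTop).const_mul 1)).add (hM0.comp hφ.tendsto_atTop)
      simpa using h3
    refine norm_le_zero_iff.1 (ge_of_tendsto' h2 fun n => ?_)
    have h4 := h1 (v (φ n) - w)
    rw [map_sub, map_sub, map_sub, hwI, hwD, sub_zero] at h4
    have h5 : M w = M (v (φ n)) - (M (v (φ n)) - M w) := by abel
    calc ‖M w‖ = ‖M (v (φ n)) - (M (v (φ n)) - M w)‖ := by rw [← h5]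
      _ ≤ ‖M (v (φ n))‖ + ‖M (v (φ n)) - M w‖ := norm_sub_le _ _
      _ ≤ _ := by linarith
  rw [hMw] at hcM
  have hc0 : c = 0 := (smul_eq_zero.1 hcM.symm).resolve_right hMe
  rw [hwI, hc0, zero_smul] at hc
  simp [hc] at hy1

/-- Compactness of `M` and closedness of `(D, M)`, deduced from the same properties of `I`. -/
lemma compact_and_closed_of_poincare [CompleteSpace A] [CompleteSpace B] [CompleteSpace F]
    (hrel : ∀ v : ℕ → V, (∃ R, ∀ n, ‖I (v n)‖ ≤ R ∧ ‖D (v n)‖ ≤ R) →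
      ∃ φ : ℕ → ℕ, StrictMono φ ∧ ∃ y, Tendsto (fun n => I (v (φ n))) atTop (𝓝 y))
    (hM : ∀ ε > 0, ∃ C, 0 ≤ C ∧ ∀ v, ‖M v‖ ≤ C * ‖I v‖ + ε * ‖D v‖)
    (hcl : ∀ (w : ℕ → V) (y : A) (z : B), Tendsto (fun n => I (w n)) atTop (𝓝 y) →
      Tendsto (fun n => D (w n)) atTop (𝓝 z) → ∃ v, I v = y ∧ D v = z)
    {C : ℝ} (hC : 0 ≤ C) (hP : ∀ v, ‖I v‖ ≤ C * (‖D v‖ + ‖M v‖)) :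
    (∀ v : ℕ → V, (∃ R, ∀ n, ‖D (v n)‖ ≤ R ∧ ‖M (v n)‖ ≤ R) →
      ∃ φ : ℕ → ℕ, StrictMono φ ∧ ∃ y, Tendsto (fun n => M (v (φ n))) atTop (𝓝 y)) ∧
    (∀ w : ℕ → V, CauchySeq (fun n => D (w n)) → CauchySeq (fun n => M (w n)) →
      ∃ v, Tendsto (fun n => D (w n)) atTop (𝓝 (D v)) ∧
        Tendsto (fun n => M (w n)) atTop (𝓝 (M v))) := by
  constructor
  · rintro v ⟨R, hR⟩
    have hI : ∀ n, ‖I (v n)‖ ≤ C * (2 * R) := fun n => (hP _).trans (by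
      have := hR n
      gcongr
      linarith)
    obtain ⟨φ, hφ, y, hy⟩ := hrel v ⟨max (C * (2 * R)) R, fun n =>
      ⟨le_max_of_le_left (hI n), le_max_of_le_right (hR n).1⟩⟩
    refine ⟨φ, hφ, cauchySeq_tendsto_of_complete ?_⟩
    have hR0 : 0 ≤ R := (norm_nonneg _).trans (hR 0).1
    rw [Metric.cauchySeq_iff]
    intro δ hδ
    obtain ⟨K, hK, h1⟩ := hM (δ / 2 / (2 * R + 1)) (by positivity)
    obtain ⟨n₀, hn₀⟩ := Metric.cauchySeq_iff.1 hy.cauchySeq (δ / 2 / (K + 1)) (by positivity)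
    refine ⟨n₀, fun k hk l hl => ?_⟩
    have h2 := h1 (v (φ k) - v (φ l))
    have h3 := hn₀ k hk l hl
    rw [dist_eq_norm, ← map_sub] at h3 ⊢
    have h4 : ‖D (v (φ k) - v (φ l))‖ ≤ 2 * R := by
      rw [map_sub]
      linarith [norm_sub_le (D (v (φ k))) (D (v (φ l))), (hR (φ k)).1, (hR (φ l)).1]
    have h5 : K * ‖I (v (φ k) - v (φ l))‖ ≤ δ / 2 * (K / (K + 1)) := by
      calc K * ‖I (v (φ k) - v (φ l))‖ ≤ K * (δ / 2 / (K + 1)) := by gcongr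
        _ = _ := by ring
    have h6 : δ / 2 / (2 * R + 1) * ‖D (v (φ k) - v (φ l))‖ < δ / 2 := by
      calc δ / 2 / (2 * R + 1) * ‖D (v (φ k) - v (φ l))‖ ≤ δ / 2 / (2 * R + 1) * (2 * R) := by
            gcongr
        _ < δ / 2 / (2 * R + 1) * (2 * R + 1) := by gcongr; linarith
        _ = δ / 2 := by field_simp
    have h7 : K / (K + 1) ≤ 1 := by rw [div_le_one (by positivity)]; linarith
    nlinarith
  · intro w hD hMw
    have hI : CauchySeq fun n => I (w n) := by
      rw [Metric.cauchySeq_iff] at hD hMw ⊢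
      intro δ hδ
      obtain ⟨n₁, hn₁⟩ := hD (δ / 2 / (C + 1)) (by positivity)
      obtain ⟨n₂, hn₂⟩ := hMw (δ / 2 / (C + 1)) (by positivity)
      refine ⟨max n₁ n₂, fun k hk l hl => ?_⟩
      have h1 := hn₁ k (le_of_max_le_left hk) l (le_of_max_le_left hl)
      have h2 := hn₂ k (le_of_max_le_right hk) l (le_of_max_le_right hl)
      rw [dist_eq_norm, ← map_sub] at h1 h2 ⊢
      calc ‖I (w k - w l)‖ ≤ C * (‖D (w k - w l)‖ + ‖M (w k - w l)‖) := hP _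
        _ ≤ C * (δ / 2 / (C + 1) + δ / 2 / (C + 1)) := by gcongr
        _ = δ * (C / (C + 1)) := by ring
        _ < δ * 1 := by
            gcongr
            rw [div_lt_one (by positivity)]; linarith
        _ = δ := mul_one _
    obtain ⟨y, hy⟩ := cauchySeq_tendsto_of_complete hI
    obtain ⟨z, hz⟩ := cauchySeq_tendsto_of_complete hD
    obtain ⟨v, rfl, rfl⟩ := hcl w y z hy hz
    refine ⟨v, hz, ?_⟩
    obtain ⟨K, hK, h1⟩ := hM 1 one_pos
    rw [tendsto_iff_norm_sub_tendsto_zero] at hy hz ⊢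
    have h2 := (hy.const_mul K).add (hz.const_mul 1)
    simp only [mul_zero, add_zero] at h2
    refine squeeze_zero (fun n => norm_nonneg _) (fun n => ?_) h2
    rw [← map_sub, ← map_sub, ← map_sub]
    exact h1 _

end Poincare

/-! ### The Sobolev space as a vector space, and the mass measure -/

section Setup

variable {N : ℕ} {Ω : Set (Eucl N)} {q : ℝ}

/-- The standing assumptions on `Ω`: a bounded domain with smooth boundary. -/
structure IsSmoothDomain (Ω : Set (Eucl N)) : Prop where
  isOpen : IsOpen Ω
  isConnected : IsConnected Ω
  isBounded : Bornology.IsBounded Ω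
  hasSmoothBoundary : HasSmoothBoundary Ω

/-- `W^{1,q}(Ω)` as a vector space of functions (not of classes). -/
def sobolevSpace (Ω : Set (Eucl N)) (q : ℝ) : Submodule ℝ (Eucl N → ℝ) where
  carrier := sobolev Ω q
  add_mem' {u w} hu hw := by simpa using add_smul_mem_sobolev hu hw 1
  zero_mem' := ⟨MemLp.zero, 0, MemLp.zero, by
    have h := hasWeakGradient_of_contDiff (Ω := Ω) (φ := fun _ : Eucl N => (0 : ℝ)) contDiff_const
    have h2 : gradient (fun _ : Eucl N => (0 : ℝ)) = 0 := by ext1 x; simp [gradient]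
    rwa [h2] at h⟩
  smul_mem' c u hu := by
    have h := add_smul_mem_sobolev hu hu (c - 1)
    have e : u + (c - 1) • u = c • u := by rw [sub_smul, one_smul]; abel
    rwa [e] at h

/-- The class of `u` in `L^q(Ω)`. -/
noncomputable def inclLp (Ω : Set (Eucl N)) (q : ℝ) :
    sobolevSpace Ω q →ₗ[ℝ] Lp ℝ (ENNReal.ofReal q) (volume.restrict Ω) where
  toFun u := u.2.1.toLp u
  map_add' _ _ := rfl
  map_smul' _ _ := rfl

/-- The class of `∇u` in `L^q(Ω; ℝ^N)`. -/
noncomputable def gradLp (hΩ : IsSmoothDomain Ω) (q : ℝ) :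
    sobolevSpace Ω q →ₗ[ℝ] Lp (Eucl N) (ENNReal.ofReal q) (volume.restrict Ω) where
  toFun u := (memLp_weakGrad hΩ.isOpen u.2).toLp (weakGrad Ω u)
  map_add' u w := by
    rw [← MemLp.toLp_add, MemLp.toLp_eq_toLp_iff]
    simpa using weakGrad_add_smul hΩ.isOpen u.2 w.2 1
  map_smul' c u := by
    rw [RingHom.id_apply, ← MemLp.toLp_const_smul, MemLp.toLp_eq_toLp_iff]
    exact weakGrad_ae_eq hΩ.isOpen ((hasWeakGradient_weakGrad u.2).const_smul c)

/-- The measure `a dx ⊕ b dσ` on the disjoint union of two copies of `ℝ^N`: integrating the pair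
`(u, trace u)` against it gives the integrals over `Ω` and over `∂Ω` at once. -/
noncomputable def massMeasure (Ω : Set (Eucl N)) (a b : Eucl N → ℝ) :
    Measure (Eucl N ⊕ Eucl N) :=
  ((volume.restrict Ω).withDensity fun x => ENNReal.ofReal (a x)).map Sum.inl +
    ((surfaceMeasure Ω).withDensity fun x => ENNReal.ofReal (b x)).map Sum.inr

variable {a b : Eucl N → ℝ}

lemma measurableEmbedding_inl {X Y : Type*} [MeasurableSpace X] [MeasurableSpace Y] :
    MeasurableEmbedding (Sum.inl : X → X ⊕ Y) :=
  ⟨Sum.inl_injective, measurable_inl, fun _ hs => hs.inl_image⟩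

lemma measurableEmbedding_inr {X Y : Type*} [MeasurableSpace X] [MeasurableSpace Y] :
    MeasurableEmbedding (Sum.inr : Y → X ⊕ Y) :=
  ⟨Sum.inr_injective, measurable_inr, fun _ hs => hs.inr_image⟩

lemma ae_massMeasure_of {P : Eucl N ⊕ Eucl N → Prop}
    (h : ∀ᵐ x ∂volume.restrict Ω, P (Sum.inl x)) (h' : ∀ᵐ x ∂surfaceMeasure Ω, P (Sum.inr x)) :
    ∀ᵐ z ∂massMeasure Ω a b, P z := by
  rw [massMeasure, ae_add_measure_iff, measurableEmbedding_inl.ae_map_iff,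
    measurableEmbedding_inr.ae_map_iff]
  exact ⟨(withDensity_absolutelyContinuous _ _).ae_le h,
    (withDensity_absolutelyContinuous _ _).ae_le h'⟩

lemma integral_massMeasure (ha : AEMeasurable a (volume.restrict Ω))
    (ha0 : 0 ≤ᵐ[volume.restrict Ω] a) (hb : AEMeasurable b (surfaceMeasure Ω))
    (hb0 : 0 ≤ᵐ[surfaceMeasure Ω] b) {f : Eucl N ⊕ Eucl N → ℝ}
    (hf : Integrable f (massMeasure Ω a b)) :
    ∫ z, f z ∂massMeasure Ω a b = (∫ x in Ω, a x * f (Sum.inl x)) +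
      ∫ x, b x * f (Sum.inr x) ∂surfaceMeasure Ω := by
  rw [massMeasure, integrable_add_measure] at hf
  rw [massMeasure, integral_add_measure hf.1 hf.2, measurableEmbedding_inl.integral_map,
    measurableEmbedding_inr.integral_map,
    integral_withDensity_eq_integral_toReal_smul₀ ha.ennreal_ofReal (by simp),
    integral_withDensity_eq_integral_toReal_smul₀ hb.ennreal_ofReal (by simp)]
  congr 1
  · refine integral_congr_ae ?_
    filter_upwards [ha0] with x hx
    rw [ENNReal.toReal_ofReal hx, smul_eq_mul]
  · refine integral_congr_ae ?_
    filter_upwards [hb0] with x hx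
    rw [ENNReal.toReal_ofReal hx, smul_eq_mul]

lemma exists_massMeasure_le (ha : MemLp a ∞ (volume.restrict Ω))
    (hb : MemLp b ∞ (surfaceMeasure Ω)) :
    ∃ K : ℝ, 1 ≤ K ∧ massMeasure Ω a b ≤ ENNReal.ofReal K •
      ((volume.restrict Ω).map Sum.inl + (surfaceMeasure Ω).map Sum.inr) := by
  have key : ∀ (ν : Measure (Eucl N)) (a : Eucl N → ℝ), MemLp a ∞ ν → ∃ K : ℝ,
      ∀ L, K ≤ L → (ν.withDensity fun x => ENNReal.ofReal (a x)) ≤ ENNReal.ofReal L • ν := by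
    intro ν a ha
    refine ⟨(eLpNorm a ∞ ν).toReal, fun L hL => ?_⟩
    rw [← withDensity_const]
    refine withDensity_mono ?_
    have h1 := ae_le_eLpNormEssSup (f := a) (μ := ν)
    filter_upwards [h1] with x hx
    refine le_trans ?_ (ENNReal.ofReal_le_ofReal hL)
    rw [ENNReal.ofReal_toReal ha.2.ne, eLpNorm_exponent_top]
    refine le_trans ?_ hx
    rw [← ofReal_norm]
    exact ENNReal.ofReal_le_ofReal (le_abs_self _)
  obtain ⟨K, hK⟩ := key _ a ha
  obtain ⟨K', hK'⟩ := key _ b hb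
  refine ⟨max 1 (max K K'), le_max_left _ _, ?_⟩
  rw [smul_add, ← Measure.map_smul, ← Measure.map_smul]
  exact add_le_add (Measure.map_mono (hK _ (by simp)) measurable_inl)
    (Measure.map_mono (hK' _ (by simp)) measurable_inr)

lemma aestronglyMeasurable_sumElim {ν ν' : Measure (Eucl N)} {u t : Eucl N → ℝ}
    (hu : AEStronglyMeasurable u ν) (ht : AEStronglyMeasurable t ν') :
    AEStronglyMeasurable (Sum.elim u t) (ν.map Sum.inl + ν'.map Sum.inr) := by
  rw [aestronglyMeasurable_add_measure_iff, measurableEmbedding_inl.aestronglyMeasurable_map_iff,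
    measurableEmbedding_inr.aestronglyMeasurable_map_iff]
  exact ⟨hu, ht⟩

/-- `L^q(Ω) ⊕ L^q(∂Ω)` embeds into `L^q` of the mass measure. -/
lemma exists_eLpNorm_sumElim_le (hq : 1 < q) (ha : MemLp a ∞ (volume.restrict Ω))
    (hb : MemLp b ∞ (surfaceMeasure Ω)) :
    ∃ K : ℝ, 1 ≤ K ∧ ∀ u t : Eucl N → ℝ, MemLp u (ENNReal.ofReal q) (volume.restrict Ω) →
      MemLp t (ENNReal.ofReal q) (surfaceMeasure Ω) →
      MemLp (Sum.elim u t) (ENNReal.ofReal q) (massMeasure Ω a b) ∧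
      eLpNorm (Sum.elim u t) (ENNReal.ofReal q) (massMeasure Ω a b) ≤
        ENNReal.ofReal K * (eLpNorm u (ENNReal.ofReal q) (volume.restrict Ω) +
          eLpNorm t (ENNReal.ofReal q) (surfaceMeasure Ω)) := by
  have hq0 : 0 < q := by linarith
  obtain ⟨K, hK1, hK⟩ := exists_massMeasure_le ha hb
  refine ⟨K, hK1, fun u t hu ht => ?_⟩
  have hle : eLpNorm (Sum.elim u t) (ENNReal.ofReal q) (massMeasure Ω a b) ≤
        ENNReal.ofReal K * (eLpNorm u (ENNReal.ofReal q) (volume.restrict Ω) +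
          eLpNorm t (ENNReal.ofReal q) (surfaceMeasure Ω)) := by
    rw [← ENNReal.rpow_le_rpow_iff hq0, ENNReal.mul_rpow_of_nonneg _ _ hq0.le,
      eLpNorm_rpow_eq_lintegral hq0]
    refine (lintegral_mono' hK le_rfl).trans ?_
    rw [lintegral_smul_measure, smul_eq_mul, lintegral_add_measure,
      measurableEmbedding_inl.lintegral_map, measurableEmbedding_inr.lintegral_map]
    refine mul_le_mul' ?_ ?_
    · rw [ENNReal.ofReal_rpow_of_nonneg (by linarith) hq0.le]
      exact ENNReal.ofReal_le_ofReal (Real.self_le_rpow_of_one_le hK1 hq.le)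
    · simp only [Sum.elim_inl, Sum.elim_inr]
      rw [← eLpNorm_rpow_eq_lintegral hq0, ← eLpNorm_rpow_eq_lintegral hq0]
      exact ENNReal.add_rpow_le_rpow_add _ _ hq.le
  refine ⟨⟨((aestronglyMeasurable_sumElim hu.1 ht.1).smul_measure (ENNReal.ofReal K)).mono_measure
    hK, hle.trans_lt (ENNReal.mul_lt_top ENNReal.ofReal_lt_top
      (ENNReal.add_lt_top.2 ⟨hu.2, ht.2⟩))⟩, hle⟩

lemma memLp_sumElim_trace (hΩ : IsSmoothDomain Ω) (hq : 1 < q)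
    (ha : MemLp a ∞ (volume.restrict Ω)) (hb : MemLp b ∞ (surfaceMeasure Ω)) {u : Eucl N → ℝ}
    (hu : u ∈ sobolev Ω q) :
    MemLp (Sum.elim u (trace Ω q u)) (ENNReal.ofReal q) (massMeasure Ω a b) := by
  obtain ⟨K, -, h⟩ := exists_eLpNorm_sumElim_le hq ha hb
  exact (h u _ hu.1
    (isTrace_trace hΩ.isOpen hΩ.isBounded hΩ.hasSmoothBoundary hq hu).1).1

/-- The class of `(u, trace u)` in `L^q(a dx ⊕ b dσ)`. -/
noncomputable def massLp (hΩ : IsSmoothDomain Ω) (hq : 1 < q)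
    (ha : MemLp a ∞ (volume.restrict Ω)) (hb : MemLp b ∞ (surfaceMeasure Ω)) :
    sobolevSpace Ω q →ₗ[ℝ] Lp ℝ (ENNReal.ofReal q) (massMeasure Ω a b) where
  toFun u := (memLp_sumElim_trace hΩ hq ha hb u.2).toLp (Sum.elim u (trace Ω q u))
  map_add' u w := by
    rw [← MemLp.toLp_add, MemLp.toLp_eq_toLp_iff]
    refine ae_massMeasure_of (.of_forall fun x => rfl) ?_
    have h := trace_add_smul hΩ.isOpen hΩ.isBounded hΩ.hasSmoothBoundary hq u.2 w.2 1
    rw [one_smul, one_smul] at h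
    filter_upwards [h] with x hx
    exact hx
  map_smul' c u := by
    rw [RingHom.id_apply, ← MemLp.toLp_const_smul, MemLp.toLp_eq_toLp_iff]
    refine ae_massMeasure_of (.of_forall fun x => rfl) ?_
    have h := trace_add_smul hΩ.isOpen hΩ.isBounded hΩ.hasSmoothBoundary hq u.2 u.2 (c - 1)
    have e : (u : Eucl N → ℝ) + (c - 1) • (u : Eucl N → ℝ) = c • (u : Eucl N → ℝ) := by
      rw [sub_smul, one_smul]; abel
    rw [e] at h
    filter_upwards [h] with x hx
    change trace Ω q (c • (u : Eucl N → ℝ)) x = c * trace Ω q u x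
    rw [hx]
    simp only [Pi.add_apply, Pi.smul_apply, smul_eq_mul]
    ring

end Setup

/-! ### Functional-analytic properties of the gradient and mass maps -/

section Properties

variable {N : ℕ} {Ω : Set (Eucl N)} {q : ℝ} {a b : Eucl N → ℝ}

lemma IsSmoothDomain.isFiniteMeasure (hΩ : IsSmoothDomain Ω) :
    IsFiniteMeasure (volume.restrict Ω) :=
  ⟨by simpa using hΩ.isBounded.measure_lt_top⟩

lemma fact_one_le_ofReal (hq : 1 < q) : Fact ((1 : ℝ≥0∞) ≤ ENNReal.ofReal q) :=
  ⟨by rw [← ENNReal.ofReal_one]; exact ENNReal.ofReal_le_ofReal hq.le⟩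

lemma HasWeakGradient.congr (hΩ : IsSmoothDomain Ω) {p : ℝ≥0∞} (hp : 1 ≤ p)
    {u u' : Eucl N → ℝ} {g g' : Eucl N → Eucl N} (h : HasWeakGradient Ω u g)
    (hu : MemLp u p (volume.restrict Ω)) (hg : MemLp g p (volume.restrict Ω))
    (huu : u =ᵐ[volume.restrict Ω] u') (hgg : g =ᵐ[volume.restrict Ω] g') :
    HasWeakGradient Ω u' g' := by
  have := hΩ.isFiniteMeasure
  refine hasWeakGradient_of_tendsto hp (fun _ : ℕ => h) (fun _ => hu) (fun _ => hg)
    (hu.ae_eq huu) (hg.ae_eq hgg) ?_ ?_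
  · have h0 : u - u' =ᵐ[volume.restrict Ω] 0 := by
      filter_upwards [huu] with x hx
      simp [hx]
    simp [eLpNorm_congr_ae h0]
  · have h0 : g - g' =ᵐ[volume.restrict Ω] 0 := by
      filter_upwards [hgg] with x hx
      simp [hx]
    simp [eLpNorm_congr_ae h0]

lemma coeFn_inclLp (u : sobolevSpace Ω q) : inclLp Ω q u =ᵐ[volume.restrict Ω] u :=
  MemLp.coeFn_toLp u.2.1

lemma coeFn_gradLp (hΩ : IsSmoothDomain Ω) (u : sobolevSpace Ω q) :
    gradLp hΩ q u =ᵐ[volume.restrict Ω] weakGrad Ω u :=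
  MemLp.coeFn_toLp (memLp_weakGrad hΩ.isOpen u.2)

lemma coeFn_massLp (hΩ : IsSmoothDomain Ω) (hq : 1 < q) (ha : MemLp a ∞ (volume.restrict Ω))
    (hb : MemLp b ∞ (surfaceMeasure Ω)) (u : sobolevSpace Ω q) :
    massLp hΩ hq ha hb u =ᵐ[massMeasure Ω a b] Sum.elim u (trace Ω q u) :=
  MemLp.coeFn_toLp (memLp_sumElim_trace hΩ hq ha hb u.2)

lemma gradLp_eq_zero_iff (hΩ : IsSmoothDomain Ω) (u : sobolevSpace Ω q) :
    gradLp hΩ q u = 0 ↔ weakGrad Ω u =ᵐ[volume.restrict Ω] 0 := by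
  rw [Lp.eq_zero_iff_ae_eq_zero]
  exact ⟨(coeFn_gradLp hΩ u).symm.trans, (coeFn_gradLp hΩ u).trans⟩

lemma isZeroOn_iff (u : sobolevSpace Ω q) : IsZeroOn Ω u ↔ inclLp Ω q u = 0 := by
  rw [Lp.eq_zero_iff_ae_eq_zero]
  exact ⟨(coeFn_inclLp u).trans, (coeFn_inclLp u).symm.trans⟩

lemma enorm_inclLp (u : sobolevSpace Ω q) :
    ‖inclLp Ω q u‖ₑ = eLpNorm (u : Eucl N → ℝ) (ENNReal.ofReal q) (volume.restrict Ω) := by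
  rw [Lp.enorm_def, eLpNorm_congr_ae (coeFn_inclLp u)]

lemma enorm_gradLp (hΩ : IsSmoothDomain Ω) (u : sobolevSpace Ω q) :
    ‖gradLp hΩ q u‖ₑ = eLpNorm (weakGrad Ω u) (ENNReal.ofReal q) (volume.restrict Ω) := by
  rw [Lp.enorm_def, eLpNorm_congr_ae (coeFn_gradLp hΩ u)]

/-- The constant function `1` as an element of `W^{1,q}(Ω)`. -/
def oneSobolev (hΩ : IsSmoothDomain Ω) (q : ℝ) : sobolevSpace Ω q :=
  ⟨fun _ => 1, mem_sobolev_of_contDiff hΩ.isBounded contDiff_const⟩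

lemma weakGrad_one (hΩ : IsSmoothDomain Ω) :
    weakGrad Ω (fun _ => (1 : ℝ)) =ᵐ[volume.restrict Ω] 0 := by
  have h2 : gradient (fun _ : Eucl N => (1 : ℝ)) = 0 := by ext1 x; simp [gradient]
  have h := weakGrad_ae_eq hΩ.isOpen (hasWeakGradient_of_contDiff (Ω := Ω)
    (φ := fun _ : Eucl N => (1 : ℝ)) contDiff_const)
  rwa [h2] at h

lemma gradLp_one (hΩ : IsSmoothDomain Ω) : gradLp hΩ q (oneSobolev hΩ q) = 0 := by
  rw [gradLp_eq_zero_iff]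
  exact weakGrad_one hΩ

lemma trace_ae_eq_of_contDiff (hΩ : IsSmoothDomain Ω) (hq : 1 < q) {φ : Eucl N → ℝ}
    (hφ : ContDiff ℝ ∞ φ) : trace Ω q φ =ᵐ[surfaceMeasure Ω] φ := by
  have := isFiniteMeasure_surfaceMeasure hΩ.isOpen hΩ.isBounded hΩ.hasSmoothBoundary
  exact trace_ae_eq hΩ.isOpen hΩ.isBounded hΩ.hasSmoothBoundary hq
    (mem_sobolev_of_contDiff hΩ.isBounded hφ) (isTrace_of_contDiff hΩ.isOpen hΩ.isBounded hφ)

/-- Rellich's theorem in sequential form. -/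
lemma exists_subseq_inclLp (hΩ : IsSmoothDomain Ω) (hq : 1 < q)
    [Fact ((1 : ℝ≥0∞) ≤ ENNReal.ofReal q)] (v : ℕ → sobolevSpace Ω q)
    (hv : ∃ R, ∀ n, ‖inclLp Ω q (v n)‖ ≤ R ∧ ‖gradLp hΩ q (v n)‖ ≤ R) :
    ∃ φ : ℕ → ℕ, StrictMono φ ∧ ∃ y, Tendsto (fun n => inclLp Ω q (v (φ n))) atTop (𝓝 y) := by
  obtain ⟨R, hR⟩ := hv
  have htb := totallyBounded_sobolevBall hΩ.isOpen hΩ.isBounded hΩ.hasSmoothBoundary hq R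
  have hcpt := htb.closure.isCompact_of_isClosed isClosed_closure
  obtain ⟨y, -, φ, hφ, hy⟩ := hcpt.tendsto_subseq (x := fun n => inclLp Ω q (v n)) fun n => by
    refine subset_closure ?_
    have h1 := coeFn_inclLp (v n)
    have hg := memLp_weakGrad hΩ.isOpen (v n).2
    refine ⟨Lp.memLp _, ?_, weakGrad Ω (v n), ?_, hg, ?_⟩
    · rw [← Lp.enorm_def, ← ofReal_norm]
      exact ENNReal.ofReal_le_ofReal (hR n).1
    · exact (hasWeakGradient_weakGrad (v n).2).congr hΩ Fact.out (v n).2.1 hg h1.symm (ae_eq_refl _)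
    · rw [← enorm_gradLp hΩ, ← ofReal_norm]
      exact ENNReal.ofReal_le_ofReal (hR n).2
  exact ⟨φ, hφ, y, hy⟩

/-- The coefficient of the gradient can be made arbitrarily small, which makes `massLp` compact
relative to `gradLp`. -/
lemma exists_norm_massLp_le (hΩ : IsSmoothDomain Ω) (hq : 1 < q)
    (ha : MemLp a ∞ (volume.restrict Ω)) (hb : MemLp b ∞ (surfaceMeasure Ω))
    [Fact ((1 : ℝ≥0∞) ≤ ENNReal.ofReal q)] {ε : ℝ} (hε : 0 < ε) :
    ∃ C, 0 ≤ C ∧ ∀ v, ‖massLp hΩ hq ha hb v‖ ≤ C * ‖inclLp Ω q v‖ + ε * ‖gradLp hΩ q v‖ := by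
  obtain ⟨K, hK1, hK⟩ := exists_eLpNorm_sumElim_le hq ha hb
  have hK0 : 0 < K := by linarith
  obtain ⟨C, hC, H⟩ := exists_eLpNorm_surfaceMeasure_le hΩ.isOpen hΩ.isBounded
    hΩ.hasSmoothBoundary hq (div_pos hε hK0)
  refine ⟨K * (1 + C), by positivity, fun v => ?_⟩
  have ht := isTrace_trace hΩ.isOpen hΩ.isBounded hΩ.hasSmoothBoundary hq v.2
  have h1 := (hK v _ v.2.1 ht.1).2
  have h2 := IsTrace.eLpNorm_le hΩ.isOpen hq H v.2 ht
  have e1 : eLpNorm (v : Eucl N → ℝ) (ENNReal.ofReal q) (volume.restrict Ω) =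
      ENNReal.ofReal ‖inclLp Ω q v‖ := by
    rw [ofReal_norm, enorm_inclLp]
  have e2 : eLpNorm (weakGrad Ω v) (ENNReal.ofReal q) (volume.restrict Ω) =
      ENNReal.ofReal ‖gradLp hΩ q v‖ := by
    rw [ofReal_norm, enorm_gradLp]
  rw [e1, e2, ← ENNReal.ofReal_mul hC, ← ENNReal.ofReal_mul (by positivity),
    ← ENNReal.ofReal_add (by positivity) (by positivity)] at h2
  have h3 := h1.trans (mul_le_mul' le_rfl (add_le_add le_rfl h2))
  rw [e1, ← ENNReal.ofReal_add (by positivity) (by positivity),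
    ← ENNReal.ofReal_mul hK0.le] at h3
  have e3 : ‖massLp hΩ hq ha hb v‖ = (eLpNorm (Sum.elim v (trace Ω q v)) (ENNReal.ofReal q)
      (massMeasure Ω a b)).toReal := by
    rw [Lp.norm_def, eLpNorm_congr_ae (coeFn_massLp hΩ hq ha hb v)]
  rw [e3]
  refine ENNReal.toReal_le_of_le_ofReal (by positivity) (h3.trans (le_of_eq ?_))
  congr 1
  field_simp
  ring

/-- `W^{1,q}(Ω)` is complete. -/
lemma exists_of_tendsto_inclLp_gradLp (hΩ : IsSmoothDomain Ω)
    [Fact ((1 : ℝ≥0∞) ≤ ENNReal.ofReal q)] (w : ℕ → sobolevSpace Ω q)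
    (y : Lp ℝ (ENNReal.ofReal q) (volume.restrict Ω))
    (z : Lp (Eucl N) (ENNReal.ofReal q) (volume.restrict Ω))
    (hy : Tendsto (fun n => inclLp Ω q (w n)) atTop (𝓝 y))
    (hz : Tendsto (fun n => gradLp hΩ q (w n)) atTop (𝓝 z)) :
    ∃ v, inclLp Ω q v = y ∧ gradLp hΩ q v = z := by
  have := hΩ.isFiniteMeasure
  rw [← Lp.toLp_coeFn y (Lp.memLp y)] at hy
  rw [← Lp.toLp_coeFn z (Lp.memLp z)] at hz
  have hy' := (Lp.tendsto_Lp_iff_tendsto_eLpNorm'' _ (fun n => (w n).2.1) _ (Lp.memLp y)).1 hy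
  have hz' := (Lp.tendsto_Lp_iff_tendsto_eLpNorm'' _ (fun n => memLp_weakGrad hΩ.isOpen (w n).2) _
    (Lp.memLp z)).1 hz
  have hwg : HasWeakGradient Ω y z := hasWeakGradient_of_tendsto Fact.out
    (fun n => hasWeakGradient_weakGrad (w n).2) (fun n => (w n).2.1)
    (fun n => memLp_weakGrad hΩ.isOpen (w n).2) (Lp.memLp y) (Lp.memLp z) hy' hz'
  exact ⟨⟨y, Lp.memLp y, z, Lp.memLp z, hwg⟩, Lp.ext (coeFn_inclLp _),
    Lp.ext ((coeFn_gradLp hΩ _).trans (weakGrad_ae_eq hΩ.isOpen hwg))⟩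

lemma eq_smul_one_of_gradLp_eq_zero (hΩ : IsSmoothDomain Ω) (hq : 1 < q)
    (ha : MemLp a ∞ (volume.restrict Ω)) (hb : MemLp b ∞ (surfaceMeasure Ω))
    [Fact ((1 : ℝ≥0∞) ≤ ENNReal.ofReal q)] (v : sobolevSpace Ω q) (hv : gradLp hΩ q v = 0) :
    ∃ c : ℝ, inclLp Ω q v = c • inclLp Ω q (oneSobolev hΩ q) ∧
      massLp hΩ hq ha hb v = c • massLp hΩ hq ha hb (oneSobolev hΩ q) := by
  have hg := (gradLp_eq_zero_iff hΩ v).1 hv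
  have hw : HasWeakGradient Ω v 0 := (hasWeakGradient_weakGrad v.2).congr hΩ Fact.out v.2.1
    (memLp_weakGrad hΩ.isOpen v.2) (ae_eq_refl _) hg
  obtain ⟨c, hc⟩ := ae_eq_const_of_hasWeakGradient_zero hΩ.isOpen hΩ.isConnected hΩ.isBounded
    hΩ.hasSmoothBoundary hq hw v.2.1
  have hI : inclLp Ω q v = c • inclLp Ω q (oneSobolev hΩ q) := by
    rw [← map_smul]
    refine Lp.ext ?_
    filter_upwards [hc, coeFn_inclLp v, coeFn_inclLp (c • oneSobolev hΩ q)] with x hx h1 h2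
    rw [h1, h2, hx]
    exact (mul_one c).symm
  refine ⟨c, hI, ?_⟩
  obtain ⟨C, hC, H⟩ := exists_norm_massLp_le hΩ hq ha hb one_pos
  have h1 := H (v - c • oneSobolev hΩ q)
  simp only [map_sub, map_smul, hI, sub_self, norm_zero, mul_zero, hv, gradLp_one, smul_zero,
    add_zero] at h1
  exact sub_eq_zero.1 (norm_le_zero_iff.1 h1)

/-- The mass measure does not charge points, so the coordinate functions cannot all be constant
almost everywhere for it. -/
lemma exists_massLp_ne_smul_one (hN : 2 ≤ N) (hΩ : IsSmoothDomain Ω) (hq : 1 < q)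
    (ha : MemLp a ∞ (volume.restrict Ω)) (hb : MemLp b ∞ (surfaceMeasure Ω))
    [Fact ((1 : ℝ≥0∞) ≤ ENNReal.ofReal q)] (h1 : massLp hΩ hq ha hb (oneSobolev hΩ q) ≠ 0) :
    ∃ v, ∀ c : ℝ, massLp hΩ hq ha hb v ≠ c • massLp hΩ hq ha hb (oneSobolev hΩ q) := by
  by_contra! hcon
  have hcoord : ∀ i : Fin N, ContDiff ℝ ∞ fun x : Eucl N => x i := fun i => by fun_prop
  set X : Fin N → sobolevSpace Ω q := fun i =>
    ⟨fun x => x i, mem_sobolev_of_contDiff hΩ.isBounded (hcoord i)⟩ with hX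
  choose c hc using fun i => hcon (X i)
  have hpt : ∀ i, ∀ᵐ z ∂massMeasure Ω a b, (Sum.elim id id z : Eucl N) i = c i := by
    intro i
    have e := hc i
    rw [← map_smul] at e
    have e1 := coeFn_massLp hΩ hq ha hb (X i)
    have e1' := coeFn_massLp hΩ hq ha hb (c i • oneSobolev hΩ q)
    rw [e] at e1
    have e2 : ∀ᵐ z ∂massMeasure Ω a b, Sum.elim (X i : Eucl N → ℝ) (trace Ω q (X i)) z =
        (Sum.elim id id z : Eucl N) i := by
      refine ae_massMeasure_of (.of_forall fun x => rfl) ?_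
      filter_upwards [trace_ae_eq_of_contDiff hΩ hq (hcoord i)] with x hx
      exact hx
    have e3 : ∀ᵐ z ∂massMeasure Ω a b, Sum.elim
        ((c i • oneSobolev hΩ q : sobolevSpace Ω q) : Eucl N → ℝ)
          (trace Ω q (c i • oneSobolev hΩ q : sobolevSpace Ω q)) z = c i := by
      refine ae_massMeasure_of (.of_forall fun x => mul_one _) ?_
      have h2 : ContDiff ℝ ∞ ((c i • oneSobolev hΩ q : sobolevSpace Ω q) : Eucl N → ℝ) :=
        contDiff_const.const_smul (c i)
      filter_upwards [trace_ae_eq_of_contDiff hΩ hq h2] with x hx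
      exact hx.trans (mul_one _)
    filter_upwards [e1, e1', e2, e3] with z h2 h2' h3 h4
    rw [← h3, ← h2, h2', h4]
  have hpt' : ∀ᵐ z ∂massMeasure Ω a b, (Sum.elim id id z : Eucl N) = WithLp.toLp 2 c := by
    filter_upwards [ae_all_iff.2 hpt] with z hz
    ext i
    exact hz i
  have hne : ∀ᵐ z ∂massMeasure Ω a b, (Sum.elim id id z : Eucl N) ≠ WithLp.toLp 2 c := by
    refine ae_massMeasure_of (ae_restrict_of_ae ?_) (ae_restrict_of_ae ?_)
    · have : Nonempty (Fin N) := ⟨⟨0, by omega⟩⟩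
      have h2 : (volume : Measure (Eucl N)) {WithLp.toLp 2 c} = 0 := measure_singleton _
      exact compl_mem_ae_iff.2 h2
    · have h2 : (Measure.euclideanHausdorffMeasure (N - 1) : Measure (Eucl N))
          {WithLp.toLp 2 c} = 0 := by
        have := Measure.nullSingletonClass_hausdorff (Eucl N) (d := ((N - 1 : ℕ) : ℝ))
          (by exact_mod_cast (by omega : 0 < N - 1))
        rw [Measure.euclideanHausdorffMeasure_def, Measure.smul_apply, measure_singleton, smul_zero]
      exact compl_mem_ae_iff.2 h2
  refine h1 ((Lp.eq_zero_iff_ae_eq_zero).2 ?_)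
  filter_upwards [hpt', hne] with z h2 h3
  exact absurd h2 h3

end Properties

/-! ### Energy, mass and their first variations -/

section Values

variable {N : ℕ} {Ω : Set (Eucl N)} {q : ℝ} {a b : Eucl N → ℝ}

lemma norm_gradLp_rpow (hΩ : IsSmoothDomain Ω) (hq : 1 < q) (u : sobolevSpace Ω q) :
    ‖gradLp hΩ q u‖ ^ q = energy Ω q u := by
  rw [Lp_norm_rpow_eq (by linarith), energy]
  refine integral_congr_ae ?_
  filter_upwards [coeFn_gradLp hΩ u] with x hx
  rw [hx]

lemma firstVariation_gradLp (hΩ : IsSmoothDomain Ω) (u w : sobolevSpace Ω q) :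
    firstVariation q (volume.restrict Ω) (gradLp hΩ q u) (gradLp hΩ q w) =
      ∫ x in Ω, ‖weakGrad Ω u x‖ ^ (q - 2) * inner ℝ (weakGrad Ω u x) (weakGrad Ω w x) :=
  firstVariation_congr (coeFn_gradLp hΩ u) (coeFn_gradLp hΩ w)

lemma norm_massLp_rpow (hΩ : IsSmoothDomain Ω) (hq : 1 < q)
    (ha : MemLp a ∞ (volume.restrict Ω)) (hb : MemLp b ∞ (surfaceMeasure Ω))
    (ha0 : 0 ≤ᵐ[volume.restrict Ω] a) (hb0 : 0 ≤ᵐ[surfaceMeasure Ω] b) (u : sobolevSpace Ω q) :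
    ‖massLp hΩ hq ha hb u‖ ^ q = weightedMass Ω q a b u := by
  have hq0 : 0 < q := by linarith
  have hm := memLp_sumElim_trace hΩ hq ha hb u.2
  have h := coeFn_massLp hΩ hq ha hb u
  have h' : (fun z => ‖massLp hΩ hq ha hb u z‖ ^ q) =ᵐ[massMeasure Ω a b]
      fun z => ‖Sum.elim (u : Eucl N → ℝ) (trace Ω q u) z‖ ^ q := h.fun_comp fun t => ‖t‖ ^ q
  rw [Lp_norm_rpow_eq hq0, integral_congr_ae h']
  exact integral_massMeasure ha.1.aemeasurable ha0 hb.1.aemeasurable hb0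
    (integrable_norm_rpow_of_memLp hq0 hm)

lemma firstVariation_massLp (hΩ : IsSmoothDomain Ω) (hq : 1 < q)
    (ha : MemLp a ∞ (volume.restrict Ω)) (hb : MemLp b ∞ (surfaceMeasure Ω))
    (ha0 : 0 ≤ᵐ[volume.restrict Ω] a) (hb0 : 0 ≤ᵐ[surfaceMeasure Ω] b)
    (u w : sobolevSpace Ω q) :
    firstVariation q (massMeasure Ω a b) (massLp hΩ hq ha hb u) (massLp hΩ hq ha hb w) =
      weightedForm Ω q a b u w := by
  have hm := memLp_sumElim_trace hΩ hq ha hb u.2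
  have hm' := memLp_sumElim_trace hΩ hq ha hb w.2
  have h := coeFn_massLp hΩ hq ha hb u
  have h' := coeFn_massLp hΩ hq ha hb w
  rw [firstVariation_congr h h', firstVariation, integral_massMeasure ha.1.aemeasurable ha0
    hb.1.aemeasurable hb0 (hasDerivAt_integral_norm_add_rpow hq hm hm').1, weightedForm]
  congr 1
  · refine integral_congr_ae (.of_forall fun x => ?_)
    simp only [Sum.elim_inl, Real.norm_eq_abs, RCLike.inner_apply, conj_trivial]
    ring
  · refine integral_congr_ae (.of_forall fun x => ?_)
    simp only [Sum.elim_inr, Real.norm_eq_abs, RCLike.inner_apply, conj_trivial]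
    ring

lemma mem_coneC_iff (hΩ : IsSmoothDomain Ω) (hq : 1 < q) (u : sobolevSpace Ω q) :
    (u : Eucl N → ℝ) ∈ coneC Ω q a b ↔ weightedForm Ω q a b u (oneSobolev hΩ q) = 0 := by
  have h1 : ∫ x, b x * |trace Ω q u x| ^ (q - 2) * trace Ω q u x *
      trace Ω q (oneSobolev hΩ q) x ∂(surfaceMeasure Ω) =
      ∫ x, b x * |trace Ω q u x| ^ (q - 2) * trace Ω q u x ∂(surfaceMeasure Ω) := by
    refine integral_congr_ae ?_
    filter_upwards [trace_ae_eq_of_contDiff (φ := fun _ => 1) hΩ hq contDiff_const] with x hx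
    change _ * trace Ω q (fun _ => 1) x = _
    rw [hx, mul_one]
  have h2 : ∫ x in Ω, a x * |(u : Eucl N → ℝ) x| ^ (q - 2) * (u : Eucl N → ℝ) x *
      (oneSobolev hΩ q : Eucl N → ℝ) x =
      ∫ x in Ω, a x * |(u : Eucl N → ℝ) x| ^ (q - 2) * (u : Eucl N → ℝ) x :=
    integral_congr_ae (.of_forall fun x => mul_one _)
  rw [weightedForm, h1, h2]
  exact ⟨fun h => h.2, fun h => ⟨u.2, h⟩⟩

lemma weightedMass_one (hΩ : IsSmoothDomain Ω) (hq : 1 < q) :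
    weightedMass Ω q a b (oneSobolev hΩ q) =
      (∫ x in Ω, a x) + ∫ x, b x ∂(surfaceMeasure Ω) := by
  rw [weightedMass]
  congr 1
  · refine integral_congr_ae (.of_forall fun x => ?_)
    simp [oneSobolev]
  · refine integral_congr_ae ?_
    filter_upwards [trace_ae_eq_of_contDiff (φ := fun _ => 1) hΩ hq contDiff_const] with x hx
    change _ * |trace Ω q (fun _ => 1) x| ^ q = _
    rw [hx, abs_one, Real.one_rpow, mul_one]

lemma gradLp_eq_zero_of_inclLp_eq_zero (hΩ : IsSmoothDomain Ω) (u : sobolevSpace Ω q)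
    (hu : inclLp Ω q u = 0) : gradLp hΩ q u = 0 := by
  rw [gradLp_eq_zero_iff]
  have h0 : weakGrad Ω (0 : Eucl N → ℝ) =ᵐ[volume.restrict Ω] 0 :=
    (gradLp_eq_zero_iff hΩ 0).1 (map_zero (gradLp hΩ q))
  exact ((hasWeakGradient_weakGrad u.2).unique hΩ.isOpen
    (hasWeakGradient_weakGrad (sobolevSpace Ω q).zero_mem) ((isZeroOn_iff u).2 hu)).trans h0

end Values

end SteklovLike
open SteklovLike in
theorem lemma1 {N : ℕ} (hN : 2 ≤ N) (Ω : Set (EuclideanSpace ℝ (Fin N)))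
    (hΩ_open : IsOpen Ω) (hΩ_conn : IsConnected Ω) (hΩ_bdd : Bornology.IsBounded Ω)
    (hΩ_smooth : HasSmoothBoundary Ω)
    (a b : EuclideanSpace ℝ (Fin N) → ℝ)
    (ha : MemLp a ∞ (volume.restrict Ω)) (ha_nonneg : 0 ≤ᵐ[volume.restrict Ω] a)
    (hb : MemLp b ∞ (surfaceMeasure Ω)) (hb_nonneg : 0 ≤ᵐ[surfaceMeasure Ω] b)
    (hab : 0 < (∫ x in Ω, a x) + ∫ x, b x ∂(surfaceMeasure Ω))
    (q : ℝ) (hq : 1 < q) :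
    ∃ u ∈ sphereC Ω q a b, ∃ μ : ℝ,
      μ = energy Ω q u ∧
      IsLeast (energy Ω q '' sphereC Ω q a b) μ ∧
      0 < μ ∧
      ENNReal.ofReal μ = lambdaOne Ω q a b ∧
      IsEigenfunction Ω q a b μ u ∧
      IsLeast {lam : ℝ | 0 < lam ∧ IsEigenvalue Ω q a b lam} μ := by
  have hq0 : 0 < q := by linarith
  have hfact := fact_one_le_ofReal hq
  have hΩ : IsSmoothDomain Ω := ⟨hΩ_open, hΩ_conn, hΩ_bdd, hΩ_smooth⟩
  set D := gradLp hΩ q with hD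
  set M := massLp hΩ hq ha hb with hM
  set e := oneSobolev hΩ q with he
  have hDe : D e = 0 := gradLp_one hΩ
  have hMn := fun u => norm_massLp_rpow hΩ hq ha hb ha_nonneg hb_nonneg u
  have hDn := fun u => norm_gradLp_rpow hΩ hq u
  have hMe : M e ≠ 0 := by
    intro h
    have h1 := hMn e
    rw [weightedMass_one hΩ hq, ← hM, h, norm_zero, Real.zero_rpow hq0.ne'] at h1
    linarith
  have hcentred : ∀ u, IsCentred M e u ↔ (u : Eucl N → ℝ) ∈ coneC Ω q a b := fun u => by
    rw [isCentred_iff_firstVariation_eq_zero hq, mem_coneC_iff hΩ hq,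
      firstVariation_massLp hΩ hq ha hb ha_nonneg hb_nonneg]
  have hrel := exists_subseq_inclLp hΩ hq
  have hMle := fun ε (hε : ε > 0) => exists_norm_massLp_le hΩ hq ha hb hε
  have hcl := exists_of_tendsto_inclLp_gradLp (q := q) hΩ
  have hker := eq_smul_one_of_gradLp_eq_zero hΩ hq ha hb
  obtain ⟨C, hC, hP⟩ := exists_poincare hrel hMle hcl hker hMe
  obtain ⟨hcomp, hclosed⟩ := compact_and_closed_of_poincare hrel hMle hcl hC hP
  obtain ⟨u, hu, hu1, hDu, hmin⟩ := exists_isCentred_minimiser hq hMe hcomp hclosed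
    (fun v hv => (hker v hv).imp fun c hc => hc.2) (exists_massLp_ne_smul_one hN hΩ hq ha hb hMe)
  have hEL := firstVariation_eq_of_minimiser hq hMe hDe hu hu1 hmin
  -- an element of the cone on which `M` or `D` vanishes is zero
  have hzero : ∀ v : sobolevSpace Ω q, D v = 0 → M v = 0 → IsZeroOn Ω v := by
    intro v hv hMv
    obtain ⟨c, h1, h2⟩ := hker v hv
    have hc : c = 0 := (smul_eq_zero.1 (h2.symm.trans hMv)).resolve_right hMe
    rw [isZeroOn_iff, h1, hc, zero_smul]
  have hminq : ∀ v : sobolevSpace Ω q, (v : Eucl N → ℝ) ∈ coneC Ω q a b →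
      energy Ω q u * weightedMass Ω q a b v ≤ energy Ω q v := by
    intro v hv
    rw [← hDn, ← hDn, ← hMn, ← Real.mul_rpow (norm_nonneg _) (norm_nonneg _)]
    exact Real.rpow_le_rpow (by positivity) (hmin v ((hcentred v).2 hv)) hq0.le
  have huC : (u : Eucl N → ℝ) ∈ coneC Ω q a b := (hcentred u).1 hu
  have hum : weightedMass Ω q a b u = 1 := by rw [← hMn, ← hM, hu1, Real.one_rpow]
  have hμ : 0 < energy Ω q u := by rw [← hDn]; exact Real.rpow_pos_of_pos hDu q
  have hu0 : ¬ IsZeroOn Ω u := fun h =>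
    hDu.ne' (by rw [gradLp_eq_zero_of_inclLp_eq_zero hΩ u ((isZeroOn_iff u).1 h), norm_zero])
  have heig : IsEigenfunction Ω q a b (energy Ω q u) u := by
    refine ⟨u.2, hu0, fun w hw => ?_⟩
    have h1 := hEL ⟨w, hw⟩
    rwa [hD, hM, firstVariation_gradLp, firstVariation_massLp hΩ hq ha hb ha_nonneg hb_nonneg,
      hDn] at h1
  refine ⟨u, ⟨huC, hum⟩, energy Ω q u, rfl, ⟨⟨u, ⟨huC, hum⟩, rfl⟩, ?_⟩, hμ, ?_, heig,
    ⟨hμ, u, heig⟩, ?_⟩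
  · rintro _ ⟨v, ⟨hv, hv1⟩, rfl⟩
    have h1 := hminq ⟨v, hv.1⟩ hv
    rwa [hv1, mul_one] at h1
  · refine le_antisymm (le_iInf₂ fun v hv => ?_) ?_
    · have h1 := hminq ⟨v, hv.1.1⟩ hv.1
      have hm0 : 0 ≤ weightedMass Ω q a b v := by
        rw [← hMn ⟨v, hv.1.1⟩]; positivity
      rcases hm0.eq_or_lt with h0 | h0
      · have hE0 : 0 < energy Ω q v := by
          rw [← hDn ⟨v, hv.1.1⟩]
          refine Real.rpow_pos_of_pos (norm_pos_iff.2 fun hDv => hv.2 ?_) q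
          refine hzero ⟨v, hv.1.1⟩ hDv ?_
          have h2 := hMn ⟨v, hv.1.1⟩
          rw [← h0] at h2
          exact norm_eq_zero.1 ((Real.rpow_eq_zero (norm_nonneg _) hq0.ne').1 h2)
        rw [← h0, ENNReal.ofReal_zero, ENNReal.div_zero (ENNReal.ofReal_pos.2 hE0).ne']
        exact le_top
      · rw [ENNReal.le_div_iff_mul_le (.inl (ENNReal.ofReal_pos.2 h0).ne')
          (.inl ENNReal.ofReal_ne_top), ← ENNReal.ofReal_mul hμ.le]
        exact ENNReal.ofReal_le_ofReal h1
    · refine (iInf₂_le (u : Eucl N → ℝ) ⟨huC, hu0⟩).trans ?_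
      rw [hum, ENNReal.ofReal_one, div_one]
  · rintro lam ⟨hlam, v, hv, hv0, hvw⟩
    set v' : sobolevSpace Ω q := ⟨v, hv⟩
    have hvar : ∀ w : sobolevSpace Ω q, firstVariation q (volume.restrict Ω) (D v') (D w) =
        lam * firstVariation q (massMeasure Ω a b) (M v') (M w) := fun w => by
      rw [hD, hM, firstVariation_gradLp, firstVariation_massLp hΩ hq ha hb ha_nonneg hb_nonneg]
      exact hvw w w.2
    -- testing with the constant `1` puts `v` into the cone, testing with `v` gives the quotient
    have hcone : IsCentred M e v' := by
      have h1 := hvar e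
      have h0 : firstVariation q (volume.restrict Ω) (D v') (D e) = 0 := by
        rw [hDe, firstVariation]
        refine integral_eq_zero_of_ae ?_
        filter_upwards [Lp.coeFn_zero (Eucl N) (ENNReal.ofReal q) (volume.restrict Ω)] with x hx
        rw [hx, Pi.zero_apply, inner_zero_right, mul_zero, Pi.zero_apply]
      rw [h0] at h1
      exact (isCentred_iff_firstVariation_eq_zero hq).2
        ((mul_eq_zero.1 h1.symm).resolve_left hlam.ne')
    have h2 := hvar v'
    rw [firstVariation_self hq0, firstVariation_self hq0, hDn, hMn] at h2
    have hm0 : 0 < weightedMass Ω q a b v' := by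
      rw [← hMn]
      refine Real.rpow_pos_of_pos (norm_pos_iff.2 fun hMv => hv0 ?_) q
      refine hzero v' ?_ hMv
      rw [← hMn, ← hM, hMv, norm_zero, Real.zero_rpow hq0.ne', mul_zero, ← hDn] at h2
      exact norm_eq_zero.1 ((Real.rpow_eq_zero (norm_nonneg _) hq0.ne').1 h2)
    have h3 := hminq v' ((hcentred v').1 hcone)
    rw [h2] at h3
    exact le_of_mul_le_mul_right h3 hm0
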